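/- Fix an odd integer $p \ge 3$ and put $c_0=\frac{2(p+1)}{(p-1)^2}$. Let $\mathcal H=L^2(0,1)\times L^2(0,1)$ (complex-valued functions) and, for $k\in\mathbb N$, $$\mathcal H^{2k}=\{\mathbf u\in H^{2k}(0,1)\times H^{2k}(0,1): u_1^{(2j)}(0)=u_2^{(2j+1)}(0)=0,\ 0\le j<k\},$$ with norm $\|\mathbf u\|_{\mathcal H^{2k}}^2=\|\mathbf u\|_{\mathcal H}^2+\|\mathbf u^{(2k)}\|_{\mathcal H}^2$. Let $L$ be the closure in $\mathcal H$ of the operator $\tilde L$ with domain $\{\mathbf u\in C^1[0,1]\times C^1[0,1]:u_1(0)=0\}$ given by $$\tilde L\mathbf u(\rho)=\Big(-\rho u_1'(\rho)+u_2'(\rho)+pc_0\int_0^\rho u_2(\xi)\,d\xi,\ \ u_1'(\rho)-\rho u_2'(\rho)\Big),$$ let $\mathcal D(L_{\mathcal H^{2k}})=\{\mathbf u\in\mathcal D(L)\cap\mathcal H^{2k}:L\mathbf u\in\mathcal H^{2k}\}$ be the domain of the part of $L$ in $\mathcal H^{2k}$, and let $$N(\mathbf u)(\rho)=\sum_{j=2}^p\binom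 pj c_0^{\frac{p-j}{p-1}}\Big(\rho\Big(\tfrac1\rho\int_0^\rho u_2(\xi)\,d\xi\Big)^j,\ 0\Big).$$ Let $\mathbf g(\rho)=(\lambda^2/3+1)^{-1/2}(\lambda\rho,1)$ with $\lambda=1+\frac{2}{p-1}$ be the gauge mode, i.e. the normalized eigenfunction of $L$ with eigenvalue $\lambda$. A global $\mathcal H^{2k}$-solution with initial data $\mathbf v\in\mathcal H^{2k}$ of $$\frac{d}{d\tau}\Phi(\tau)=\Big(L-\frac2{p-1}\Big)\Phi(\tau)+N(\Phi(\tau))\qquad(*)$$ is a function $\Phi:[0,\infty)\to\mathcal H^{2k}$ with $\Phi(0)=\mathbf v$ that is continuous at $\tau=0$ with respect to $\|\cdot\|_{\mathcal H^{2k}}$, is differentiable with respect to $\|\cdot\|_{\mathcal H^{2k}}$ at every $\tau>0$, and satisfies $\Phi(\tau)\in\mathcal D(L)$ and $(*)$ for every $\tau>0$. **Theorem.** There is a $k_0$ such that for every $k\ge k_0$ there are $\delta_0>0$ and $C>0$ such that for every $0<\delta\le\delta_0$ and every $\mathbf u\in\mathcal D(L_{\mathcal H^{2k}})$ with $\|\mathbf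 u\|_{\mathcal H^{2k}}\le\delta^2$ there is an $\alpha_{\mathbf u}\in\mathbb C$ for which $(*)$ has exactly one global $\mathcal H^{2k}$-solution $\Phi$ with initial data $\Phi(0)=\mathbf u+\alpha_{\mathbf u}\mathbf g$, and this solution satisfies $\|\Phi(\tau)\|_{\mathcal H^{2k}}\le Ce^{-\tau}$ for all $\tau>0$. -/

import Mathlib

open MeasureTheory Set
open scoped ContDiff

namespace WaveStability

noncomputable section

/-- Lebesgue measure on the unit interval `(0,1)`. -/
abbrev unitMeasure : Measure ℝ := volume.restrict (Ioo 0 1)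

/-- The complex space `L²(0,1)`. -/
abbrev L2 : Type := Lp ℂ 2 unitMeasure

/-- The Hilbert space `H = L²(0,1) × L²(0,1)`, with `(u|v) = ∑ j, ∫ uⱼ conj vⱼ`. -/
abbrev H : Type := WithLp 2 (L2 × L2)

/-- `c₀ = 2(p+1)/(p-1)²`. -/
def c0 (p : ℕ) : ℝ := 2 * (p + 1) / (p - 1) ^ 2

/-! ### The linear operator -/

/-- First component of `L̃ (f₁, f₂)`. -/
def genFst (p : ℕ) (f₁ f₂ : ℝ → ℂ) (ρ : ℝ) : ℂ :=
  -(ρ : ℂ) * deriv f₁ ρ + deriv f₂ ρ + ((p * c0 p : ℝ) : ℂ) * ∫ ξ in (0 : ℝ)..ρ, f₂ ξ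

/-- Second component of `L̃ (f₁, f₂)`. -/
def genSnd (f₁ f₂ : ℝ → ℂ) (ρ : ℝ) : ℂ :=
  deriv f₁ ρ - (ρ : ℂ) * deriv f₂ ρ

/-- `f₁, f₂` are `C¹` on `[0,1]` with `f₁(0) = 0`, and they represent `u`. -/
structure IsC1Rep (f₁ f₂ : ℝ → ℂ) (u : H) : Prop where
  contDiff_fst : ContDiffOn ℝ 1 f₁ (Icc 0 1)
  contDiff_snd : ContDiffOn ℝ 1 f₂ (Icc 0 1)
  fst_zero : f₁ 0 = 0
  fst_ae : u.fst =ᵐ[unitMeasure] f₁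
  snd_ae : u.snd =ᵐ[unitMeasure] f₂

theorem C1_diffAt {f : ℝ → ℂ} (hf : ContDiffOn ℝ 1 f (Icc 0 1)) {ρ : ℝ} (hρ : ρ ∈ Ioo (0 : ℝ) 1) :
    DifferentiableAt ℝ f ρ :=
  (hf.differentiableOn (by norm_num)).differentiableAt (Icc_mem_nhds hρ.1 hρ.2)

theorem C1_intervalIntegrable {f : ℝ → ℂ} (hf : ContDiffOn ℝ 1 f (Icc 0 1)) {ρ : ℝ}
    (hρ : ρ ∈ Ioo (0 : ℝ) 1) : IntervalIntegrable f volume 0 ρ := by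
  apply ContinuousOn.intervalIntegrable
  rw [uIcc_of_le hρ.1.le]
  exact hf.continuousOn.mono (Icc_subset_Icc_right hρ.2.le)

theorem ae_mem_unit : ∀ᵐ ρ ∂unitMeasure, ρ ∈ Ioo (0 : ℝ) 1 := ae_restrict_mem measurableSet_Ioo

/-- The graph of `L̃`, as a linear subspace of `H × H`. -/
def preGenGraph (p : ℕ) : Submodule ℂ (H × H) where
  carrier := {x | ∃ f₁ f₂ : ℝ → ℂ, IsC1Rep f₁ f₂ x.1 ∧
    x.2.fst =ᵐ[unitMeasure] genFst p f₁ f₂ ∧ x.2.snd =ᵐ[unitMeasure] genSnd f₁ f₂}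
  zero_mem' := by
    refine ⟨0, 0, ⟨contDiffOn_const, contDiffOn_const, rfl, Lp.coeFn_zero _ _ _,
      Lp.coeFn_zero _ _ _⟩, ?_, ?_⟩
    · have h : genFst p 0 0 = 0 := by ext ρ; simp [genFst]
      rw [h]; exact Lp.coeFn_zero _ _ _
    · have h : genSnd 0 0 = 0 := by ext ρ; simp [genSnd]
      rw [h]; exact Lp.coeFn_zero _ _ _
  add_mem' := by
    rintro x y ⟨f₁, f₂, hf, hf1, hf2⟩ ⟨g₁, g₂, hg, hg1, hg2⟩
    refine ⟨f₁ + g₁, f₂ + g₂, ⟨hf.1.add hg.1, hf.2.add hg.2, by simp [hf.3, hg.3],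
      (Lp.coeFn_add _ _).trans (hf.4.add hg.4), (Lp.coeFn_add _ _).trans (hf.5.add hg.5)⟩, ?_, ?_⟩
    · refine (Lp.coeFn_add x.2.fst y.2.fst).trans ?_
      filter_upwards [hf1, hg1, ae_mem_unit] with ρ h1 h2 hρ
      simp only [Pi.add_apply, h1, h2, genFst]
      rw [deriv_add (C1_diffAt hf.1 hρ) (C1_diffAt hg.1 hρ),
        deriv_add (C1_diffAt hf.2 hρ) (C1_diffAt hg.2 hρ),
        intervalIntegral.integral_add (C1_intervalIntegrable hf.2 hρ)
          (C1_intervalIntegrable hg.2 hρ)]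
      ring
    · refine (Lp.coeFn_add x.2.snd y.2.snd).trans ?_
      filter_upwards [hf2, hg2, ae_mem_unit] with ρ h1 h2 hρ
      simp only [Pi.add_apply, h1, h2, genSnd]
      rw [deriv_add (C1_diffAt hf.1 hρ) (C1_diffAt hg.1 hρ),
        deriv_add (C1_diffAt hf.2 hρ) (C1_diffAt hg.2 hρ)]
      ring
  smul_mem' := by
    rintro c x ⟨f₁, f₂, hf, hf1, hf2⟩
    refine ⟨c • f₁, c • f₂, ⟨hf.1.const_smul c, hf.2.const_smul c, by simp [hf.3],
      (Lp.coeFn_smul _ _).trans (hf.4.const_smul c),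
      (Lp.coeFn_smul _ _).trans (hf.5.const_smul c)⟩, ?_, ?_⟩
    · refine (Lp.coeFn_smul c x.2.fst).trans ?_
      filter_upwards [hf1, ae_mem_unit] with ρ h1 hρ
      simp only [Pi.smul_apply, h1, genFst]
      rw [deriv_const_smul c (C1_diffAt hf.1 hρ), deriv_const_smul c (C1_diffAt hf.2 hρ),
        intervalIntegral.integral_smul]
      simp only [smul_eq_mul]
      ring
    · refine (Lp.coeFn_smul c x.2.snd).trans ?_
      filter_upwards [hf2, ae_mem_unit] with ρ h1 hρ
      simp only [Pi.smul_apply, h1, genSnd]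
      rw [deriv_const_smul c (C1_diffAt hf.1 hρ), deriv_const_smul c (C1_diffAt hf.2 hρ)]
      simp only [smul_eq_mul]
      ring

/-- The operator `L̃` on `H`: its domain consists of the `u ∈ C¹[0,1] × C¹[0,1]` with `u₁(0) = 0`,
and `L̃ u = (-ρ u₁' + u₂' + p c₀ ∫₀^ρ u₂, u₁' - ρ u₂')`. -/
def preGen (p : ℕ) : H →ₗ.[ℂ] H := (preGenGraph p).toLinearPMap

theorem C1_eq_zero {f : ℝ → ℂ} (hf : ContDiffOn ℝ 1 f (Icc 0 1)) (h0 : f =ᵐ[unitMeasure] 0) :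
    EqOn f 0 (Ioo 0 1) :=
  Measure.eqOn_open_of_ae_eq h0 isOpen_Ioo (hf.continuousOn.mono Ioo_subset_Icc_self)
    continuousOn_const

/-- `L̃` is well defined: its graph is the subspace `preGenGraph`. -/
theorem preGen_graph (p : ℕ) : (preGen p).graph = preGenGraph p := by
  apply Submodule.toLinearPMap_graph_eq
  rintro ⟨u, v⟩ ⟨f₁, f₂, hf, h1, h2⟩ hu
  change u = 0 at hu
  subst hu
  have e1 := C1_eq_zero hf.1 (hf.4.symm.trans (Lp.coeFn_zero _ _ _))
  have e2 := C1_eq_zero hf.2 (hf.5.symm.trans (Lp.coeFn_zero _ _ _))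
  have d : ∀ {f : ℝ → ℂ}, EqOn f 0 (Ioo 0 1) → ∀ ρ ∈ Ioo (0 : ℝ) 1, deriv f ρ = 0 := by
    intro f hf ρ hρ
    rw [(hf.eventuallyEq_of_mem (Ioo_mem_nhds hρ.1 hρ.2)).deriv_eq]
    exact deriv_const ρ (0 : ℂ)
  have i2 : ∀ ρ ∈ Ioo (0 : ℝ) 1, ∫ ξ in (0 : ℝ)..ρ, f₂ ξ = 0 := by
    intro ρ hρ
    rw [intervalIntegral.integral_of_le hρ.1.le]
    apply setIntegral_eq_zero_of_forall_eq_zero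
    intro ξ hξ
    exact e2 ⟨hξ.1, hξ.2.trans_lt hρ.2⟩
  have z1 : v.fst = 0 := by
    apply Lp.ext
    refine h1.trans (Filter.EventuallyEq.trans ?_ (Lp.coeFn_zero _ _ _).symm)
    filter_upwards [ae_mem_unit] with ρ hρ
    simp [genFst, d e1 ρ hρ, d e2 ρ hρ, i2 ρ hρ]
  have z2 : v.snd = 0 := by
    apply Lp.ext
    refine h2.trans (Filter.EventuallyEq.trans ?_ (Lp.coeFn_zero _ _ _).symm)
    filter_upwards [ae_mem_unit] with ρ hρ
    simp [genSnd, d e1 ρ hρ, d e2 ρ hρ]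
  change v = 0
  apply WithLp.ofLp_injective
  exact Prod.ext z1 z2

/-- The operator `L`, the closure of `L̃` in `H`. -/
def gen (p : ℕ) : H →ₗ.[ℂ] H := (preGen p).closure

/-! ### The Sobolev spaces -/

/-- `w ∈ L²(0,1)` is the weak derivative of `v ∈ L²(0,1)`. -/
def IsWeakDeriv (v w : L2) : Prop :=
  ∀ φ : ℝ → ℝ, ContDiff ℝ ∞ φ → HasCompactSupport φ → tsupport φ ⊆ Ioo 0 1 →
    ∫ ρ, deriv φ ρ • v ρ ∂unitMeasure = -∫ ρ, φ ρ • w ρ ∂unitMeasure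

/-- The continuous representative of `v` on `[0,1]` vanishes at `0`. -/
def VanishesAtZero (v : L2) : Prop :=
  ∃ f : ℝ → ℂ, ContinuousOn f (Icc 0 1) ∧ v =ᵐ[unitMeasure] f ∧ f 0 = 0

/-- `d 0, d 1, …, d n` are the successive weak derivatives of `d 0`, all in `L²(0,1)`;
so `d 0 ∈ Hⁿ(0,1)` and `d j = (d 0)^(j)` for `j ≤ n`. -/
def IsWeakDerivChain (n : ℕ) (d : ℕ → L2) : Prop :=
  ∀ j < n, IsWeakDeriv (d j) (d (j + 1))

theorem test_integrable {ψ : ℝ → ℝ} (hc : Continuous ψ) (hs : HasCompactSupport ψ) (v : L2) :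
    Integrable (fun ρ => ψ ρ • v ρ) unitMeasure := by
  have hv : Integrable (v : ℝ → ℂ) unitMeasure := (Lp.memLp v).integrable (by norm_num)
  obtain ⟨C, hC⟩ := hs.exists_bound_of_continuous hc
  exact hv.bdd_smul C hc.aestronglyMeasurable (Filter.Eventually.of_forall hC)

theorem IsWeakDeriv.add {v w v' w' : L2} (h : IsWeakDeriv v w) (h' : IsWeakDeriv v' w') :
    IsWeakDeriv (v + v') (w + w') := by
  intro φ hφ hs ht
  have hd : Continuous (deriv φ) := hφ.continuous_deriv (by simp)
  have e1 : ∫ ρ, deriv φ ρ • (v + v') ρ ∂unitMeasure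
      = ∫ ρ, (deriv φ ρ • v ρ + deriv φ ρ • v' ρ) ∂unitMeasure := by
    apply integral_congr_ae
    filter_upwards [Lp.coeFn_add v v'] with ρ hρ
    rw [hρ, Pi.add_apply, smul_add]
  have e2 : ∫ ρ, φ ρ • (w + w') ρ ∂unitMeasure
      = ∫ ρ, (φ ρ • w ρ + φ ρ • w' ρ) ∂unitMeasure := by
    apply integral_congr_ae
    filter_upwards [Lp.coeFn_add w w'] with ρ hρ
    rw [hρ, Pi.add_apply, smul_add]
  rw [e1, e2, integral_add (test_integrable hd hs.deriv v) (test_integrable hd hs.deriv v'),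
    integral_add (test_integrable hφ.continuous hs w) (test_integrable hφ.continuous hs w'),
    h φ hφ hs ht, h' φ hφ hs ht]
  ring

theorem IsWeakDeriv.smul {v w : L2} (c : ℂ) (h : IsWeakDeriv v w) :
    IsWeakDeriv (c • v) (c • w) := by
  intro φ hφ hs ht
  have e : ∀ (ψ : ℝ → ℝ) (x : L2), ∫ ρ, ψ ρ • (c • x) ρ ∂unitMeasure
      = c • ∫ ρ, ψ ρ • x ρ ∂unitMeasure := by
    intro ψ x
    rw [← integral_smul]
    apply integral_congr_ae
    filter_upwards [Lp.coeFn_smul c x] with ρ hρ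
    rw [hρ, Pi.smul_apply, smul_comm]
  rw [e, e, h φ hφ hs ht, smul_neg]

theorem isWeakDeriv_zero : IsWeakDeriv 0 0 := by
  intro φ hφ hs ht
  have e : ∀ ψ : ℝ → ℝ, ∫ ρ, ψ ρ • (0 : L2) ρ ∂unitMeasure = 0 := by
    intro ψ
    apply integral_eq_zero_of_ae
    filter_upwards [Lp.coeFn_zero ℂ 2 unitMeasure] with ρ hρ
    rw [hρ]; simp
  rw [e, e, neg_zero]

theorem vanishesAtZero_zero : VanishesAtZero 0 :=
  ⟨0, continuousOn_const, Lp.coeFn_zero _ _ _, rfl⟩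

theorem VanishesAtZero.add {v w : L2} (hv : VanishesAtZero v) (hw : VanishesAtZero w) :
    VanishesAtZero (v + w) := by
  obtain ⟨f, hf, hvf, f0⟩ := hv
  obtain ⟨g, hg, hwg, g0⟩ := hw
  exact ⟨f + g, hf.add hg, (Lp.coeFn_add _ _).trans (hvf.add hwg), by simp [f0, g0]⟩

theorem VanishesAtZero.smul {v : L2} (c : ℂ) (hv : VanishesAtZero v) :
    VanishesAtZero (c • v) := by
  obtain ⟨f, hf, hvf, f0⟩ := hv
  exact ⟨c • f, hf.const_smul c, (Lp.coeFn_smul _ _).trans (hvf.const_smul c), by simp [f0]⟩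

/-- The space `H^{2k}` of all `u ∈ H^{2k}(0,1) × H^{2k}(0,1)` with
`u₁^(2j)(0) = u₂^(2j+1)(0) = 0` for `j < k`. It is realized as the space of pairs `(u, u^(2k))` in
the Hilbert sum `H ⊕ H`, so that the inherited inner product is
`(u|v)_H + (u^(2k)|v^(2k))_H`. -/
def sobolev (k : ℕ) : Submodule ℂ (WithLp 2 (H × H)) where
  carrier := {x | ∃ d₁ d₂ : ℕ → L2,
    d₁ 0 = x.fst.fst ∧ d₂ 0 = x.fst.snd ∧
    d₁ (2 * k) = x.snd.fst ∧ d₂ (2 * k) = x.snd.snd ∧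
    IsWeakDerivChain (2 * k) d₁ ∧ IsWeakDerivChain (2 * k) d₂ ∧
    ∀ j < k, VanishesAtZero (d₁ (2 * j)) ∧ VanishesAtZero (d₂ (2 * j + 1))}
  zero_mem' := ⟨0, 0, rfl, rfl, rfl, rfl, fun _ _ => isWeakDeriv_zero, fun _ _ => isWeakDeriv_zero,
    fun _ _ => ⟨vanishesAtZero_zero, vanishesAtZero_zero⟩⟩
  add_mem' := by
    rintro x y ⟨d₁, d₂, a1, a2, a3, a4, a5, a6, a7⟩ ⟨e₁, e₂, b1, b2, b3, b4, b5, b6, b7⟩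
    exact ⟨d₁ + e₁, d₂ + e₂, by simp [a1, b1], by simp [a2, b2], by simp [a3, b3],
      by simp [a4, b4], fun j hj => (a5 j hj).add (b5 j hj), fun j hj => (a6 j hj).add (b6 j hj),
      fun j hj => ⟨(a7 j hj).1.add (b7 j hj).1, (a7 j hj).2.add (b7 j hj).2⟩⟩
  smul_mem' := by
    rintro c x ⟨d₁, d₂, a1, a2, a3, a4, a5, a6, a7⟩
    exact ⟨c • d₁, c • d₂, by simp [a1], by simp [a2], by simp [a3], by simp [a4],
      fun j hj => (a5 j hj).smul c, fun j hj => (a6 j hj).smul c,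
      fun j hj => ⟨(a7 j hj).1.smul c, (a7 j hj).2.smul c⟩⟩

/-- The Hilbert space `H^{2k}` as a type. -/
abbrev H2k (k : ℕ) : Type := sobolev k

/-- The inclusion of `H^{2k}` into `H`. -/
def toH {k : ℕ} (u : H2k k) : H := (u : WithLp 2 (H × H)).fst

/-- `u` lies in the domain of the part of `L` in `H^{2k}`: `u ∈ D(L) ∩ H^{2k}` and
`L u ∈ H^{2k}`. -/
def InPartDomain (p k : ℕ) (u : H2k k) : Prop :=
  ∃ h : toH u ∈ (gen p).domain, ∃ v : H2k k, gen p ⟨toH u, h⟩ = toH v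

/-! ### The gauge mode -/

/-- The gauge eigenvalue `λ₀⁺ = 1 + 2/(p-1)` of `L`. -/
def gaugeEigenvalue (p : ℕ) : ℝ := 1 + 2 / (p - 1)

/-- The class in `L²(0,1)` of the affine function `ρ ↦ a ρ + b`. -/
def affine (a b : ℝ) : L2 :=
  MemLp.toLp (fun ρ : ℝ => ((a * ρ + b : ℝ) : ℂ)) (by
    refine MemLp.of_bound (C := |a| + |b|) (by fun_prop) ?_
    filter_upwards [ae_mem_unit] with ρ hρ
    rw [Complex.norm_real, Real.norm_eq_abs]
    refine (abs_add_le _ _).trans ?_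
    rw [abs_mul, abs_of_pos hρ.1]
    have := mul_le_of_le_one_right (abs_nonneg a) hρ.2.le
    linarith)

theorem affine_ae (a b : ℝ) : affine a b =ᵐ[unitMeasure] fun ρ : ℝ => ((a * ρ + b : ℝ) : ℂ) :=
  MemLp.coeFn_toLp _

theorem affine_zero : affine 0 0 = 0 := by
  apply Lp.ext
  filter_upwards [affine_ae 0 0, Lp.coeFn_zero ℂ 2 unitMeasure] with ρ h1 h2
  rw [h1, h2]; simp

theorem affine_isWeakDeriv (a b : ℝ) : IsWeakDeriv (affine a b) (affine 0 a) := by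
  intro φ hφ hs ht
  have e1 : ∫ ρ, deriv φ ρ • affine a b ρ ∂unitMeasure
      = ((∫ ρ in (0 : ℝ)..1, deriv φ ρ * (a * ρ + b) : ℝ) : ℂ) := by
    rw [intervalIntegral.integral_of_le zero_le_one, integral_Ioc_eq_integral_Ioo,
      ← integral_complex_ofReal]
    apply integral_congr_ae
    filter_upwards [affine_ae a b] with ρ hρ
    rw [hρ]
    simp [mul_add]
  have e2 : ∫ ρ, φ ρ • affine 0 a ρ ∂unitMeasure
      = ((∫ ρ in (0 : ℝ)..1, φ ρ * a : ℝ) : ℂ) := by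
    rw [intervalIntegral.integral_of_le zero_le_one, integral_Ioc_eq_integral_Ioo,
      ← integral_complex_ofReal]
    apply integral_congr_ae
    filter_upwards [affine_ae 0 a] with ρ hρ
    rw [hρ]
    simp
  have hd : Continuous (deriv φ) := hφ.continuous_deriv (by simp)
  have z : ∀ x, x ∉ Ioo (0 : ℝ) 1 → φ x = 0 := fun x hx =>
    image_eq_zero_of_notMem_tsupport fun h => hx (ht h)
  have key := intervalIntegral.integral_deriv_mul_eq_sub (a := 0) (b := 1) (u := φ)
    (v := fun ρ => a * ρ + b) (u' := deriv φ) (v' := fun _ => a)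
    (fun x _ => (hφ.differentiable (by simp) x).hasDerivAt)
    (fun x _ => by simpa using ((hasDerivAt_id x).const_mul a).add_const b)
    (hd.intervalIntegrable _ _) (continuous_const.intervalIntegrable _ _)
  have c1 : Continuous fun x => deriv φ x * (a * x + b) := by fun_prop
  have c2 : Continuous fun x => φ x * a := hφ.continuous.mul continuous_const
  rw [intervalIntegral.integral_add (c1.intervalIntegrable _ _) (c2.intervalIntegrable _ _),
    z 0 (by simp), z 1 (by simp)] at key
  rw [e1, e2, ← Complex.ofReal_neg]
  congr 1
  linarith

/-- The derivatives of the affine function `ρ ↦ a ρ + b`. -/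
def affineDeriv (a b : ℝ) : ℕ → L2
  | 0 => affine a b
  | 1 => affine 0 a
  | _ + 2 => 0

theorem affineDeriv_chain (a b : ℝ) (n : ℕ) : IsWeakDerivChain n (affineDeriv a b) := by
  rintro (_ | _ | j) _
  · exact affine_isWeakDeriv a b
  · have h := affine_isWeakDeriv 0 a
    rwa [affine_zero] at h
  · exact isWeakDeriv_zero

theorem affine_vanishesAtZero (a : ℝ) : VanishesAtZero (affine a 0) :=
  ⟨fun ρ : ℝ => ((a * ρ + 0 : ℝ) : ℂ), by fun_prop, affine_ae a 0, by simp⟩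

/-- The normalization factor `1 / √(λ²/3 + 1)` of the gauge mode, `λ = λ₀⁺`. -/
def gaugeFactor (p : ℕ) : ℝ := (√(gaugeEigenvalue p ^ 2 / 3 + 1))⁻¹

/-- The gauge mode `g`, the normalized eigenfunction of `L` for the eigenvalue `λ = λ₀⁺`: the
function `ρ ↦ (λ ρ, 1) / √(λ²/3 + 1)`. -/
def gaugeMode (p k : ℕ) : H2k k :=
  ⟨WithLp.toLp 2
    (WithLp.toLp 2 (affine (gaugeFactor p * gaugeEigenvalue p) 0, affine 0 (gaugeFactor p)),
     WithLp.toLp 2 (affineDeriv (gaugeFactor p * gaugeEigenvalue p) 0 (2 * k),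
      affineDeriv 0 (gaugeFactor p) (2 * k))), by
    refine ⟨affineDeriv (gaugeFactor p * gaugeEigenvalue p) 0, affineDeriv 0 (gaugeFactor p),
      rfl, rfl, rfl, rfl, affineDeriv_chain _ _ _, affineDeriv_chain _ _ _, ?_⟩
    rintro (_ | j) _
    · refine ⟨affine_vanishesAtZero _, ?_⟩
      exact affine_vanishesAtZero 0
    · exact ⟨vanishesAtZero_zero, vanishesAtZero_zero⟩⟩

/-- The gauge mode is an eigenfunction: `L g = λ₀⁺ g`. -/
theorem gaugeMode_eigen (p k : ℕ) (hp : 1 < p) :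
    (toH (gaugeMode p k), (gaugeEigenvalue p : ℂ) • toH (gaugeMode p k)) ∈ (gen p).graph := by
  refine LinearPMap.le_graph_of_le (preGen p).le_closure ?_
  rw [preGen_graph]
  have hp' : (p : ℝ) - 1 ≠ 0 := by
    have : (1 : ℝ) < p := by exact_mod_cast hp
    linarith
  have hq : gaugeEigenvalue p * gaugeEigenvalue p = p * c0 p - gaugeEigenvalue p := by
    rw [gaugeEigenvalue, c0]
    field_simp
    ring
  set s := gaugeFactor p with hs
  set l := gaugeEigenvalue p with hl
  have hder : ∀ (a b ρ : ℝ), deriv (fun ρ : ℝ => ((a * ρ + b : ℝ) : ℂ)) ρ = a := by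
    intro a b ρ
    have h : HasDerivAt (fun ρ : ℝ => a * ρ + b) a ρ := by
      simpa using ((hasDerivAt_id ρ).const_mul a).add_const b
    exact h.ofReal_comp.deriv
  have hsm : ∀ (a b : ℝ), ContDiffOn ℝ 1 (fun ρ : ℝ => ((a * ρ + b : ℝ) : ℂ)) (Icc 0 1) := by
    intro a b
    exact (Complex.ofRealCLM.contDiff.comp
      (by fun_prop : ContDiff ℝ 1 fun ρ : ℝ => a * ρ + b)).contDiffOn
  refine ⟨fun ρ : ℝ => ((s * l * ρ + 0 : ℝ) : ℂ), fun ρ : ℝ => ((0 * ρ + s : ℝ) : ℂ),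
    ⟨hsm _ _, hsm _ _, by simp, affine_ae _ _, affine_ae _ _⟩, ?_, ?_⟩
  · refine (Lp.coeFn_smul (l : ℂ) (affine (s * l) 0)).trans ?_
    filter_upwards [affine_ae (s * l) 0] with ρ hρ
    rw [Pi.smul_apply, hρ, genFst, hder, hder, intervalIntegral.integral_ofReal]
    have : ∫ x in (0 : ℝ)..ρ, (0 * x + s) = ρ * s := by simp
    rw [this, smul_eq_mul]
    norm_cast
    linear_combination s * ρ * hq
  · refine (Lp.coeFn_smul (l : ℂ) (affine 0 s)).trans ?_
    filter_upwards [affine_ae 0 s] with ρ hρ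
    rw [Pi.smul_apply, hρ, genSnd, hder, hder, smul_eq_mul]
    push_cast
    ring

theorem affine_norm_sq (a b : ℝ) : ‖affine a b‖ ^ 2 = ∫ ρ in (0 : ℝ)..1, (a * ρ + b) ^ 2 := by
  have h : ((‖affine a b‖ ^ 2 : ℝ) : ℂ) = ((∫ ρ in (0 : ℝ)..1, (a * ρ + b) ^ 2 : ℝ) : ℂ) := by
    have h1 := inner_self_eq_norm_sq_to_K (𝕜 := ℂ) (affine a b)
    rw [Complex.ofReal_pow]
    refine h1.symm.trans ?_
    rw [MeasureTheory.L2.inner_def,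
      intervalIntegral.integral_of_le zero_le_one, integral_Ioc_eq_integral_Ioo,
      ← integral_complex_ofReal]
    apply integral_congr_ae
    filter_upwards [affine_ae a b] with ρ hρ
    rw [hρ, RCLike.inner_apply, Complex.conj_ofReal]
    push_cast
    ring
  exact_mod_cast h

/-- The gauge mode is normalized. -/
theorem gaugeMode_norm (p k : ℕ) (hk : 1 ≤ k) : ‖gaugeMode p k‖ = 1 := by
  obtain ⟨j, rfl⟩ : ∃ j, k = j + 1 := ⟨k - 1, by omega⟩
  have h : ‖gaugeMode p (j + 1)‖ ^ 2 = 1 := by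
    rw [← Submodule.norm_coe, gaugeMode, WithLp.prod_norm_sq_eq_of_L2, WithLp.prod_norm_sq_eq_of_L2,
      WithLp.prod_norm_sq_eq_of_L2]
    change ‖affine _ _‖ ^ 2 + ‖affine _ _‖ ^ 2 + (‖(0 : L2)‖ ^ 2 + ‖(0 : L2)‖ ^ 2) = 1
    rw [affine_norm_sq, affine_norm_sq]
    have i1 : ∀ a : ℝ, ∫ ρ in (0 : ℝ)..1, (a * ρ + 0) ^ 2 = a ^ 2 / 3 := by
      intro a
      simp only [add_zero, mul_pow, intervalIntegral.integral_const_mul, integral_pow]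
      norm_num
      ring
    have i2 : ∀ b : ℝ, ∫ ρ in (0 : ℝ)..1, (0 * ρ + b) ^ 2 = b ^ 2 := by
      intro b; simp
    rw [i1, i2]
    have hpos : 0 < gaugeEigenvalue p ^ 2 / 3 + 1 := by positivity
    have hf : gaugeFactor p ^ 2 = (gaugeEigenvalue p ^ 2 / 3 + 1)⁻¹ := by
      rw [gaugeFactor, inv_pow, Real.sq_sqrt hpos.le]
    rw [mul_pow, hf]
    simp only [norm_zero]
    field_simp
    ring
  have h0 := norm_nonneg (gaugeMode p (j + 1))
  nlinarith

/-! ### The nonlinear equation -/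

/-- `w = N(u)`, where `N(u)(ρ) = ∑_{j=2}^p (p choose j) c₀^((p-j)/(p-1))
(ρ ((1/ρ) ∫₀^ρ u₂)^j, 0)`. -/
def IsNonlinearity (p : ℕ) (u w : H) : Prop :=
  (w.fst =ᵐ[unitMeasure] fun ρ : ℝ => ∑ j ∈ Finset.Icc 2 p,
    ((p.choose j * c0 p ^ (((p : ℝ) - j) / (p - 1)) : ℝ) : ℂ) *
      ((ρ : ℂ) * ((1 / (ρ : ℂ)) * ∫ ξ in (0 : ℝ)..ρ, u.snd ξ) ^ j)) ∧
  w.snd = 0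

/-- `Φ` (restricted to `[0,∞)`) is a global `H^{2k}`-solution of
`dΦ/dτ = (L - 2/(p-1)) Φ + N(Φ)` with initial data `v`. -/
structure IsSolution (p k : ℕ) (v : H2k k) (Φ : ℝ → H2k k) : Prop where
  initial : Φ 0 = v
  continuous_zero : ContinuousWithinAt Φ (Ici 0) 0
  equation : ∀ τ > 0, ∃ Φ' : H2k k, HasDerivAt Φ Φ' τ ∧
    ∃ h : toH (Φ τ) ∈ (gen p).domain, ∃ w : H, IsNonlinearity p (toH (Φ τ)) w ∧
      toH Φ' = (gen p ⟨toH (Φ τ), h⟩ - ((2 / (p - 1) : ℝ) : ℂ) • toH (Φ τ)) + w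

end

end WaveStability

namespace WaveStability

noncomputable section

/-! Extend u₁ to (-1,1) as an odd function and u₂ as an even one, and put w = u₁ + u₂. The
conditions at 0 say exactly that the derivatives of w of order below 2k do not jump there, so H^{2k}
becomes H^{2k}(-1,1) without side conditions (`exists_equiv`). The system becomes a single transport
equation w_t = (1 - x) w_x - a w + P ∫₀ˣ w_even + N(w), where a = 2/(p-1) and P = p c₀ = (1+a)(2+a).
Its free flow w ↦ e^{-at} w(1 + e^{-t}(x-1)) is a dilation about the fixed point 1. Storing w by its
derivatives at 1 of order below n, together with its n-th derivative in L² (`Sob`), makes this flow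
diagonal.

No spectral theory of L is needed. The nonlocal term is a bounded perturbation that commutes with
two derivatives (`tail_tail_pot`), while each derivative of the free flow gains a factor e^{-t}.
Hence the second derivative of the perturbed flow on Hⁿ⁺² is e^{-2t} times the perturbed flow on Hⁿ
(`IsPert.tail_tail`). The two coordinates left over, w(1) and w'(1), obey a 2×2 system with
eigenvalues 1 and -2-2a, driven by the second derivative. Whatever the growth rate in L² is, it
therefore falls by two with every two derivatives until the eigenvalue 1 dominates
(`exists_hasGrowth_one`). Two further derivatives give S(t)w = e^t l(w) g + O(e^{-t}), where g =
(1+a)x + 1 is the gauge mode up to normalization (`exists_dichotomy`).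

The nonlinearity is quadratic at the origin and gains one derivative. The Lyapunov-Perron method
(`exists_decaying`) picks the multiple of g for which the total coefficient of e^t, contributed by
the data and by the forcing over all future times, is zero, and finds the solution as a fixed point
in the space with weight e^{-t}. Since the data lie in the domain of the generator and the forcing
is smoother than the phase space, this mild solution is differentiable (`IsPert.solvesAt`).

Uniqueness holds among all solutions, small or not, by an energy estimate in L²(-1,1)
(`eq_of_solvesL2At`): the weight 1 - x kills the boundary term at 1, and the one at -1 has the
favourable sign. -/

/-! ### Strongly continuous families and Volterra equations -/

section Volterra

variable {X Y : Type*} [NormedAddCommGroup X] [NormedSpace ℂ X]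
  [NormedAddCommGroup Y] [NormedSpace ℂ Y]

/-- A family of operators `S t` is strongly continuous: `(t, x) ↦ S t x` is continuous. -/
def StronglyCont (S : ℝ → X →L[ℂ] X) : Prop :=
  Continuous fun q : ℝ × X => S q.1 q.2

theorem StronglyCont.comp {S : ℝ → X →L[ℂ] X} (hS : StronglyCont S) {α : Type*}
    [TopologicalSpace α] {f : α → ℝ} {g : α → X} (hf : Continuous f) (hg : Continuous g) :
    Continuous fun x => S (f x) (g x) :=
  Continuous.comp (g := fun q : ℝ × X => S q.1 q.2) hS (hf.prodMk hg)

/-- Strong continuity follows from continuity of the orbits and a locally uniform bound. -/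
theorem stronglyCont_of_orbits {S : ℝ → X →L[ℂ] X} (horb : ∀ x, Continuous fun t => S t x)
    {b : ℝ → ℝ} (hb : Continuous b) (hbd : ∀ t, ‖S t‖ ≤ b t) : StronglyCont S := by
  refine continuous_iff_continuousAt.2 fun q => ?_
  have h1 : Filter.Tendsto (fun y : ℝ × X => b y.1 * ‖y.2 - q.2‖ + ‖S y.1 q.2 - S q.1 q.2‖)
      (nhds q) (nhds 0) := by
    have hc : Continuous fun y : ℝ × X => b y.1 * ‖y.2 - q.2‖ + ‖S y.1 q.2 - S q.1 q.2‖ :=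
      ((hb.comp continuous_fst).mul (continuous_snd.sub continuous_const).norm).add
        (((horb q.2).comp continuous_fst).sub continuous_const).norm
    simpa using hc.tendsto q
  refine tendsto_iff_norm_sub_tendsto_zero.2 (squeeze_zero (fun _ => norm_nonneg _) ?_ h1)
  intro y
  have : S y.1 y.2 - S q.1 q.2 = S y.1 (y.2 - q.2) + (S y.1 q.2 - S q.1 q.2) := by
    rw [map_sub]; abel
  rw [this]
  refine (norm_add_le _ _).trans (add_le_add ?_ le_rfl)
  exact ((S y.1).le_opNorm _).trans (mul_le_mul_of_nonneg_right (hbd _) (norm_nonneg _))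

theorem StronglyCont.continuous_conv {S : ℝ → X →L[ℂ] X} (hS : StronglyCont S) {g : ℝ → X}
    (hg : Continuous g) : Continuous fun t => ∫ s in (0 : ℝ)..t, S (t - s) (g s) :=
  intervalIntegral.continuous_parametric_intervalIntegral_of_continuous
    (f := fun t s => S (t - s) (g s))
    (hS.comp (continuous_fst.sub continuous_snd) (hg.comp continuous_snd)) continuous_id

/-- Fubini's theorem on a triangle. -/
theorem integral_triangle {F : ℝ → ℝ → X} (hF : Continuous (Function.uncurry F)) {t : ℝ}
    (ht : 0 ≤ t) :
    ∫ s in (0 : ℝ)..t, ∫ r in (0 : ℝ)..(t - s), F r s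
      = ∫ σ in (0 : ℝ)..t, ∫ s in (0 : ℝ)..σ, F (σ - s) s := by
  have hF' : Continuous fun q : ℝ × ℝ => F (q.2 - q.1) q.1 :=
    hF.comp ((continuous_snd.sub continuous_fst).prodMk continuous_fst)
  -- After the shift σ = r + s both iterated integrals run over the triangle s < σ; the indicator
  -- turns them into integrals over the square, where Fubini applies.
  set H : ℝ → ℝ → X := fun s σ => ({q : ℝ × ℝ | q.1 < q.2}).indicator
    (fun q => F (q.2 - q.1) q.1) (s, σ) with hH
  have hms : MeasurableSet {q : ℝ × ℝ | q.1 < q.2} := measurableSet_lt measurable_fst measurable_snd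
  have e1 : ∀ s ∈ uIcc 0 t, ∫ r in (0 : ℝ)..(t - s), F r s = ∫ σ in (0 : ℝ)..t, H s σ := by
    intro s hs
    rw [uIcc_of_le ht] at hs
    have h0 : ∫ r in (0 : ℝ)..(t - s), F r s = ∫ σ in s..t, F (σ - s) s := by
      rw [intervalIntegral.integral_comp_sub_right (fun r => F r s) s]; simp
    rw [h0, intervalIntegral.integral_of_le hs.2, intervalIntegral.integral_of_le ht]
    have : ∀ σ, H s σ = (Ioi s).indicator (fun σ => F (σ - s) s) σ := by
      intro σ
      simp only [hH, indicator, mem_ofPred_eq, mem_Ioi]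
    simp only [this]
    rw [setIntegral_indicator measurableSet_Ioi]
    congr 2
    ext σ
    simp only [mem_inter_iff, mem_Ioc, mem_Ioi]
    constructor
    · rintro ⟨h1, h2⟩; exact ⟨⟨hs.1.trans_lt h1, h2⟩, h1⟩
    · rintro ⟨⟨_, h2⟩, h3⟩; exact ⟨h3, h2⟩
  have e2 : ∀ σ ∈ uIcc 0 t, ∫ s in (0 : ℝ)..σ, F (σ - s) s = ∫ s in (0 : ℝ)..t, H s σ := by
    intro σ hs
    rw [uIcc_of_le ht] at hs
    rw [intervalIntegral.integral_of_le hs.1, intervalIntegral.integral_of_le ht,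
      integral_Ioc_eq_integral_Ioo]
    have : ∀ s, H s σ = (Iio σ).indicator (fun s => F (σ - s) s) s := by
      intro σ
      simp only [hH, indicator, mem_ofPred_eq, mem_Iio]
    simp only [this]
    rw [setIntegral_indicator measurableSet_Iio]
    congr 2
    ext s
    simp only [mem_inter_iff, mem_Ioc, mem_Iio, mem_Ioo]
    constructor
    · rintro ⟨h1, h2⟩; exact ⟨⟨h1, h2.le.trans hs.2⟩, h2⟩
    · rintro ⟨⟨h2, _⟩, h3⟩; exact ⟨h2, h3⟩
  rw [intervalIntegral.integral_congr e1, intervalIntegral.integral_congr e2]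
  refine intervalIntegral_intervalIntegral_swap ?_
  have hc : IntegrableOn (fun q : ℝ × ℝ => F (q.2 - q.1) q.1) (Icc 0 t ×ˢ Icc 0 t)
      (volume.prod volume) :=
    hF'.continuousOn.integrableOn_compact (isCompact_Icc.prod isCompact_Icc)
  rw [uIoc_of_le ht]
  exact (hc.mono_set (prod_mono Ioc_subset_Icc_self Ioc_subset_Icc_self)).indicator hms

/-- A Gronwall lemma in integral form. -/
theorem eq_zero_of_le_integral {f : ℝ → ℝ} (hf : Continuous f) (h0 : ∀ t, 0 ≤ f t) {C b : ℝ}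
    (h : ∀ t ∈ Icc 0 b, f t ≤ C * ∫ s in (0 : ℝ)..t, f s) : ∀ t ∈ Icc 0 b, f t = 0 := by
  set F : ℝ → ℝ := fun t => ∫ s in (0 : ℝ)..t, f s
  have hd : ∀ t, HasDerivAt F (f t) t := fun t => hf.integral_hasStrictDerivAt 0 t |>.hasDerivAt
  -- With the integrating factor the primitive becomes antitone; it starts at zero and is
  -- nonnegative, so it vanishes. No sign of C enters.
  have hd2 : ∀ t, HasDerivAt (fun t => Real.exp (-C * t) * F t)
      (Real.exp (-C * t) * (f t - C * F t)) t := by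
    intro t
    have h1 : HasDerivAt (fun t => Real.exp (-C * t)) (Real.exp (-C * t) * (-C)) t := by
      simpa using ((hasDerivAt_id t).const_mul (-C)).exp
    exact (h1.mul (hd t)).congr_deriv (by ring)
  have hanti : AntitoneOn (fun t => Real.exp (-C * t) * F t) (Icc 0 b) := by
    apply antitoneOn_of_deriv_nonpos (convex_Icc 0 b)
    · exact fun t _ => (hd2 t).continuousAt.continuousWithinAt
    · exact fun t _ => (hd2 t).differentiableAt.differentiableWithinAt
    · intro t ht
      rw [interior_Icc] at ht
      rw [(hd2 t).deriv]
      have := h t (Ioo_subset_Icc_self ht)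
      exact mul_nonpos_of_nonneg_of_nonpos (Real.exp_pos _).le (by simpa [F] using this)
  intro t ht
  have h1 := hanti ⟨le_rfl, ht.1.trans ht.2⟩ ht ht.1
  have hF0 : F 0 = 0 := by simp [F]
  simp only [hF0, mul_zero] at h1
  have hFt : F t ≤ 0 := by
    by_contra hc
    push Not at hc
    exact absurd h1 (not_le.2 (mul_pos (Real.exp_pos _) hc))
  have hFt' : 0 ≤ F t := intervalIntegral.integral_nonneg ht.1 fun s _ => h0 s
  have hz : F t = 0 := le_antisymm hFt hFt'
  have := h t ht
  change f t ≤ C * F t at this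
  rw [hz, mul_zero] at this
  exact le_antisymm this (h0 t)

theorem norm_conv_le {S : ℝ → X →L[ℂ] X} {g : ℝ → X} {h : ℝ → ℝ} (hh : Continuous h) {t : ℝ} (ht : 0 ≤ t)
    (hb : ∀ s ∈ Icc 0 t, ‖S (t - s) (g s)‖ ≤ h s) :
    ‖∫ s in (0 : ℝ)..t, S (t - s) (g s)‖ ≤ ∫ s in (0 : ℝ)..t, h s := by
  refine intervalIntegral.norm_integral_le_of_norm_le ht ?_ (hh.intervalIntegrable _ _)
  exact Filter.Eventually.of_forall fun s hs => hb s (Ioc_subset_Icc_self hs)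

/-- Uniqueness for linear Volterra equations. -/
theorem volterra_unique {T : ℝ → X →L[ℂ] X} (hT : StronglyCont T) {κ₀ : ℝ} (hk₀ : 0 ≤ κ₀)
    (hTb : ∀ t, 0 ≤ t → ‖T t‖ ≤ Real.exp (κ₀ * t)) (B : X →L[ℂ] X) {g φ ψ : ℝ → X}
    (hφ : Continuous φ) (hψ : Continuous ψ)
    (eφ : ∀ t, 0 ≤ t → φ t = g t + ∫ s in (0 : ℝ)..t, T (t - s) (B (φ s)))
    (eψ : ∀ t, 0 ≤ t → ψ t = g t + ∫ s in (0 : ℝ)..t, T (t - s) (B (ψ s))) :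
    ∀ t, 0 ≤ t → φ t = ψ t := by
  intro b hb
  have hc : ∀ θ : ℝ → X, Continuous θ → ∀ t, IntervalIntegrable
      (fun s => T (t - s) (B (θ s))) volume 0 t := fun θ hθ t =>
    (hT.comp (continuous_const.sub continuous_id) (B.continuous.comp hθ)).intervalIntegrable _ _
  have key := eq_zero_of_le_integral (f := fun t => ‖φ t - ψ t‖) (hφ.sub hψ).norm
    (fun t => norm_nonneg _) (C := Real.exp (κ₀ * b) * ‖B‖) (b := b) (by
      intro t ht
      have e : φ t - ψ t = ∫ s in (0 : ℝ)..t, T (t - s) (B (φ s - ψ s)) := by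
        rw [eφ t ht.1, eψ t ht.1, add_sub_add_left_eq_sub,
          ← intervalIntegral.integral_sub (hc φ hφ t) (hc ψ hψ t)]
        simp only [map_sub]
      rw [e, ← intervalIntegral.integral_const_mul]
      refine norm_conv_le (g := fun s => B (φ s - ψ s)) (continuous_const.mul (hφ.sub hψ).norm) ht.1 ?_
      intro s hs
      refine ((T (t - s)).le_opNorm _).trans ?_
      change _ ≤ Real.exp (κ₀ * b) * ‖B‖ * ‖φ s - ψ s‖
      rw [mul_assoc]
      refine mul_le_mul ((hTb _ (sub_nonneg.2 hs.2)).trans ?_) (B.le_opNorm _) (norm_nonneg _)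
        (Real.exp_pos _).le
      refine Real.exp_le_exp.2 (mul_le_mul_of_nonneg_left ?_ hk₀)
      linarith [hs.1, ht.2])
  exact sub_eq_zero.1 (norm_eq_zero.1 (key b ⟨hb, le_rfl⟩))

/-- Variation of constants: the perturbed family turns Duhamel's formula into the unperturbed
mild equation. -/
theorem duhamel_mild [CompleteSpace X] {T S : ℝ → X →L[ℂ] X} (hT : StronglyCont T) (hS : StronglyCont S)
    (B : X →L[ℂ] X)
    (hST : ∀ v t, 0 ≤ t → S t v = T t v + ∫ s in (0 : ℝ)..t, T (t - s) (B (S s v)))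
    {g : ℝ → X} (hg : Continuous g) (v : X) {φ : ℝ → X}
    (hφ : ∀ t, 0 ≤ t → φ t = S t v + ∫ s in (0 : ℝ)..t, S (t - s) (g s)) {t : ℝ} (ht : 0 ≤ t) :
    φ t = T t v + ∫ s in (0 : ℝ)..t, T (t - s) (B (φ s) + g s) := by
  have hSc : ∀ t, IntervalIntegrable (fun s => S (t - s) (g s)) volume 0 t := fun t =>
    (hS.comp (continuous_const.sub continuous_id) hg).intervalIntegrable _ _
  have cB : Continuous fun s => ∫ r in (0 : ℝ)..s, S (s - r) (g r) := hS.continuous_conv hg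
  have e1 : ∫ s in (0 : ℝ)..t, S (t - s) (g s) = (∫ s in (0 : ℝ)..t, T (t - s) (g s)) +
      ∫ s in (0 : ℝ)..t, ∫ r in (0 : ℝ)..(t - s), T (t - s - r) (B (S r (g s))) := by
    rw [← intervalIntegral.integral_add]
    · refine intervalIntegral.integral_congr fun s hs => ?_
      rw [uIcc_of_le ht] at hs
      exact hST (g s) (t - s) (sub_nonneg.2 hs.2)
    · exact (hT.comp (continuous_const.sub continuous_id) hg).intervalIntegrable _ _
    · refine Continuous.intervalIntegrable ?_ _ _
      refine intervalIntegral.continuous_parametric_intervalIntegral_of_continuous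
        (f := fun s r => T (t - s - r) (B (S r (g s)))) ?_ (continuous_const.sub continuous_id)
      exact hT.comp (by fun_prop) (B.continuous.comp
        (hS.comp continuous_snd (hg.comp continuous_fst)))
  -- Associativity of convolution: T ∗ B(S ∗ g) = (T ∗ BS) ∗ g, by exchanging the order of
  -- integration on the triangle.
  have e2 : ∫ s in (0 : ℝ)..t, ∫ r in (0 : ℝ)..(t - s), T (t - s - r) (B (S r (g s)))
      = ∫ σ in (0 : ℝ)..t, T (t - σ) (B (∫ s in (0 : ℝ)..σ, S (σ - s) (g s))) := by
    rw [integral_triangle (F := fun r s => T (t - s - r) (B (S r (g s)))) _ ht]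
    · refine intervalIntegral.integral_congr fun σ _ => ?_
      have := ((T (t - σ)).comp B).intervalIntegral_comp_comm (hSc σ)
      rw [ContinuousLinearMap.comp_apply] at this
      change _ = (T (t - σ)) (B _)
      rw [← this]
      refine intervalIntegral.integral_congr fun s _ => ?_
      simp
    · exact hT.comp (by fun_prop) (B.continuous.comp
        (hS.comp continuous_fst (hg.comp continuous_snd)))
  have e3 : ∫ s in (0 : ℝ)..t, T (t - s) (B (φ s) + g s)
      = (∫ s in (0 : ℝ)..t, T (t - s) (B (S s v))) +
        (∫ s in (0 : ℝ)..t, T (t - s) (B (∫ r in (0 : ℝ)..s, S (s - r) (g r)))) +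
        ∫ s in (0 : ℝ)..t, T (t - s) (g s) := by
    have i1 : IntervalIntegrable (fun s => T (t - s) (B (S s v))) volume 0 t :=
      (hT.comp (continuous_const.sub continuous_id) (B.continuous.comp
        (hS.comp continuous_id continuous_const))).intervalIntegrable _ _
    have i2 : IntervalIntegrable (fun s => T (t - s) (B (∫ r in (0 : ℝ)..s, S (s - r) (g r))))
        volume 0 t :=
      (hT.comp (continuous_const.sub continuous_id) (B.continuous.comp cB)).intervalIntegrable _ _
    have i3 : IntervalIntegrable (fun s => T (t - s) (g s)) volume 0 t :=
      (hT.comp (continuous_const.sub continuous_id) hg).intervalIntegrable _ _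
    rw [← intervalIntegral.integral_add i1 i2, ← intervalIntegral.integral_add (i1.add i2) i3]
    refine intervalIntegral.integral_congr fun s hs => ?_
    rw [uIcc_of_le ht] at hs
    simp only [hφ s hs.1, map_add]
  rw [hφ t ht, hST v t ht, e1, e2, e3]
  abel

/-- A mild solution with smooth data is differentiable. -/
theorem mild_integral_form {T : ℝ → X →L[ℂ] X} (hT : StronglyCont T) {j A : Y →L[ℂ] X}
    (hj : ∀ y t, 0 ≤ t → T t (j y) = j y + ∫ s in (0 : ℝ)..t, T s (A y))
    {v z : X} (hv : ∀ t, 0 ≤ t → T t v = v + ∫ s in (0 : ℝ)..t, T s z)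
    {h : ℝ → Y} (hh : Continuous h) {t : ℝ} (ht : 0 ≤ t) :
    T t v + ∫ s in (0 : ℝ)..t, T (t - s) (j (h s))
      = v + (∫ s in (0 : ℝ)..t, (T s z + ∫ r in (0 : ℝ)..s, T (s - r) (A (h r)))) +
        ∫ s in (0 : ℝ)..t, j (h s) := by
  -- The smoothness of the forcing enters here: since h takes values in Y, each T(t-s) j(h s) is j(h
  -- s) plus a time integral of T applied to A(h s). The outcome is an integral of continuous
  -- functions, hence differentiable in t.
  have e1 : ∫ s in (0 : ℝ)..t, T (t - s) (j (h s)) = (∫ s in (0 : ℝ)..t, j (h s)) +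
      ∫ s in (0 : ℝ)..t, ∫ r in (0 : ℝ)..(t - s), T r (A (h s)) := by
    rw [← intervalIntegral.integral_add]
    · refine intervalIntegral.integral_congr fun s hs => ?_
      rw [uIcc_of_le ht] at hs
      exact hj (h s) (t - s) (sub_nonneg.2 hs.2)
    · exact (j.continuous.comp hh).intervalIntegrable _ _
    · refine Continuous.intervalIntegrable ?_ _ _
      refine intervalIntegral.continuous_parametric_intervalIntegral_of_continuous
        (f := fun s r => T r (A (h s))) ?_ (continuous_const.sub continuous_id)
      exact hT.comp continuous_snd (A.continuous.comp (hh.comp continuous_fst))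
  have e2 := integral_triangle (F := fun r s => T r (A (h s)))
    (hT.comp continuous_fst (A.continuous.comp (hh.comp continuous_snd))) ht
  rw [e1, e2, hv t ht, intervalIntegral.integral_add]
  · abel
  · exact (hT.comp continuous_id continuous_const).intervalIntegrable _ _
  · exact (hT.continuous_conv (A.continuous.comp hh)).intervalIntegrable _ _

theorem exp_conv_le {κ t : ℝ} (hκ : 0 < κ) :
    ∫ s in (0 : ℝ)..t, Real.exp (-κ * (t - s)) ≤ κ⁻¹ := by
  have hd : ∀ s, HasDerivAt (fun s => κ⁻¹ * Real.exp (-κ * (t - s))) (Real.exp (-κ * (t - s))) s := by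
    intro s
    have h1 : HasDerivAt (fun s => -κ * (t - s)) κ s := by
      simpa using ((hasDerivAt_id s).const_sub t).const_mul (-κ)
    exact (h1.exp.const_mul κ⁻¹).congr_deriv (by field_simp)
  rw [intervalIntegral.integral_eq_sub_of_hasDerivAt (fun s _ => hd s)
    (Continuous.intervalIntegrable (by fun_prop) _ _)]
  simp only [sub_self, mul_zero, Real.exp_zero, mul_one]
  have := mul_pos (inv_pos.2 hκ) (Real.exp_pos (-κ * (t - 0)))
  linarith

/-- Bounded perturbation of a strongly continuous family. -/
theorem exists_perturbation [CompleteSpace X] {T : ℝ → X →L[ℂ] X} (hT : StronglyCont T) {κ₀ : ℝ}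
    (hTb : ∀ t, 0 ≤ t → ‖T t‖ ≤ Real.exp (κ₀ * t)) (B : X →L[ℂ] X) :
    ∃ (S : ℝ → X →L[ℂ] X) (M β : ℝ), StronglyCont S ∧ 0 ≤ M ∧
      (∀ t, 0 ≤ t → ‖S t‖ ≤ M * Real.exp (β * t)) ∧
      ∀ v t, 0 ≤ t → S t v = T t v + ∫ s in (0 : ℝ)..t, T (t - s) (B (S s v)) := by
  -- With the weight e^{-βt}, β = κ₀ + κ, the Volterra operator has norm at most ‖B‖/κ, which this
  -- choice makes smaller than one.
  set κ : ℝ := 2 * ‖B‖ + 1 with hκ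
  have hκ0 : 0 < κ := by positivity
  set β : ℝ := κ₀ + κ with hβ
  -- weighted bound on the unperturbed family
  have hw : ∀ t s, s ≤ t → ∀ x, ‖Real.exp (-β * (t - s)) • T (t - s) x‖
      ≤ Real.exp (-κ * (t - s)) * ‖x‖ := by
    intro t s hs x
    rw [norm_smul, Real.norm_eq_abs, abs_of_pos (Real.exp_pos _)]
    have h1 : ‖T (t - s) x‖ ≤ Real.exp (κ₀ * (t - s)) * ‖x‖ :=
      ((T (t - s)).le_opNorm x).trans
        (mul_le_mul_of_nonneg_right (hTb _ (sub_nonneg.2 hs)) (norm_nonneg _))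
    refine (mul_le_mul_of_nonneg_left h1 (Real.exp_pos _).le).trans ?_
    rw [← mul_assoc, ← Real.exp_add]
    refine le_of_eq ?_
    congr 2
    rw [hβ]; ring
  -- The Volterra operator acting on weighted orbits e^{-βt} S(t)v. Freezing the time at 0 for
  -- negative arguments lets it act on bounded continuous functions on the whole line.
  let V0 : BoundedContinuousFunction ℝ X → ℝ → X := fun ψ t =>
    ∫ s in (0 : ℝ)..(max t 0), Real.exp (-β * (max t 0 - s)) • T (max t 0 - s) (B (ψ s))
  have hint : ∀ (ψ : BoundedContinuousFunction ℝ X) (t : ℝ), Continuous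
      (fun s => Real.exp (-β * (t - s)) • T (t - s) (B (ψ s))) := fun ψ t =>
    (by fun_prop : Continuous fun s => Real.exp (-β * (t - s))).smul
      (hT.comp (by fun_prop) (B.continuous.comp ψ.continuous))
  have V0c : ∀ ψ, Continuous (V0 ψ) := by
    intro ψ
    refine intervalIntegral.continuous_parametric_intervalIntegral_of_continuous
      (f := fun t s => Real.exp (-β * (max t 0 - s)) • T (max t 0 - s) (B (ψ s))) ?_ (by fun_prop)
    exact (by fun_prop : Continuous fun q : ℝ × ℝ => Real.exp (-β * (max q.1 0 - q.2))).smul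
      (hT.comp (by fun_prop) (B.continuous.comp (ψ.continuous.comp continuous_snd)))
  have V0b : ∀ (ψ : BoundedContinuousFunction ℝ X) (t : ℝ), ‖V0 ψ t‖ ≤ ‖B‖ * ‖ψ‖ * κ⁻¹ := by
    intro ψ t
    refine le_trans (intervalIntegral.norm_integral_le_of_norm_le
      (g := fun s => ‖B‖ * ‖ψ‖ * Real.exp (-κ * (max t 0 - s))) (le_max_right _ _) ?_
      (Continuous.intervalIntegrable (by fun_prop) _ _)) ?_
    · refine Filter.Eventually.of_forall fun s hs => ?_
      refine (hw _ _ hs.2 _).trans ?_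
      rw [mul_comm]
      refine mul_le_mul_of_nonneg_right ?_ (Real.exp_pos _).le
      exact (B.le_opNorm _).trans (mul_le_mul_of_nonneg_left (ψ.norm_coe_le_norm s) (norm_nonneg _))
    · rw [intervalIntegral.integral_const_mul]
      exact mul_le_mul_of_nonneg_left (exp_conv_le hκ0) (by positivity)
  let V1 : BoundedContinuousFunction ℝ X →ₗ[ℂ] BoundedContinuousFunction ℝ X :=
    { toFun := fun ψ => BoundedContinuousFunction.ofNormedAddCommGroup (V0 ψ) (V0c ψ) _ (V0b ψ)
      map_add' := by
        intro ψ χ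
        ext t
        simp only [BoundedContinuousFunction.coe_ofNormedAddCommGroup,
          BoundedContinuousFunction.coe_add, Pi.add_apply, V0, map_add, smul_add]
        exact intervalIntegral.integral_add ((hint ψ _).intervalIntegrable _ _)
          ((hint χ _).intervalIntegrable _ _)
      map_smul' := by
        intro c ψ
        ext t
        simp only [BoundedContinuousFunction.coe_ofNormedAddCommGroup,
          BoundedContinuousFunction.coe_smul, V0, map_smul, RingHom.id_apply]
        rw [← intervalIntegral.integral_smul]
        exact intervalIntegral.integral_congr fun s _ => smul_comm _ _ _ }
  have V1b : ∀ ψ, ‖V1 ψ‖ ≤ (‖B‖ * κ⁻¹) * ‖ψ‖ := by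
    intro ψ
    rw [BoundedContinuousFunction.norm_le (by positivity)]
    intro t
    refine (V0b ψ t).trans (le_of_eq (by ring))
  let V : BoundedContinuousFunction ℝ X →L[ℂ] BoundedContinuousFunction ℝ X :=
    V1.mkContinuous _ V1b
  have hV : ‖V‖ < 1 := by
    refine (V1.mkContinuous_norm_le (by positivity) V1b).trans_lt ?_
    rw [← div_eq_mul_inv, div_lt_one hκ0, hκ]
    linarith [norm_nonneg B]
  let T0 : X → ℝ → X := fun v t => Real.exp (-β * max t 0) • T (max t 0) v
  have T0c : ∀ v, Continuous (T0 v) := fun v =>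
    (by fun_prop : Continuous fun t : ℝ => Real.exp (-β * max t 0)).smul
      (hT.comp (by fun_prop) continuous_const)
  have T0b : ∀ v t, ‖T0 v t‖ ≤ ‖v‖ := by
    intro v t
    have := hw (max t 0) 0 (le_max_right _ _) v
    rw [sub_zero] at this
    refine this.trans (mul_le_of_le_one_left (norm_nonneg _) ?_)
    rw [Real.exp_le_one_iff]
    have := le_max_right t 0
    nlinarith
  let T1 : X →ₗ[ℂ] BoundedContinuousFunction ℝ X :=
    { toFun := fun v => BoundedContinuousFunction.ofNormedAddCommGroup (T0 v) (T0c v) _ (T0b v)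
      map_add' := by
        intro v w; ext t
        simp [T0]
      map_smul' := by
        intro c v; ext t
        simp only [BoundedContinuousFunction.coe_ofNormedAddCommGroup,
          BoundedContinuousFunction.coe_smul, T0, map_smul, RingHom.id_apply]
        exact smul_comm _ _ _ }
  have T1b : ∀ v, ‖T1 v‖ ≤ 1 * ‖v‖ := by
    intro v
    rw [BoundedContinuousFunction.norm_le (by positivity), one_mul]
    exact fun t => T0b v t
  let T2 : X →L[ℂ] BoundedContinuousFunction ℝ X := T1.mkContinuous _ T1b
  -- Neumann series: the weighted orbit of v is (1 - V)⁻¹ applied to the weighted free orbit, so it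
  -- depends linearly and boundedly on v.
  let U := Units.oneSub V hV
  let Q : X →L[ℂ] BoundedContinuousFunction ℝ X := (↑U⁻¹ : BoundedContinuousFunction ℝ X →L[ℂ]
    BoundedContinuousFunction ℝ X).comp T2
  have hQ : ∀ v, Q v = T2 v + V (Q v) := by
    intro v
    have h1 : (U : BoundedContinuousFunction ℝ X →L[ℂ] BoundedContinuousFunction ℝ X) (Q v) = T2 v := by
      change ((U : BoundedContinuousFunction ℝ X →L[ℂ] BoundedContinuousFunction ℝ X) * ↑U⁻¹) (T2 v)
        = T2 v
      rw [Units.mul_inv]; rfl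
    rw [Units.val_oneSub] at h1
    rw [← h1]
    simp
  have hQt : ∀ v t, Q v t = T0 v t + V0 (Q v) t := by
    intro v t
    conv_lhs => rw [hQ v]
    rfl
  let ev : ℝ → BoundedContinuousFunction ℝ X →L[ℂ] X := fun t =>
    LinearMap.mkContinuous
      { toFun := fun ψ => ψ t, map_add' := fun _ _ => rfl, map_smul' := fun _ _ => rfl } 1
      (fun ψ => by rw [one_mul]; exact ψ.norm_coe_le_norm t)
  have hev : ∀ t, ‖ev t‖ ≤ 1 := fun t => LinearMap.mkContinuous_norm_le _ zero_le_one _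
  let S : ℝ → X →L[ℂ] X := fun t => ((Real.exp (β * t) : ℝ) : ℂ) • (ev t).comp Q
  have hSapp : ∀ t v, S t v = Real.exp (β * t) • Q v t := by
    intro t v
    change ((Real.exp (β * t) : ℝ) : ℂ) • (Q v t) = _
    exact Complex.coe_smul _ _
  have hSb : ∀ t, ‖S t‖ ≤ ‖Q‖ * Real.exp (β * t) := by
    intro t
    rw [norm_smul, Complex.norm_real, Real.norm_eq_abs, abs_of_pos (Real.exp_pos _), mul_comm]
    refine mul_le_mul_of_nonneg_right ?_ (Real.exp_pos _).le
    refine (ContinuousLinearMap.opNorm_comp_le _ _).trans ?_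
    exact mul_le_of_le_one_left (norm_nonneg _) (hev t)
  refine ⟨S, ‖Q‖, β, ?_, norm_nonneg _, fun t _ => hSb t, ?_⟩
  · refine stronglyCont_of_orbits (fun v => ?_) (b := fun t => ‖Q‖ * Real.exp (β * t))
      (by fun_prop) hSb
    simp only [hSapp]
    exact (by fun_prop : Continuous fun t => Real.exp (β * t)).smul (Q v).continuous
  · intro v t ht
    rw [hSapp, hQt]
    simp only [T0, V0, max_eq_left ht, smul_add, smul_smul, ← Real.exp_add]
    congr 1
    · simp
    · rw [← intervalIntegral.integral_smul]
      refine intervalIntegral.integral_congr fun s _ => ?_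
      simp only [hSapp, smul_smul, ← Real.exp_add]
      rw [← Complex.coe_smul (Real.exp (β * s)), map_smul, map_smul, Complex.coe_smul]
      congr 2
      ring

end Volterra

/-! ### The space `L²(-1,1)` and continuous functions on `[-1,1]` -/

/-- Lebesgue measure on `(-1,1)`. -/
abbrev symMeasure : Measure ℝ := volume.restrict (Ioo (-1) 1)

/-- The complex space `L²(-1,1)`. -/
abbrev L2s : Type := Lp ℂ 2 symMeasure

/-- Continuous complex functions on `[-1,1]`. -/
abbrev CI : Type := C(Icc (-1 : ℝ) 1, ℂ)

theorem ae_mem_sym : ∀ᵐ x ∂symMeasure, x ∈ Ioo (-1 : ℝ) 1 := ae_restrict_mem measurableSet_Ioo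

/-- Composition with a map that does not concentrate mass, as an operator between `L²` spaces. -/
theorem exists_compLp {μ ν : Measure ℝ} {φ : ℝ → ℝ} (hφ : Measurable φ) {C : NNReal}
    (h : μ.map φ ≤ (C : ENNReal) • ν) :
    ∃ A : Lp ℂ 2 ν →L[ℂ] Lp ℂ 2 μ, (∀ f, A f =ᵐ[μ] fun x => f (φ x)) ∧ ‖A‖ ≤ √C := by
  have hac : (μ.map φ).AbsolutelyContinuous ν := Measure.absolutelyContinuous_of_le_smul h
  have hq : ∀ {f g : ℝ → ℂ}, f =ᵐ[ν] g → (fun x => f (φ x)) =ᵐ[μ] fun x => g (φ x) := fun hfg =>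
    ae_of_ae_map hφ.aemeasurable (hac.ae_le hfg)
  have hm : ∀ f : Lp ℂ 2 ν, MemLp (fun x => f (φ x)) 2 μ := fun f =>
    ((Lp.memLp f).of_measure_le_smul ENNReal.coe_ne_top h).comp_of_map hφ.aemeasurable
  let A0 : Lp ℂ 2 ν →ₗ[ℂ] Lp ℂ 2 μ :=
    { toFun := fun f => (hm f).toLp _
      map_add' := by
        intro f g
        apply Lp.ext
        filter_upwards [(hm (f + g)).coeFn_toLp, (hm f).coeFn_toLp, (hm g).coeFn_toLp,
          Lp.coeFn_add ((hm f).toLp _) ((hm g).toLp _), hq (Lp.coeFn_add f g)] with x h1 h2 h3 h4 h5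
        rw [h1, h4, Pi.add_apply, h2, h3, h5, Pi.add_apply]
      map_smul' := by
        intro c f
        apply Lp.ext
        filter_upwards [(hm (c • f)).coeFn_toLp, (hm f).coeFn_toLp,
          Lp.coeFn_smul c ((hm f).toLp _), hq (Lp.coeFn_smul c f)] with x h1 h2 h4 h5
        rw [h1, RingHom.id_apply, h4, Pi.smul_apply, h2, h5, Pi.smul_apply] }
  have hb : ∀ f, ‖A0 f‖ ≤ √C * ‖f‖ := by
    intro f
    have h1 : eLpNorm (fun x => f (φ x)) 2 μ ≤ (C : ENNReal) ^ (1 / 2 : ℝ) * eLpNorm f 2 ν := by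
      have h2 := eLpNorm_map_measure (p := 2) ((Lp.aestronglyMeasurable f).mono_ac hac)
        hφ.aemeasurable
      change eLpNorm (f ∘ φ) 2 μ ≤ _
      rw [← h2]
      refine (eLpNorm_mono_measure _ h).trans ?_
      rw [eLpNorm_smul_measure_of_ne_top (by norm_num), smul_eq_mul]
      norm_num
    change ‖(hm f).toLp _‖ ≤ _
    rw [Lp.norm_toLp, Lp.norm_def]
    have h3 := ENNReal.toReal_mono (ENNReal.mul_ne_top
      (ENNReal.rpow_ne_top_of_nonneg (by norm_num) ENNReal.coe_ne_top) (Lp.eLpNorm_ne_top f)) h1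
    refine h3.trans (le_of_eq ?_)
    rw [ENNReal.toReal_mul, ← ENNReal.toReal_rpow, ENNReal.coe_toReal, Real.sqrt_eq_rpow]
  exact ⟨A0.mkContinuous _ hb, fun f => (hm f).coeFn_toLp,
    A0.mkContinuous_norm_le (Real.sqrt_nonneg _) hb⟩

/-- Change of variables: an affine map of slope s pushes Lebesgue measure to |s|⁻¹ times itself.
Through `exists_compLp` this makes composition bounded on L² with norm at most √|s⁻¹|. -/
theorem map_affine_restrict_le {b s : ℝ} (hs : s ≠ 0) {U V : Set ℝ} (hV : MeasurableSet V)
    (h : ∀ x ∈ U, b + s * x ∈ V) :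
    (volume.restrict U).map (fun x => b + s * x)
      ≤ ((Real.toNNReal |s⁻¹| : NNReal) : ENNReal) • volume.restrict V := by
  have hm : Measurable fun x : ℝ => b + s * x := by fun_prop
  have e : (volume : Measure ℝ).map (fun x => b + s * x) = ENNReal.ofReal |s⁻¹| • volume := by
    have : (fun x : ℝ => b + s * x) = (fun x => b + x) ∘ fun x => s * x := rfl
    rw [this, ← Measure.map_map (by fun_prop) (by fun_prop), Real.map_volume_mul_left hs,
      Measure.map_smul, map_add_left_eq_self]
  change _ ≤ ENNReal.ofReal |s⁻¹| • volume.restrict V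
  rw [← Measure.restrict_smul, ← e, Measure.restrict_map hm hV]
  exact Measure.map_mono (Measure.restrict_mono h le_rfl) hm

theorem affine_mem_Icc {b s : ℝ} (h : |b| + |s| ≤ 1) {x : ℝ} (hx : x ∈ Icc (-1 : ℝ) 1) :
    b + s * x ∈ Icc (-1 : ℝ) 1 := by
  rw [mem_Icc, ← abs_le] at hx ⊢
  refine (abs_add_le _ _).trans ?_
  rw [abs_mul]
  nlinarith [abs_nonneg s]

theorem affine_mem_Ioo {b s : ℝ} (hs : s ≠ 0) (h : |b| + |s| ≤ 1) {x : ℝ}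
    (hx : x ∈ Ioo (-1 : ℝ) 1) : b + s * x ∈ Ioo (-1 : ℝ) 1 := by
  rw [mem_Ioo, ← abs_lt] at hx ⊢
  refine (abs_add_le _ _).trans_lt ?_
  rw [abs_mul]
  nlinarith [abs_pos.2 hs]

/-- The function on `ℝ` that extends `g` by constants. -/
def xt (g : CI) (x : ℝ) : ℂ := g (projIcc (-1) 1 (by norm_num) x)

theorem xt_continuous (g : CI) : Continuous (xt g) := g.continuous.comp continuous_projIcc

theorem xt_of_mem (g : CI) {x : ℝ} (hx : x ∈ Icc (-1 : ℝ) 1) : xt g x = g ⟨x, hx⟩ := by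
  rw [xt, projIcc_of_mem _ hx]

theorem xt_coe (g : CI) (x : Icc (-1 : ℝ) 1) : xt g x = g x := xt_of_mem g x.2

@[simp] theorem xt_add (g h : CI) (x : ℝ) : xt (g + h) x = xt g x + xt h x := rfl
@[simp] theorem xt_sub (g h : CI) (x : ℝ) : xt (g - h) x = xt g x - xt h x := rfl
@[simp] theorem xt_smul (c : ℂ) (g : CI) (x : ℝ) : xt (c • g) x = c * xt g x := rfl
@[simp] theorem xt_mul (g h : CI) (x : ℝ) : xt (g * h) x = xt g x * xt h x := rfl
@[simp] theorem xt_zero (x : ℝ) : xt 0 x = 0 := rfl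

theorem norm_xt_le (g : CI) (x : ℝ) : ‖xt g x‖ ≤ ‖g‖ := g.norm_coe_le_norm _

theorem CI_ext {g h : CI} (H : ∀ x ∈ Icc (-1 : ℝ) 1, xt g x = xt h x) : g = h := by
  ext x
  rw [← xt_coe, ← xt_coe]
  exact H x x.2

/-- The restriction of a continuous function to `[-1,1]`. -/
def toCI (F : ℝ → ℂ) (hF : Continuous F) : CI := ⟨fun x => F x, hF.comp continuous_subtype_val⟩

theorem xt_toCI {F : ℝ → ℂ} (hF : Continuous F) {x : ℝ} (hx : x ∈ Icc (-1 : ℝ) 1) :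
    xt (toCI F hF) x = F x := xt_of_mem _ hx

/-- Evaluation at a point as a functional on `C[-1,1]`. -/
def evalCI (x : ℝ) : CI →L[ℂ] ℂ :=
  LinearMap.mkContinuous
    { toFun := fun g => xt g x, map_add' := fun _ _ => rfl, map_smul' := fun _ _ => rfl } 1
    fun g => by rw [one_mul]; exact norm_xt_le g x

/-- Continuity of a curve in `C[-1,1]` from joint continuity. -/
theorem continuous_toCI {α : Type*} [TopologicalSpace α] {F : α → ℝ → ℂ}
    (hF : Continuous (Function.uncurry F)) :
    Continuous fun a => toCI (F a) (hF.comp (Continuous.prodMk_right a)) :=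
  ContinuousMap.continuous_of_continuous_uncurry _
    (hF.comp (continuous_fst.prodMk (continuous_subtype_val.comp continuous_snd)))

/-- Pointwise evaluation of integrals of curves in `C[-1,1]`. -/
theorem xt_intervalIntegral {F : ℝ → CI} (hF : Continuous F) (a b x : ℝ) :
    xt (∫ t in a..b, F t) x = ∫ t in a..b, xt (F t) x :=
  ((evalCI x).intervalIntegral_comp_comm (hF.intervalIntegrable a b)).symm

theorem xt_memLp (g : CI) {μ : Measure ℝ} [IsFiniteMeasure μ] : MemLp (xt g) 2 μ :=
  MemLp.of_bound (xt_continuous g).aestronglyMeasurable ‖g‖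
    (Filter.Eventually.of_forall fun x => norm_xt_le g x)

/-- The class in `L²(-1,1)` of a continuous function. -/
def cl : CI →L[ℂ] L2s :=
  LinearMap.mkContinuous
    { toFun := fun g => (xt_memLp g).toLp _
      map_add' := fun _ _ => rfl
      map_smul' := fun _ _ => rfl }
    (measureUnivNNReal symMeasure ^ (ENNReal.toReal 2)⁻¹) (by
      intro g
      refine Lp.norm_le_of_ae_bound (norm_nonneg _) ?_
      filter_upwards [(xt_memLp g (μ := symMeasure)).coeFn_toLp] with x hx
      change ‖((xt_memLp g).toLp _ : L2s) x‖ ≤ _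
      rw [hx]
      exact norm_xt_le g x)

theorem cl_ae (g : CI) : cl g =ᵐ[symMeasure] xt g := (xt_memLp g).coeFn_toLp

theorem dense_cl : DenseRange cl := by
  refine (BoundedContinuousFunction.toLp_denseRange ℂ symMeasure ℂ (p := 2) (by norm_num)).mono ?_
  rintro _ ⟨g, rfl⟩
  refine ⟨toCI g g.continuous, ?_⟩
  apply Lp.ext
  filter_upwards [cl_ae (toCI g g.continuous), BoundedContinuousFunction.coeFn_toLp ℂ (p := 2)
    (μ := symMeasure) (f := g), ae_mem_sym] with x h1 h2 h3
  rw [h1, h2, xt_toCI _ (Ioo_subset_Icc_self h3)]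

/-- Density of continuous functions reduces operator identities on L² to pointwise computations. -/
theorem L2s_clm_ext {E : Type*} [TopologicalSpace E] [T2Space E] [AddCommMonoid E] [Module ℂ E]
    {A B : L2s →L[ℂ] E} (h : ∀ g, A (cl g) = B (cl g)) (f : L2s) : A f = B f :=
  congrFun (dense_cl.equalizer A.continuous B.continuous (funext h)) f

theorem cl_injective : Function.Injective cl := by
  intro g h e
  have h1 : xt g =ᵐ[symMeasure] xt h := (cl_ae g).symm.trans ((Filter.EventuallyEq.of_eq
    (congrArg (fun f : L2s => (f : ℝ → ℂ)) e)).trans (cl_ae h))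
  have h2 := Measure.eqOn_open_of_ae_eq h1 isOpen_Ioo (xt_continuous g).continuousOn
    (xt_continuous h).continuousOn
  have h3 := h2.closure (xt_continuous g) (xt_continuous h)
  rw [closure_Ioo (by norm_num)] at h3
  exact CI_ext h3

/-! ### Composition with affine maps -/

/-- Composition with the affine map `x ↦ b + s x`. -/
def affCI (b s : ℝ) : CI →L[ℂ] CI :=
  LinearMap.mkContinuous
    { toFun := fun g => toCI (fun x => xt g (b + s * x)) ((xt_continuous g).comp (by fun_prop))
      map_add' := fun _ _ => rfl
      map_smul' := fun _ _ => rfl } 1 (by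
      intro g
      rw [one_mul, ContinuousMap.norm_le _ (norm_nonneg _)]
      exact fun x => norm_xt_le g _)

theorem xt_affCI (b s : ℝ) (g : CI) {x : ℝ} (hx : x ∈ Icc (-1 : ℝ) 1) :
    xt (affCI b s g) x = xt g (b + s * x) :=
  xt_of_mem _ hx

theorem continuous_affCI {α : Type*} [TopologicalSpace α] {b s : α → ℝ} (hb : Continuous b)
    (hs : Continuous s) (g : CI) : Continuous fun a => affCI (b a) (s a) g :=
  continuous_toCI (F := fun a x => xt g (b a + s a * x))
    ((xt_continuous g).comp ((hb.comp continuous_fst).add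
      ((hs.comp continuous_fst).mul continuous_snd)))

/-- The admissibility conditions stand inside the existential so that the chosen operator is a total
function of b and s; outside the admissible range the witness is 0. -/
theorem exists_affL2 (b s : ℝ) : ∃ A : L2s →L[ℂ] L2s, (s ≠ 0 → |b| + |s| ≤ 1 →
    ((∀ f, A f =ᵐ[symMeasure] fun x => f (b + s * x)) ∧ ‖A‖ ≤ √|s⁻¹|)) := by
  by_cases h : s ≠ 0 ∧ |b| + |s| ≤ 1
  · obtain ⟨A, h1, h2⟩ := exists_compLp (by fun_prop : Measurable fun x : ℝ => b + s * x)
      (map_affine_restrict_le h.1 measurableSet_Ioo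
        fun x hx => affine_mem_Ioo h.1 h.2 hx)
    refine ⟨A, fun _ _ => ⟨h1, ?_⟩⟩
    rwa [Real.coe_toNNReal _ (abs_nonneg _)] at h2
  · exact ⟨0, fun h1 h2 => absurd ⟨h1, h2⟩ h⟩

/-- Composition with the affine map `x ↦ b + s x` on `L²(-1,1)`. -/
def affL2 (b s : ℝ) : L2s →L[ℂ] L2s := (exists_affL2 b s).choose

theorem affL2_ae {b s : ℝ} (hs : s ≠ 0) (h : |b| + |s| ≤ 1) (f : L2s) :
    affL2 b s f =ᵐ[symMeasure] fun x => f (b + s * x) :=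
  ((exists_affL2 b s).choose_spec hs h).1 f

theorem norm_affL2_le {b s : ℝ} (hs : s ≠ 0) (h : |b| + |s| ≤ 1) :
    ‖affL2 b s‖ ≤ √|s⁻¹| := ((exists_affL2 b s).choose_spec hs h).2

theorem affL2_cl {b s : ℝ} (hs : s ≠ 0) (h : |b| + |s| ≤ 1) (g : CI) :
    affL2 b s (cl g) = cl (affCI b s g) := by
  have hac := Measure.absolutelyContinuous_of_le_smul (map_affine_restrict_le hs
    measurableSet_Ioo fun x hx => affine_mem_Ioo hs h hx)
  have hq := ae_of_ae_map (by fun_prop : Measurable fun x : ℝ => b + s * x).aemeasurable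
    (hac.ae_le (cl_ae g))
  apply Lp.ext
  filter_upwards [affL2_ae hs h (cl g), hq, cl_ae (affCI b s g), ae_mem_sym] with x h1 h2 h3 h4
  rw [h1, h2, h3, xt_affCI _ _ _ (Ioo_subset_Icc_self h4)]

/-! ### Primitives -/

theorem integral_norm_le {μ : Measure ℝ} [IsFiniteMeasure μ] (f : Lp ℂ 2 μ) :
    ∫ x, ‖f x‖ ∂μ ≤ ((μ univ) ^ (1 / 2 : ℝ)).toReal * ‖f‖ := by
  have h := eLpNorm_le_eLpNorm_mul_rpow_measure_univ (p := 1) (q := 2) (by norm_num)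
    (Lp.aestronglyMeasurable f)
  rw [integral_norm_eq_lintegral_enorm (Lp.aestronglyMeasurable f),
    ← eLpNorm_one_eq_lintegral_enorm, Lp.norm_def, mul_comm, ← ENNReal.toReal_mul]
  refine ENNReal.toReal_mono (ENNReal.mul_ne_top (Lp.eLpNorm_ne_top f)
    (ENNReal.rpow_ne_top_of_nonneg (by norm_num) (measure_ne_top _ _))) ?_
  convert h using 2
  norm_num

/-- The extension by zero of the representative of `f`. -/
def ind (f : L2s) : ℝ → ℂ := (Ioo (-1 : ℝ) 1).indicator f

theorem ind_integrable (f : L2s) : Integrable (ind f) :=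
  (integrable_indicator_iff measurableSet_Ioo).2 ((Lp.memLp f).integrable (by norm_num))

theorem integral_norm_ind (f : L2s) : ∫ x, ‖ind f x‖ = ∫ x, ‖f x‖ ∂symMeasure := by
  rw [← integral_indicator measurableSet_Ioo]
  congr 1
  ext x
  simp only [ind, norm_indicator_eq_indicator_norm]

theorem ind_congr {f : L2s} {F : ℝ → ℂ} (h : f =ᵐ[symMeasure] F) :
    ind f =ᵐ[volume] (Ioo (-1 : ℝ) 1).indicator F := by
  have h1 := (ae_restrict_iff' measurableSet_Ioo).1 h
  filter_upwards [h1] with x hx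
  by_cases hm : x ∈ Ioo (-1 : ℝ) 1
  · simp [ind, hm, hx hm]
  · simp [ind, hm]

theorem ind_add (f g : L2s) : ind (f + g) =ᵐ[volume] ind f + ind g := by
  refine (ind_congr (Lp.coeFn_add f g)).trans (Filter.EventuallyEq.of_eq ?_)
  exact indicator_add' _ _ _

theorem ind_smul (c : ℂ) (f : L2s) : ind (c • f) =ᵐ[volume] c • ind f := by
  refine (ind_congr (Lp.coeFn_smul c f)).trans (Filter.EventuallyEq.of_eq ?_)
  exact indicator_const_smul (Ioo (-1 : ℝ) 1) c (f : ℝ → ℂ)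

/-- The primitive `x ↦ ∫₁ˣ f`. -/
def primL2 : L2s →L[ℂ] CI :=
  LinearMap.mkContinuous
    { toFun := fun f => toCI (fun x => ∫ s in (1 : ℝ)..x, ind f s)
        (intervalIntegral.continuous_primitive (fun _ _ => (ind_integrable f).intervalIntegrable) 1)
      map_add' := by
        intro f g
        ext x
        change ∫ s in (1 : ℝ)..x, ind (f + g) s = (∫ s in (1 : ℝ)..x, ind f s) + ∫ s in (1 : ℝ)..x, ind g s
        rw [← intervalIntegral.integral_add (ind_integrable f).intervalIntegrable
          (ind_integrable g).intervalIntegrable]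
        exact intervalIntegral.integral_congr_ae
          ((ind_add f g).mono fun s hs _ => by rw [hs, Pi.add_apply])
      map_smul' := by
        intro c f
        ext x
        change ∫ s in (1 : ℝ)..x, ind (c • f) s = c • ∫ s in (1 : ℝ)..x, ind f s
        rw [← intervalIntegral.integral_smul]
        exact intervalIntegral.integral_congr_ae
          ((ind_smul c f).mono fun s hs _ => by rw [hs, Pi.smul_apply]) }
    ((symMeasure univ) ^ (1 / 2 : ℝ)).toReal (by
      intro f
      rw [ContinuousMap.norm_le _ (by positivity)]
      intro x
      refine le_trans ?_ (integral_norm_le f)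
      rw [← integral_norm_ind]
      exact intervalIntegral.norm_integral_le_integral_norm_uIoc.trans
        (setIntegral_le_integral (ind_integrable f).norm
          (Filter.Eventually.of_forall fun _ => norm_nonneg _)))

theorem xt_primL2 (f : L2s) {x : ℝ} (hx : x ∈ Icc (-1 : ℝ) 1) :
    xt (primL2 f) x = ∫ s in (1 : ℝ)..x, ind f s :=
  xt_of_mem _ hx

/-- The primitive `x ↦ ∫₁ˣ g` of a continuous function. -/
def primCI : CI →L[ℂ] CI := primL2.comp cl

theorem xt_primCI (g : CI) {x : ℝ} (hx : x ∈ Icc (-1 : ℝ) 1) :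
    xt (primCI g) x = ∫ s in (1 : ℝ)..x, xt g s := by
  change xt (primL2 (cl g)) x = _
  rw [xt_primL2 _ hx]
  refine intervalIntegral.integral_congr_ae ?_
  -- The zero extension `ind` vanishes at the endpoint 1, which belongs to the interval of
  -- integration, so that point is discarded.
  have hne : ∀ᵐ s : ℝ, s ≠ 1 := by simp [ae_iff, measure_singleton]
  filter_upwards [ind_congr (cl_ae g), hne] with s hs hs1 hm
  rw [hs, indicator_of_mem]
  rw [uIoc_of_ge hx.2] at hm
  exact ⟨hx.1.trans_lt hm.1, lt_of_le_of_ne hm.2 hs1⟩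

/-- Constant functions. -/
def constCI : ℂ →L[ℂ] CI := ContinuousLinearMap.toSpanSingleton ℂ 1

@[simp] theorem xt_constCI (c : ℂ) (x : ℝ) : xt (constCI c) x = c := by
  simp only [constCI, ContinuousLinearMap.toSpanSingleton_apply, xt_smul]
  change c * 1 = c
  rw [mul_one]

/-! ### Multiplication of L² functions by continuous functions -/

theorem memLp_xt_mul (g : CI) (f : L2s) : MemLp (fun x => xt g x * f x) 2 symMeasure := by
  refine (Lp.memLp f).of_le_mul (c := ‖g‖)
    ((xt_continuous g).aestronglyMeasurable.mul (Lp.aestronglyMeasurable f))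
    (Filter.Eventually.of_forall fun x => ?_)
  rw [norm_mul]
  exact mul_le_mul_of_nonneg_right (norm_xt_le g x) (norm_nonneg _)

/-- Multiplication of `L²` functions by continuous functions. -/
def mulL2 : CI →L[ℂ] L2s →L[ℂ] L2s := by
  refine LinearMap.mkContinuous₂ (LinearMap.mk₂ ℂ (fun g f => (memLp_xt_mul g f).toLp _) ?_ ?_ ?_ ?_) 1 ?_
  · intro g h f
    apply Lp.ext
    filter_upwards [(memLp_xt_mul (g + h) f).coeFn_toLp, (memLp_xt_mul g f).coeFn_toLp, (memLp_xt_mul h f).coeFn_toLp,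
      Lp.coeFn_add ((memLp_xt_mul g f).toLp _) ((memLp_xt_mul h f).toLp _)] with x h1 h2 h3 h4
    rw [h1, h4, Pi.add_apply, h2, h3, xt_add, add_mul]
  · intro c g f
    apply Lp.ext
    filter_upwards [(memLp_xt_mul (c • g) f).coeFn_toLp, (memLp_xt_mul g f).coeFn_toLp,
      Lp.coeFn_smul c ((memLp_xt_mul g f).toLp _)] with x h1 h2 h4
    rw [h1, h4, Pi.smul_apply, h2, xt_smul, smul_eq_mul, mul_assoc]
  · intro g f f'
    apply Lp.ext
    filter_upwards [(memLp_xt_mul g (f + f')).coeFn_toLp, (memLp_xt_mul g f).coeFn_toLp, (memLp_xt_mul g f').coeFn_toLp,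
      Lp.coeFn_add ((memLp_xt_mul g f).toLp _) ((memLp_xt_mul g f').toLp _), Lp.coeFn_add f f'] with x h1 h2 h3 h4 h5
    rw [h1, h4, Pi.add_apply, h2, h3, h5, Pi.add_apply, mul_add]
  · intro c g f
    apply Lp.ext
    filter_upwards [(memLp_xt_mul g (c • f)).coeFn_toLp, (memLp_xt_mul g f).coeFn_toLp,
      Lp.coeFn_smul c ((memLp_xt_mul g f).toLp _), Lp.coeFn_smul c f] with x h1 h2 h4 h5
    rw [h1, h4, Pi.smul_apply, h2, h5, Pi.smul_apply, smul_eq_mul, smul_eq_mul, mul_left_comm]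
  · intro g f
    rw [one_mul]
    refine Lp.norm_le_mul_norm_of_ae_le_mul ?_
    filter_upwards [(memLp_xt_mul g f).coeFn_toLp] with x hx
    rw [LinearMap.mk₂_apply, hx, norm_mul]
    exact mul_le_mul_of_nonneg_right (norm_xt_le g x) (norm_nonneg _)

theorem mulL2_ae (g : CI) (f : L2s) : mulL2 g f =ᵐ[symMeasure] fun x => xt g x * f x :=
  (memLp_xt_mul g f).coeFn_toLp

theorem mulL2_cl (g h : CI) : mulL2 g (cl h) = cl (g * h) := by
  apply Lp.ext
  filter_upwards [mulL2_ae g (cl h), cl_ae h, cl_ae (g * h)] with x h1 h2 h3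
  rw [h1, h2, h3, xt_mul]

/-! ### The dilation semigroup about the point `1` -/

/-- The exponential factor `exp (-κ t)`, frozen for `t ≤ 0`. -/
def ex (κ t : ℝ) : ℂ := ((Real.exp (-κ * max t 0) : ℝ) : ℂ)

theorem ex_continuous (κ : ℝ) : Continuous (ex κ) :=
  Complex.continuous_ofReal.comp (by fun_prop)

theorem norm_ex (κ t : ℝ) : ‖ex κ t‖ = Real.exp (-κ * max t 0) := by
  rw [ex, Complex.norm_real, Real.norm_eq_abs, abs_of_pos (Real.exp_pos _)]

theorem norm_ex_le {κ : ℝ} (hκ : 0 ≤ κ) (t : ℝ) : ‖ex κ t‖ ≤ 1 := by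
  rw [norm_ex, Real.exp_le_one_iff]
  have := le_max_right t 0
  nlinarith

theorem ex_add (κ κ' t : ℝ) : ex (κ + κ') t = ex κ t * ex κ' t := by
  rw [ex, ex, ex, ← Complex.ofReal_mul, ← Real.exp_add]
  congr 3
  ring

theorem ex_of_nonneg (κ : ℝ) {t : ℝ} (ht : 0 ≤ t) : ex κ t = ((Real.exp (-κ * t) : ℝ) : ℂ) := by
  rw [ex, max_eq_left ht]

theorem ex_zero (κ : ℝ) : ex κ 0 = 1 := by simp [ex]

theorem ex_hasDerivAt (κ : ℝ) {t : ℝ} (ht : 0 < t) : HasDerivAt (ex κ) (-κ * ex κ t) t := by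
  have h1 : HasDerivAt (fun t => ((Real.exp (-κ * t) : ℝ) : ℂ)) (-κ * ex κ t) t := by
    have h2 : HasDerivAt (fun t => Real.exp (-κ * t)) (Real.exp (-κ * t) * (-κ)) t := by
      simpa using ((hasDerivAt_id t).const_mul (-κ)).exp
    refine h2.ofReal_comp.congr_deriv ?_
    rw [ex_of_nonneg _ ht.le]
    push_cast
    ring
  refine h1.congr_of_eventuallyEq ?_
  filter_upwards [lt_mem_nhds ht] with s hs
  rw [ex_of_nonneg _ (le_of_lt hs)]

/-- The contraction factor `exp (-t)`, frozen for `t ≤ 0`. -/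
def sc (t : ℝ) : ℝ := Real.exp (-max t 0)

theorem sc_pos (t : ℝ) : 0 < sc t := Real.exp_pos _

theorem sc_le_one (t : ℝ) : sc t ≤ 1 := by
  rw [sc, Real.exp_le_one_iff]
  linarith [le_max_right t 0]

theorem sc_continuous : Continuous sc := by unfold sc; fun_prop

theorem sc_eq_ex (t : ℝ) : (sc t : ℂ) = ex 1 t := by simp [sc, ex]

theorem abs_sc (t : ℝ) : |1 - sc t| + |sc t| ≤ 1 := by
  rw [abs_of_pos (sc_pos t), abs_of_nonneg (sub_nonneg.2 (sc_le_one t))]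
  linarith

/-- `f ↦ f (1 + e^{-t} (x - 1))` on `L²(-1,1)`. -/
def dl (t : ℝ) : L2s →L[ℂ] L2s := affL2 (1 - sc t) (sc t)

/-- `g ↦ g (1 + e^{-t} (x - 1))` on `C[-1,1]`. -/
def dlC (t : ℝ) : CI →L[ℂ] CI := affCI (1 - sc t) (sc t)

theorem dl_cl (t : ℝ) (g : CI) : dl t (cl g) = cl (dlC t g) :=
  affL2_cl (sc_pos t).ne' (abs_sc t) g

theorem xt_dlC (t : ℝ) (g : CI) {x : ℝ} (hx : x ∈ Icc (-1 : ℝ) 1) :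
    xt (dlC t g) x = xt g (1 - sc t + sc t * x) := xt_affCI _ _ _ hx

/-- The change of variables costs only e^{t/2}. The cruder e^t suffices, because any exponential
rate is later beaten by taking enough derivatives. -/
theorem norm_dl_le (t : ℝ) : ‖dl t‖ ≤ Real.exp (max t 0) := by
  refine (norm_affL2_le (sc_pos t).ne' (abs_sc t)).trans ?_
  rw [sc, ← Real.exp_neg, neg_neg, abs_of_pos (Real.exp_pos _), Real.sqrt_le_iff]
  refine ⟨(Real.exp_pos _).le, ?_⟩
  have : 1 ≤ Real.exp (max t 0) := Real.one_le_exp (le_max_right _ _)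
  nlinarith

/-- An ε/3 argument: near a fixed time the operators are uniformly bounded, so an approximation by
an element with continuous orbit costs little at both times. -/
theorem continuous_orbit_of_dense {E F D : Type*} [NormedAddCommGroup E] [NormedSpace ℂ E]
    [NormedAddCommGroup F] [NormedSpace ℂ F] {S : ℝ → E →L[ℂ] F} {b : ℝ → ℝ} (hb : Continuous b)
    (hbd : ∀ t, ‖S t‖ ≤ b t) {e : D → E} (he : DenseRange e)
    (hc : ∀ d, Continuous fun t => S t (e d)) (f : E) : Continuous fun t => S t f := by
  refine continuous_iff_continuousAt.2 fun t₀ => ?_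
  rw [Metric.continuousAt_iff']
  intro ε hε
  have hb0 : 0 ≤ b t₀ := (norm_nonneg _).trans (hbd t₀)
  obtain ⟨d, hd⟩ := he.exists_dist_lt f (ε := ε / (3 * (b t₀ + 1))) (by positivity)
  have hd' : (b t₀ + 1) * ‖f - e d‖ < ε / 3 := by
    rw [dist_eq_norm, lt_div_iff₀ (by positivity)] at hd
    linarith
  filter_upwards [hb.continuousAt.eventually_lt_const (lt_add_one (b t₀)),
    (Metric.continuousAt_iff'.1 (hc d).continuousAt) (ε / 3) (by positivity)] with t h1 h2
  have h3 : ∀ s, b s ≤ b t₀ + 1 → ‖S s (f - e d)‖ < ε / 3 := fun s hs =>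
    (((S s).le_opNorm _).trans (mul_le_mul_of_nonneg_right ((hbd s).trans hs)
      (norm_nonneg _))).trans_lt hd'
  have h4 := h3 t h1.le
  have h5 := h3 t₀ (by linarith)
  rw [dist_eq_norm] at h2 ⊢
  have e1 : S t f - S t₀ f = S t (f - e d) - S t₀ (f - e d) + (S t (e d) - S t₀ (e d)) := by
    simp only [map_sub]; abel
  rw [e1]
  have := norm_add_le (S t (f - e d) - S t₀ (f - e d)) (S t (e d) - S t₀ (e d))
  have := norm_sub_le (S t (f - e d)) (S t₀ (f - e d))
  linarith

theorem dl_stronglyCont : StronglyCont dl := by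
  have hb : Continuous fun t : ℝ => Real.exp (max t 0) := by fun_prop
  refine stronglyCont_of_orbits (fun f => ?_) hb norm_dl_le
  refine continuous_orbit_of_dense hb norm_dl_le dense_cl (fun g => ?_) f
  simp only [dl_cl]
  exact cl.continuous.comp
    (continuous_affCI (continuous_const.sub sc_continuous) sc_continuous g)

/-- `(c, f) ↦ c + ∫₁ˣ f`. -/
def prim0 : ℂ × L2s →L[ℂ] CI :=
  constCI.comp (ContinuousLinearMap.fst ℂ ℂ L2s) + primL2.comp (ContinuousLinearMap.snd ℂ ℂ L2s)

theorem prim0_apply (c : ℂ) (f : L2s) : prim0 (c, f) = constCI c + primL2 f := rfl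

/-- The function `1 - x`. -/
def oneSub : CI := toCI (fun x => 1 - (x : ℂ)) (by fun_prop)

theorem xt_oneSub {x : ℝ} (hx : x ∈ Icc (-1 : ℝ) 1) : xt oneSub x = 1 - (x : ℂ) := xt_of_mem _ hx

theorem xt_prim0_cl (c : ℂ) (g : CI) {x : ℝ} (hx : x ∈ Icc (-1 : ℝ) 1) :
    xt (prim0 (c, cl g)) x = c + ∫ s in (1 : ℝ)..x, xt g s := by
  rw [prim0_apply, xt_add, xt_constCI, ← xt_primCI g hx]
  rfl

/-- Chain rule: dilation multiplies the derivative by e^{-t} and keeps the value at 1, the fixed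
point. This gain of e^{-t} per derivative drives the whole linear theory. -/
theorem dlC_prim0 (t : ℝ) (c : ℂ) (f : L2s) :
    dlC t (prim0 (c, f)) = prim0 (c, ex 1 t • dl t f) := by
  have e : ∀ g, dlC t (prim0 (c, cl g)) = prim0 (c, ex 1 t • dl t (cl g)) := by
    intro g
    rw [dl_cl, ← map_smul]
    refine CI_ext fun x hx => ?_
    rw [xt_dlC _ _ hx, xt_prim0_cl _ _ hx, xt_prim0_cl _ _ (affine_mem_Icc (abs_sc t) hx)]
    congr 1
    simp only [xt_smul]
    rw [intervalIntegral.integral_const_mul]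
    have : ∫ s in (1 : ℝ)..x, xt (dlC t g) s = ∫ s in (1 : ℝ)..x, xt g (1 - sc t + sc t * s) := by
      refine intervalIntegral.integral_congr fun s hs => ?_
      rw [uIcc_of_ge hx.2] at hs
      exact xt_dlC _ _ ⟨hx.1.trans hs.1, hs.2⟩
    rw [this, intervalIntegral.integral_comp_add_mul _ (sc_pos t).ne', Complex.real_smul,
      Complex.ofReal_inv, sc_eq_ex, ← mul_assoc, mul_inv_cancel₀, one_mul]
    · simp
    · rw [← sc_eq_ex]; exact_mod_cast (sc_pos t).ne'
  refine dense_cl.induction_on (p := fun f => dlC t (prim0 (c, f)) = prim0 (c, ex 1 t • dl t f))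
    f ?_ e
  refine isClosed_eq ?_ ?_
  · exact (dlC t).continuous.comp (prim0.continuous.comp (by fun_prop))
  · exact prim0.continuous.comp (by fun_prop)

/-- The reason is that 1 - (1 + e^{-t}(x-1)) = e^{-t}(1-x). -/
theorem dl_mul_oneSub (t : ℝ) (f : L2s) :
    dl t (mulL2 oneSub f) = ex 1 t • mulL2 oneSub (dl t f) := by
  refine L2s_clm_ext (A := (dl t).comp (mulL2 oneSub))
    (B := ex 1 t • (mulL2 oneSub).comp (dl t)) (fun g => ?_) f
  change dl t (mulL2 oneSub (cl g)) = ex 1 t • mulL2 oneSub (dl t (cl g))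
  rw [mulL2_cl, dl_cl, dl_cl, mulL2_cl, ← map_smul]
  congr 1
  refine CI_ext fun x hx => ?_
  rw [xt_dlC _ _ hx, xt_mul, xt_smul, xt_mul, xt_dlC _ _ hx, xt_oneSub hx,
    xt_oneSub (affine_mem_Icc (abs_sc t) hx), ← sc_eq_ex]
  push_cast
  ring

/-- The dilation semigroup solves the transport equation. -/
theorem dl_generator (c : ℂ) (f : L2s) {t : ℝ} (ht : 0 ≤ t) :
    dl t (cl (prim0 (c, f))) = cl (prim0 (c, f)) + ∫ s in (0 : ℝ)..t, dl s (mulL2 oneSub f) := by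
  refine dense_cl.induction_on (p := fun f => dl t (cl (prim0 (c, f))) = cl (prim0 (c, f)) +
    ∫ s in (0 : ℝ)..t, dl s (mulL2 oneSub f)) f ?_ ?_
  · have h1 : Continuous fun f => cl (prim0 (c, f)) :=
      cl.continuous.comp (prim0.continuous.comp (by fun_prop))
    refine isClosed_eq ((dl t).continuous.comp h1) (h1.add ?_)
    refine intervalIntegral.continuous_parametric_intervalIntegral_of_continuous'
      (f := fun f s => dl s (mulL2 oneSub f)) ?_ _ _
    exact dl_stronglyCont.comp continuous_snd ((mulL2 oneSub).continuous.comp continuous_fst)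
  · intro g
    have hc : Continuous fun s => dlC s (oneSub * g) :=
      continuous_affCI (continuous_const.sub sc_continuous) sc_continuous _
    simp only [mulL2_cl, dl_cl]
    rw [cl.intervalIntegral_comp_comm (hc.intervalIntegrable _ _), ← map_add]
    congr 1
    refine CI_ext fun x hx => ?_
    rw [xt_dlC _ _ hx, xt_add, xt_intervalIntegral hc,
      xt_prim0_cl _ _ hx, xt_prim0_cl _ _ (affine_mem_Icc (abs_sc t) hx), add_assoc]
    congr 1
    -- The characteristic through x; it solves y' = 1 - y, so the fundamental theorem of calculus
    -- along it gives the claim.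
    let y : ℝ → ℝ := fun s => 1 - Real.exp (-s) + Real.exp (-s) * x
    have hy : ∀ s, HasDerivAt y (1 - y s) s := by
      intro s
      have h1 : HasDerivAt (fun s => Real.exp (-s)) (-Real.exp (-s)) s := by
        simpa using (hasDerivAt_id s).neg.exp
      refine ((h1.const_sub 1).add (h1.mul_const x)).congr_deriv ?_
      simp only [y]; ring
    have hyc : Continuous y := by fun_prop
    have hd : ∀ s, HasDerivAt (fun s => ∫ r in (1 : ℝ)..y s, xt g r)
        ((1 - y s) • xt g (y s)) s := fun s =>
      ((xt_continuous g).integral_hasStrictDerivAt 1 (y s)).hasDerivAt.scomp s (hy s)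
    have hft := intervalIntegral.integral_eq_sub_of_hasDerivAt (a := 0) (b := t)
      (fun s _ => hd s) (Continuous.intervalIntegrable
        ((continuous_const.sub hyc).smul ((xt_continuous g).comp hyc)) _ _)
    have e1 : ∫ s in (0 : ℝ)..t, xt (dlC s (oneSub * g)) x
        = ∫ s in (0 : ℝ)..t, (1 - y s) • xt g (y s) := by
      refine intervalIntegral.integral_congr fun s hs => ?_
      rw [uIcc_of_le ht] at hs
      have e2 : 1 - sc s + sc s * x = y s := by simp only [y, sc, max_eq_left hs.1]
      have e3 := affine_mem_Icc (abs_sc s) hx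
      simp only [xt_dlC _ _ hx, xt_mul, xt_oneSub e3]
      rw [e2, Complex.real_smul]
      push_cast
      ring
    have e4 : 1 - sc t + sc t * x = y t := by simp only [y, sc, max_eq_left ht]
    have e5 : y 0 = x := by simp [y]
    rw [e1, hft, e4, e5]
    abel

/-! ### The scale of Sobolev spaces on `(-1,1)` -/

/-- The Sobolev space `Hⁿ(-1,1)`: a function `w` is encoded by its derivatives at `1` of order less
than `n` and by its derivative of order `n`. -/
abbrev Sob (n : ℕ) : Type := (Fin n → ℂ) × L2s

/-- The value at `1`. -/
def head {n : ℕ} : Sob (n + 1) →L[ℂ] ℂ :=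
  (ContinuousLinearMap.proj 0).comp (ContinuousLinearMap.fst ℂ (Fin (n + 1) → ℂ) L2s)

/-- The derivative. -/
def tail {n : ℕ} : Sob (n + 1) →L[ℂ] Sob n :=
  ((ContinuousLinearMap.pi fun j : Fin n => ContinuousLinearMap.proj j.succ).comp
    (ContinuousLinearMap.fst ℂ (Fin (n + 1) → ℂ) L2s)).prod
    (ContinuousLinearMap.snd ℂ (Fin (n + 1) → ℂ) L2s)

/-- The primitive with prescribed value at `1`. -/
def cons {n : ℕ} : ℂ × Sob n →L[ℂ] Sob (n + 1) :=
  (ContinuousLinearMap.pi (Fin.cons (ContinuousLinearMap.fst ℂ ℂ (Sob n)) fun j : Fin n =>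
    (ContinuousLinearMap.proj j).comp ((ContinuousLinearMap.fst ℂ (Fin n → ℂ) L2s).comp
      (ContinuousLinearMap.snd ℂ ℂ (Sob n))))).prod
    ((ContinuousLinearMap.snd ℂ (Fin n → ℂ) L2s).comp (ContinuousLinearMap.snd ℂ ℂ (Sob n)))

theorem head_apply {n : ℕ} (w : Sob (n + 1)) : head w = w.1 0 := rfl
theorem tail_fst {n : ℕ} (w : Sob (n + 1)) (j : Fin n) : (tail w).1 j = w.1 j.succ := rfl
theorem tail_snd {n : ℕ} (w : Sob (n + 1)) : (tail w).2 = w.2 := rfl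

@[simp] theorem head_cons {n : ℕ} (c : ℂ) (w : Sob n) : head (cons (c, w)) = c := rfl
@[simp] theorem tail_cons {n : ℕ} (c : ℂ) (w : Sob n) : tail (cons (c, w)) = w := rfl

theorem Sob_ext {n : ℕ} {v w : Sob (n + 1)} (h1 : head v = head w) (h2 : tail v = tail w) :
    v = w := by
  have h3 : (tail v).2 = (tail w).2 := by rw [h2]
  refine Prod.ext (funext fun j => ?_) h3
  refine Fin.cases h1 (fun i => ?_) j
  have h4 : (tail v).1 i = (tail w).1 i := by rw [h2]
  exact h4

theorem norm_Sob_le {n : ℕ} (w : Sob (n + 1)) : ‖w‖ ≤ max ‖head w‖ ‖tail w‖ := by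
  rw [Prod.norm_def]
  refine max_le ((pi_norm_le_iff_of_nonneg (by positivity)).2 fun j => ?_)
    (le_max_of_le_right (le_max_right _ _))
  refine Fin.cases (le_max_left _ _) (fun i => le_max_of_le_right ?_) j
  exact (norm_le_pi_norm (tail w).1 i).trans (le_max_left _ _)

/-- The derivatives at `1` of order `n`, together with the derivative of order `n + 1`. -/
def lastPair {n : ℕ} : Sob (n + 1) →L[ℂ] ℂ × L2s :=
  ((ContinuousLinearMap.proj (Fin.last n)).comp
    (ContinuousLinearMap.fst ℂ (Fin (n + 1) → ℂ) L2s)).prod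
    (ContinuousLinearMap.snd ℂ (Fin (n + 1) → ℂ) L2s)

/-- The inclusion of `Hⁿ⁺¹` into `Hⁿ`. -/
def incl {n : ℕ} : Sob (n + 1) →L[ℂ] Sob n :=
  ((ContinuousLinearMap.pi fun j : Fin n => ContinuousLinearMap.proj j.castSucc).comp
    (ContinuousLinearMap.fst ℂ (Fin (n + 1) → ℂ) L2s)).prod (cl.comp (prim0.comp lastPair))

theorem incl_fst {n : ℕ} (w : Sob (n + 1)) (j : Fin n) : (incl w).1 j = w.1 j.castSucc := rfl
theorem incl_snd {n : ℕ} (w : Sob (n + 1)) : (incl w).2 = cl (prim0 (w.1 (Fin.last n), w.2)) := rfl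

theorem head_incl {n : ℕ} (w : Sob (n + 2)) : head (incl w) = head w := rfl
theorem tail_incl {n : ℕ} (w : Sob (n + 2)) : tail (incl w) = incl (tail w) := rfl

/-- The free flow `w ↦ e^{-a t} w (1 + e^{-t} (x - 1))`. -/
def flow (a : ℝ) (n : ℕ) (t : ℝ) : Sob n →L[ℂ] Sob n :=
  ((ContinuousLinearMap.pi fun j : Fin n => ex (j + a) t • ContinuousLinearMap.proj j).comp
    (ContinuousLinearMap.fst ℂ (Fin n → ℂ) L2s)).prod
    (ex (n + a) t • (dl t).comp (ContinuousLinearMap.snd ℂ (Fin n → ℂ) L2s))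

/-- The generator `w ↦ (1 - x) w' - a w` of the free flow. -/
def freeGen (a : ℝ) {n : ℕ} : Sob (n + 1) →L[ℂ] Sob n :=
  ((ContinuousLinearMap.pi fun j : Fin n =>
    (-((j + a : ℝ) : ℂ)) • ContinuousLinearMap.proj j.castSucc).comp
    (ContinuousLinearMap.fst ℂ (Fin (n + 1) → ℂ) L2s)).prod
    ((mulL2 oneSub).comp (ContinuousLinearMap.snd ℂ (Fin (n + 1) → ℂ) L2s) -
      ((n + a : ℝ) : ℂ) • cl.comp (prim0.comp lastPair))

theorem flow_fst (a : ℝ) {n : ℕ} (t : ℝ) (w : Sob n) (j : Fin n) :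
    (flow a n t w).1 j = ex (j + a) t * w.1 j := rfl
theorem flow_snd (a : ℝ) {n : ℕ} (t : ℝ) (w : Sob n) :
    (flow a n t w).2 = ex (n + a) t • dl t w.2 := rfl
theorem freeGen_fst (a : ℝ) {n : ℕ} (w : Sob (n + 1)) (j : Fin n) :
    (freeGen a w).1 j = -((j + a : ℝ) : ℂ) * w.1 j.castSucc := rfl
theorem freeGen_snd (a : ℝ) {n : ℕ} (w : Sob (n + 1)) :
    (freeGen a w).2 = mulL2 oneSub w.2 - ((n + a : ℝ) : ℂ) • (incl w).2 := rfl

theorem head_flow (a : ℝ) {n : ℕ} (t : ℝ) (w : Sob (n + 1)) :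
    head (flow a (n + 1) t w) = ex a t * head w := by
  rw [head_apply, flow_fst, head_apply]
  simp

theorem tail_flow (a : ℝ) {n : ℕ} (t : ℝ) (w : Sob (n + 1)) :
    tail (flow a (n + 1) t w) = ex 1 t • flow a n t (tail w) := by
  refine Prod.ext (funext fun j => ?_) ?_
  · rw [tail_fst, flow_fst, Prod.smul_fst, Pi.smul_apply, flow_fst, tail_fst, smul_eq_mul,
      ← mul_assoc, ← ex_add]
    congr 2
    simp; ring
  · rw [tail_snd, flow_snd, Prod.smul_snd, flow_snd, tail_snd, smul_smul, ← ex_add]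
    congr 2
    push_cast; ring

/-- The j-th derivative carries the factor e^{-(j+a)t} at every order, so the encodings at different
orders describe one and the same flow on functions. -/
theorem incl_flow (a : ℝ) {n : ℕ} (t : ℝ) (w : Sob (n + 1)) :
    incl (flow a (n + 1) t w) = flow a n t (incl w) := by
  refine Prod.ext (funext fun j => ?_) ?_
  · rw [incl_fst, flow_fst, flow_fst, incl_fst]
    simp
  · rw [incl_snd, flow_snd, flow_snd, flow_fst, incl_snd, dl_cl, dlC_prim0,
      ← map_smul cl, ← map_smul prim0, Prod.smul_mk, smul_smul, ← ex_add, Fin.val_last,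
      smul_eq_mul, add_right_comm, Nat.cast_succ]

theorem freeGen_flow (a : ℝ) {n : ℕ} (t : ℝ) (w : Sob (n + 1)) :
    freeGen a (flow a (n + 1) t w) = flow a n t (freeGen a w) := by
  refine Prod.ext (funext fun j => ?_) ?_
  · rw [freeGen_fst, flow_fst, flow_fst, freeGen_fst]
    simp only [Fin.val_castSucc]
    ring
  · rw [freeGen_snd, incl_flow, flow_snd, flow_snd, flow_snd, freeGen_snd, map_sub, smul_sub,
      map_smul, map_smul, dl_mul_oneSub, smul_smul (ex _ t), ← ex_add,
      smul_comm (ex _ t) ((n + a : ℝ) : ℂ), add_right_comm, Nat.cast_succ]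

theorem norm_flow_le {a : ℝ} (ha : 0 ≤ a) (n : ℕ) (t : ℝ) :
    ‖flow a n t‖ ≤ Real.exp (max t 0) := by
  have h1 : 1 ≤ Real.exp (max t 0) := Real.one_le_exp (le_max_right _ _)
  refine ContinuousLinearMap.opNorm_le_bound _ (Real.exp_pos _).le fun w => ?_
  rw [Prod.norm_def]
  refine max_le ((pi_norm_le_iff_of_nonneg (by positivity)).2 fun j => ?_) ?_
  · rw [flow_fst, norm_mul]
    exact mul_le_mul ((norm_ex_le (by positivity) t).trans h1)
      ((norm_le_pi_norm w.1 j).trans (norm_fst_le w)) (norm_nonneg _) (by positivity)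
  · rw [flow_snd, norm_smul]
    have h2 : ‖dl t w.2‖ ≤ Real.exp (max t 0) * ‖w‖ := ((dl t).le_opNorm _).trans
      (mul_le_mul (norm_dl_le t) (norm_snd_le w) (norm_nonneg _) (by positivity))
    have h3 := norm_ex_le (by positivity : (0 : ℝ) ≤ n + a) t
    have := mul_le_mul h3 h2 (norm_nonneg _) zero_le_one
    rwa [one_mul] at this

theorem norm_flow_le_of_nonneg {a : ℝ} (ha : 0 ≤ a) (n : ℕ) (t : ℝ) (ht : 0 ≤ t) :
    ‖flow a n t‖ ≤ Real.exp (1 * t) := by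
  rw [one_mul]
  simpa only [max_eq_left ht] using norm_flow_le ha n t

theorem flow_stronglyCont {a : ℝ} (ha : 0 ≤ a) (n : ℕ) : StronglyCont (flow a n) := by
  refine stronglyCont_of_orbits (fun w => ?_) (b := fun t => Real.exp (max t 0)) (by fun_prop)
    (norm_flow_le ha n)
  refine Continuous.prodMk (continuous_pi fun j => ?_) ?_
  · exact (ex_continuous _).mul continuous_const
  · exact (ex_continuous _).smul (dl_stronglyCont.comp continuous_id continuous_const)

theorem flow_zero (a : ℝ) {n : ℕ} (w : Sob (n + 1)) : flow a n 0 (incl w) = incl w := by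
  refine Prod.ext (funext fun j => ?_) ?_
  · rw [flow_fst, ex_zero, one_mul]
  · rw [flow_snd, ex_zero, one_smul, incl_snd]
    have := dl_generator (w.1 (Fin.last n)) w.2 le_rfl
    simpa using this

theorem flow_incl_hasDerivAt (a : ℝ) {n : ℕ} (w : Sob (n + 1)) {t : ℝ} (ht : 0 < t) :
    HasDerivAt (fun t => flow a n t (incl w)) (flow a n t (freeGen a w)) t := by
  have h2 : HasDerivAt (fun t => dl t (incl w).2) (dl t (mulL2 oneSub w.2)) t := by
    have hc : Continuous fun s => dl s (mulL2 oneSub w.2) :=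
      dl_stronglyCont.comp continuous_id continuous_const
    have h3 : HasDerivAt (fun t => (incl w).2 + ∫ s in (0 : ℝ)..t, dl s (mulL2 oneSub w.2))
        (dl t (mulL2 oneSub w.2)) t :=
      (hc.integral_hasStrictDerivAt 0 t).hasDerivAt.const_add _
    refine h3.congr_of_eventuallyEq ?_
    filter_upwards [lt_mem_nhds ht] with s hs
    exact dl_generator _ _ (le_of_lt hs)
  refine HasDerivAt.prodMk (hasDerivAt_pi.2 fun j => ?_) ?_
  · refine ((ex_hasDerivAt (j + a) ht).mul_const (w.1 j.castSucc)).congr_deriv ?_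
    change _ = ex (j + a) t * (freeGen a w).1 j
    rw [freeGen_fst]
    ring
  · refine ((ex_hasDerivAt (n + a) ht).smul h2).congr_deriv ?_
    change _ = ex (n + a) t • dl t (freeGen a w).2
    rw [freeGen_snd, map_sub, smul_sub, map_smul, smul_smul]
    rw [neg_mul, neg_smul, ← sub_eq_add_neg, mul_comm]

/-- One extra derivative puts the data in the domain of the generator. This is the smoothness input
required by `mild_integral_form`. -/
theorem flow_incl {a : ℝ} (ha : 0 ≤ a) {n : ℕ} (w : Sob (n + 1)) {t : ℝ} (ht : 0 ≤ t) :
    flow a n t (incl w) = incl w + ∫ s in (0 : ℝ)..t, flow a n s (freeGen a w) := by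
  have hc : ∀ v, Continuous fun s => flow a n s v := fun v =>
    (flow_stronglyCont ha n).comp continuous_id continuous_const
  rw [intervalIntegral.integral_eq_sub_of_hasDerivAt_of_le ht (hc _).continuousOn
    (fun s hs => flow_incl_hasDerivAt a w hs.1) ((hc _).intervalIntegrable _ _), flow_zero]
  abel

/-! ### Elements of the Sobolev spaces as functions -/

/-- The continuous representative of an element of `Hⁿ⁺¹(-1,1)`. -/
def ev : (n : ℕ) → Sob (n + 1) →L[ℂ] CI
  | 0 => prim0.comp lastPair
  | n + 1 => constCI.comp head + primCI.comp ((ev n).comp tail)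

/-- The inclusion of `Hⁿ(-1,1)` into `L²(-1,1)`. -/
def toL2 : (n : ℕ) → Sob n →L[ℂ] L2s
  | 0 => ContinuousLinearMap.snd ℂ (Fin 0 → ℂ) L2s
  | n + 1 => cl.comp (ev n)

theorem toL2_succ {n : ℕ} (w : Sob (n + 1)) : toL2 (n + 1) w = cl (ev n w) := rfl

theorem ev_eq_prim0 {n : ℕ} (w : Sob (n + 1)) : ev n w = prim0 (head w, toL2 n (tail w)) := by
  cases n with
  | zero => rfl
  | succ n => rfl

theorem ev_succ {n : ℕ} (w : Sob (n + 2)) :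
    ev (n + 1) w = constCI (head w) + primCI (ev n (tail w)) := rfl

theorem xt_ev_succ {n : ℕ} (w : Sob (n + 2)) {x : ℝ} (hx : x ∈ Icc (-1 : ℝ) 1) :
    xt (ev (n + 1) w) x = head w + ∫ s in (1 : ℝ)..x, xt (ev n (tail w)) s := by
  rw [ev_succ, xt_add, xt_constCI, xt_primCI _ hx]

theorem ev_incl {n : ℕ} (w : Sob (n + 2)) : ev n (incl w) = ev (n + 1) w := by
  induction n with
  | zero => rfl
  | succ n ih => rw [ev_succ, ev_succ, head_incl, tail_incl, ih]

theorem toL2_incl {n : ℕ} (w : Sob (n + 1)) : toL2 n (incl w) = toL2 (n + 1) w := by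
  cases n with
  | zero => rfl
  | succ n => rw [toL2_succ, toL2_succ, ev_incl]

/-- By Lebesgue's differentiation theorem f is almost everywhere the derivative of its primitive. -/
theorem primL2_eq_zero {f : L2s} (h : primL2 f = 0) : f = 0 := by
  have h1 := LocallyIntegrable.ae_hasDerivAt_integral (ind_integrable f).locallyIntegrable
  have h2 : ∀ x ∈ Ioo (-1 : ℝ) 1, HasDerivAt (fun x => ∫ s in (1 : ℝ)..x, ind f s) 0 x := by
    intro x hx
    refine (hasDerivAt_const x (0 : ℂ)).congr_of_eventuallyEq ?_
    filter_upwards [Ioo_mem_nhds hx.1 hx.2] with y hy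
    rw [← xt_primL2 f (Ioo_subset_Icc_self hy), h, xt_zero]
  apply Lp.ext
  have h3 : ∀ᵐ x ∂symMeasure, x ∈ Ioo (-1 : ℝ) 1 → (f : ℝ → ℂ) x = 0 := by
    refine ae_restrict_of_ae ?_
    filter_upwards [h1] with x hx hm
    have := (hx 1).unique (h2 x hm)
    rwa [ind, indicator_of_mem hm] at this
  filter_upwards [h3, ae_mem_sym, Lp.coeFn_zero ℂ 2 symMeasure] with x h4 h5 h6
  rw [h4 h5, h6]; rfl

theorem xt_prim0_one (c : ℂ) (f : L2s) : xt (prim0 (c, f)) 1 = c := by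
  rw [prim0_apply, xt_add, xt_constCI, xt_primL2 _ (by norm_num)]
  simp

theorem xt_ev_one {n : ℕ} (w : Sob (n + 1)) : xt (ev n w) 1 = head w := by
  rw [ev_eq_prim0, xt_prim0_one]

theorem prim0_injective : Function.Injective prim0 := by
  refine (injective_iff_map_eq_zero _).2 ?_
  rintro ⟨c, f⟩ h
  have h1 : c = 0 := by rw [← xt_prim0_one c f, h, xt_zero]
  rw [prim0_apply, h1, map_zero, zero_add] at h
  rw [h1, primL2_eq_zero h]
  rfl

theorem incl_injective {n : ℕ} : Function.Injective (incl (n := n)) := by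
  intro v w h
  have h1 : (incl v).2 = (incl w).2 := by rw [h]
  rw [incl_snd, incl_snd] at h1
  have h2 := prim0_injective (cl_injective h1)
  refine Prod.ext (funext fun j => ?_) (Prod.ext_iff.1 h2).2
  refine Fin.lastCases (Prod.ext_iff.1 h2).1 (fun i => ?_) j
  have h3 : (incl v).1 i = (incl w).1 i := by rw [h]
  exact h3

/-- An encoded Sobolev function is determined by its class in L². Identities between encodings are
therefore verified in L², or pointwise, instead of coordinate by coordinate. -/
theorem toL2_injective (n : ℕ) : Function.Injective (toL2 n) := by
  induction n with
  | zero => exact fun v w h => Prod.ext (funext fun j => j.elim0) h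
  | succ n ih =>
    intro v w h
    rw [← toL2_incl, ← toL2_incl] at h
    exact incl_injective (ih h)

/-! ### The product rule and the action of the generator on functions -/

/-- The product rule for primitives. -/
theorem prim0_mul (c d : ℂ) (f h : L2s) : prim0 (c, f) * prim0 (d, h) =
    prim0 (c * d, mulL2 (prim0 (c, f)) h + mulL2 (prim0 (d, h)) f) := by
  have hcont : Continuous fun q : L2s × L2s => (prim0 (c, q.1), prim0 (d, q.2)) :=
    (prim0.continuous.comp (by fun_prop)).prodMk (prim0.continuous.comp (by fun_prop))
  have hm : ∀ {u : L2s × L2s → CI} {v : L2s × L2s → L2s}, Continuous u → Continuous v →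
      Continuous fun q => mulL2 (u q) (v q) := fun hu hv =>
    (mulL2.continuous.comp hu).clm_apply hv
  have hcl : IsClosed {q : L2s × L2s | prim0 (c, q.1) * prim0 (d, q.2) =
      prim0 (c * d, mulL2 (prim0 (c, q.1)) q.2 + mulL2 (prim0 (d, q.2)) q.1)} := by
    refine isClosed_eq (hcont.fst.mul hcont.snd) (prim0.continuous.comp ?_)
    exact continuous_const.prodMk ((hm hcont.fst continuous_snd).add (hm hcont.snd continuous_fst))
  have hd : DenseRange fun q : CI × CI => (cl q.1, cl q.2) := dense_cl.prodMap dense_cl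
  refine hd.induction_on (p := fun q : L2s × L2s => prim0 (c, q.1) * prim0 (d, q.2) =
      prim0 (c * d, mulL2 (prim0 (c, q.1)) q.2 + mulL2 (prim0 (d, q.2)) q.1)) (f, h) hcl ?_
  rintro ⟨g, k⟩
  simp only [mulL2_cl, ← map_add cl]
  refine CI_ext fun x hx => ?_
  rw [xt_mul, xt_prim0_cl _ _ hx, xt_prim0_cl _ _ hx, xt_prim0_cl _ _ hx]
  have hG : ∀ (e : ℂ) (g : CI) (y : ℝ), HasDerivAt (fun y => e + ∫ s in (1 : ℝ)..y, xt g s)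
      (xt g y) y := fun e g y =>
    ((xt_continuous g).integral_hasStrictDerivAt 1 y).hasDerivAt.const_add e
  have hft := intervalIntegral.integral_eq_sub_of_hasDerivAt (a := 1) (b := x)
    (fun s _ => (hG c g s).mul (hG d k s)) (Continuous.intervalIntegrable (by
      have h1 : ∀ (e : ℂ) (g : CI), Continuous fun y => e + ∫ s in (1 : ℝ)..y, xt g s := fun e g =>
        continuous_iff_continuousAt.2 fun y => (hG e g y).continuousAt
      exact ((xt_continuous g).mul (h1 d k)).add ((h1 c g).mul (xt_continuous k))) _ _)
  have e1 : ∫ s in (1 : ℝ)..x, xt (prim0 (c, cl g) * k + prim0 (d, cl k) * g) s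
      = ∫ s in (1 : ℝ)..x, (xt g s * (d + ∫ r in (1 : ℝ)..s, xt k r) +
        (c + ∫ r in (1 : ℝ)..s, xt g r) * xt k s) := by
    refine intervalIntegral.integral_congr fun s hs => ?_
    rw [uIcc_of_ge hx.2] at hs
    have hs' : s ∈ Icc (-1 : ℝ) 1 := ⟨hx.1.trans hs.1, hs.2⟩
    simp only [xt_add, xt_mul, xt_prim0_cl _ _ hs']
    ring
  rw [e1, hft]
  simp

theorem oneSub_eq : oneSub = prim0 (0, cl (constCI (-1))) := by
  refine CI_ext fun x hx => ?_
  rw [xt_oneSub hx, xt_prim0_cl _ _ hx]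
  simp only [xt_constCI, intervalIntegral.integral_const, Complex.real_smul]
  push_cast
  ring

theorem oneSub_mul_prim0 (c : ℂ) (f : L2s) :
    oneSub * prim0 (c, f) = prim0 (0, mulL2 oneSub f - cl (prim0 (c, f))) := by
  conv_lhs => rw [oneSub_eq, prim0_mul, ← oneSub_eq, zero_mul, mulL2_cl]
  congr 2
  rw [sub_eq_add_neg, ← map_neg]
  congr 2
  refine CI_ext fun x _ => ?_
  rw [xt_mul, xt_constCI, mul_neg_one]
  rfl

/-- Differentiating (1-x)w' - a w gives the same expression with w' for w and a + 1 for a; the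
induction therefore runs over all a. It shows that the coordinate definition of `freeGen` is the
intended differential operator. -/
theorem toL2_freeGen (a : ℝ) {n : ℕ} (w : Sob (n + 1)) :
    toL2 n (freeGen a w) = mulL2 oneSub (toL2 n (tail w)) - (a : ℂ) • toL2 (n + 1) w := by
  induction n generalizing a with
  | zero =>
    change (freeGen a w).2 = mulL2 oneSub (tail w).2 - (a : ℂ) • (incl w).2
    rw [freeGen_snd, tail_snd]
    simp
  | succ n ih =>
    have ht : tail (freeGen a w) = freeGen (a + 1) (tail w) := by
      refine Prod.ext (funext fun j => ?_) ?_
      · rw [tail_fst, freeGen_fst, freeGen_fst, tail_fst, Fin.val_succ, Fin.succ_castSucc]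
        congr 3
        push_cast; ring
      · rw [tail_snd, freeGen_snd, freeGen_snd, tail_snd, ← tail_incl, tail_snd]
        congr 3
        push_cast; ring
    have hh : head (freeGen a w) = -(a : ℂ) * head w := by
      rw [head_apply, freeGen_fst]
      simp [head_apply]
    have h1 := oneSub_mul_prim0 (head (tail w)) (toL2 n (tail (tail w)))
    rw [← ev_eq_prim0, ← toL2_succ] at h1
    rw [toL2_succ, ev_eq_prim0, ht, ih, toL2_succ (tail w), mulL2_cl, h1, toL2_succ w,
      ev_eq_prim0 w, hh, ← toL2_succ]
    refine Eq.trans ?_ (map_sub cl _ ((a : ℂ) • prim0 (head w, toL2 (n + 1) (tail w))))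
    rw [← map_smul prim0, ← map_sub prim0]
    congr 2
    refine Prod.ext ?_ ?_
    · simp
    · simp only [Prod.smul_mk, Prod.mk_sub_mk]
      push_cast
      rw [add_smul, one_smul]
      abel

/-! ### Reflection and parity -/

theorem refl_ne : (-1 : ℝ) ≠ 0 := by norm_num
theorem refl_abs : |(0 : ℝ)| + |(-1 : ℝ)| ≤ 1 := by norm_num

/-- Reflection on `C[-1,1]`. -/
def reflCI : CI →L[ℂ] CI := affCI 0 (-1)

/-- Reflection on `L²(-1,1)`. -/
def reflL2 : L2s →L[ℂ] L2s := affL2 0 (-1)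

theorem reflL2_cl (g : CI) : reflL2 (cl g) = cl (reflCI g) := affL2_cl refl_ne refl_abs g

theorem neg_mem_sym {x : ℝ} (hx : x ∈ Icc (-1 : ℝ) 1) : -x ∈ Icc (-1 : ℝ) 1 :=
  ⟨by linarith [hx.2], by linarith [hx.1]⟩

theorem xt_reflCI (g : CI) {x : ℝ} (hx : x ∈ Icc (-1 : ℝ) 1) : xt (reflCI g) x = xt g (-x) := by
  rw [reflCI, xt_affCI _ _ _ hx]
  congr 1
  ring

/-- Reflection flips the sign of the derivative. The base point stays at 1, so the constant becomes
the old value at -1. -/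
theorem reflCI_prim0 (c : ℂ) (f : L2s) :
    reflCI (prim0 (c, f)) = prim0 (xt (prim0 (c, f)) (-1), -reflL2 f) := by
  refine dense_cl.induction_on (p := fun f => reflCI (prim0 (c, f)) =
    prim0 (xt (prim0 (c, f)) (-1), -reflL2 f)) f ?_ ?_
  · have h1 : Continuous fun f => prim0 (c, f) := prim0.continuous.comp (by fun_prop)
    refine isClosed_eq (reflCI.continuous.comp h1) (prim0.continuous.comp ?_)
    exact ((evalCI (-1)).continuous.comp h1).prodMk reflL2.continuous.neg
  · intro g
    rw [reflL2_cl, ← map_neg]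
    refine CI_ext fun x hx => ?_
    rw [xt_reflCI _ hx, xt_prim0_cl _ _ (neg_mem_sym hx), xt_prim0_cl _ _ hx,
      xt_prim0_cl _ _ (by norm_num)]
    have e : ∫ s in (1 : ℝ)..x, xt (-reflCI g) s = - ∫ s in (1 : ℝ)..x, xt g (-s) := by
      rw [← intervalIntegral.integral_neg]
      refine intervalIntegral.integral_congr fun s hs => ?_
      rw [uIcc_of_ge hx.2] at hs
      change - xt (reflCI g) s = _
      rw [xt_reflCI _ ⟨hx.1.trans hs.1, hs.2⟩]
    have hi : ∀ a b, IntervalIntegrable (xt g) volume a b := fun a b =>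
      (xt_continuous g).intervalIntegrable a b
    rw [e, intervalIntegral.integral_comp_neg,
      ← intervalIntegral.integral_add_adjacent_intervals (hi 1 (-x)) (hi (-x) (-1))]
    ring

/-- Reflection on `Hⁿ(-1,1)`. -/
def refl : (n : ℕ) → Sob n →L[ℂ] Sob n
  | 0 => (ContinuousLinearMap.fst ℂ (Fin 0 → ℂ) L2s).prod
      (reflL2.comp (ContinuousLinearMap.snd ℂ (Fin 0 → ℂ) L2s))
  | n + 1 => cons.comp (((evalCI (-1)).comp (ev n)).prod (-(refl n).comp tail))

theorem head_refl {n : ℕ} (w : Sob (n + 1)) : head (refl (n + 1) w) = xt (ev n w) (-1) := rfl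
theorem tail_refl {n : ℕ} (w : Sob (n + 1)) : tail (refl (n + 1) w) = -refl n (tail w) := rfl

theorem toL2_refl (n : ℕ) (w : Sob n) : toL2 n (refl n w) = reflL2 (toL2 n w) := by
  induction n with
  | zero => rfl
  | succ n ih =>
    rw [toL2_succ, toL2_succ, reflL2_cl, ev_eq_prim0, ev_eq_prim0, reflCI_prim0, head_refl,
      tail_refl, map_neg, ih, ev_eq_prim0]

theorem ev_refl {n : ℕ} (w : Sob (n + 1)) : ev n (refl (n + 1) w) = reflCI (ev n w) := by
  apply cl_injective
  rw [← toL2_succ, toL2_refl, toL2_succ, reflL2_cl]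

/-- The even part. -/
def evenP (n : ℕ) : Sob n →L[ℂ] Sob n := (1 / 2 : ℂ) • (ContinuousLinearMap.id ℂ _ + refl n)

/-- The odd part. -/
def oddP (n : ℕ) : Sob n →L[ℂ] Sob n := (1 / 2 : ℂ) • (ContinuousLinearMap.id ℂ _ - refl n)

theorem evenP_apply {n : ℕ} (w : Sob n) : evenP n w = (1 / 2 : ℂ) • (w + refl n w) := rfl
theorem oddP_apply {n : ℕ} (w : Sob n) : oddP n w = (1 / 2 : ℂ) • (w - refl n w) := rfl

/-- Differentiation exchanges parities. -/
theorem tail_evenP {n : ℕ} (w : Sob (n + 1)) : tail (evenP (n + 1) w) = oddP n (tail w) := by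
  rw [evenP_apply, oddP_apply, map_smul, map_add, tail_refl, sub_eq_add_neg]

theorem tail_oddP {n : ℕ} (w : Sob (n + 1)) : tail (oddP (n + 1) w) = evenP n (tail w) := by
  rw [evenP_apply, oddP_apply, map_smul, map_sub, tail_refl, sub_neg_eq_add]

theorem head_evenP {n : ℕ} (w : Sob (n + 1)) :
    head (evenP (n + 1) w) = (1 / 2 : ℂ) * (head w + xt (ev n w) (-1)) := by
  rw [evenP_apply, map_smul, map_add, head_refl, smul_eq_mul]

theorem head_oddP {n : ℕ} (w : Sob (n + 1)) :
    head (oddP (n + 1) w) = (1 / 2 : ℂ) * (head w - xt (ev n w) (-1)) := by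
  rw [oddP_apply, map_smul, map_sub, head_refl, smul_eq_mul]

/-- The integral over `(-1,1)`. -/
def integ (n : ℕ) : Sob n →L[ℂ] ℂ := -(evalCI (-1)).comp (primL2.comp (toL2 n))

theorem integ_apply {n : ℕ} (w : Sob n) : integ n w = -xt (primL2 (toL2 n w)) (-1) := rfl

theorem integ_tail {n : ℕ} (w : Sob (n + 1)) :
    integ n (tail w) = head w - xt (ev n w) (-1) := by
  rw [integ_apply, ev_eq_prim0, prim0_apply, xt_add, xt_constCI]
  ring

/-- The potential term `w ↦ P ∫₀ˣ w_even`. -/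
def pot (P : ℝ) (n : ℕ) : Sob n →L[ℂ] Sob (n + 1) :=
  (P : ℂ) • cons.comp (((1 / 2 : ℂ) • integ n).prod (evenP n))

theorem pot_apply (P : ℝ) {n : ℕ} (w : Sob n) :
    pot P n w = (P : ℂ) • cons ((1 / 2 : ℂ) * integ n w, evenP n w) := rfl

theorem head_pot (P : ℝ) {n : ℕ} (w : Sob n) :
    head (pot P n w) = P * ((1 / 2 : ℂ) * integ n w) := by
  rw [pot_apply, map_smul, head_cons, smul_eq_mul]

theorem tail_pot (P : ℝ) {n : ℕ} (w : Sob n) : tail (pot P n w) = (P : ℂ) • evenP n w := by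
  rw [pot_apply, map_smul, tail_cons]

/-- The second derivative of ∫₀ˣ w_even is the odd part of w'. It vanishes at 0 and has derivative
(w'')_even, hence equals ∫₀ˣ (w'')_even. This exact commutation is what makes the descent in the
order of differentiation possible. -/
theorem tail_tail_pot (P : ℝ) {n : ℕ} (w : Sob (n + 2)) :
    tail (tail (pot P (n + 2) w)) = pot P n (tail (tail w)) := by
  rw [tail_pot, map_smul, tail_evenP, pot_apply]
  congr 1
  refine Sob_ext ?_ ?_
  · rw [head_oddP, head_cons, integ_tail]
  · rw [tail_oddP, tail_cons]

/-- The potential term as a bounded operator on `Hⁿ`. -/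
def potB (P : ℝ) (n : ℕ) : Sob n →L[ℂ] Sob n := incl.comp (pot P n)

theorem potB_apply (P : ℝ) {n : ℕ} (w : Sob n) : potB P n w = incl (pot P n w) := rfl

theorem tail_tail_potB (P : ℝ) {n : ℕ} (w : Sob (n + 2)) :
    tail (tail (potB P (n + 2) w)) = potB P n (tail (tail w)) := by
  rw [potB_apply, tail_incl, tail_incl, tail_tail_pot, potB_apply]

/-! ### The perturbed flow -/

/-- `S` is the flow on `Hⁿ` of `w' = (1 - x) w_x - a w + P ∫₀ˣ w_even`. -/
structure IsPert (a P : ℝ) (n : ℕ) (S : ℝ → Sob n →L[ℂ] Sob n) : Prop where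
  cont : StronglyCont S
  mild : ∀ v t, 0 ≤ t →
    S t v = flow a n t v + ∫ s in (0 : ℝ)..t, flow a n (t - s) (potB P n (S s v))

theorem exists_isPert {a : ℝ} (ha : 0 ≤ a) (P : ℝ) (n : ℕ) :
    ∃ (S : ℝ → Sob n →L[ℂ] Sob n) (M β : ℝ), IsPert a P n S ∧ 0 ≤ M ∧
      ∀ t, 0 ≤ t → ‖S t‖ ≤ M * Real.exp (β * t) := by
  obtain ⟨S, M, β, h1, h2, h3, h4⟩ := exists_perturbation (flow_stronglyCont ha n)
    (norm_flow_le_of_nonneg ha n) (potB P n)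
  exact ⟨S, M, β, ⟨h1, h4⟩, h2, h3⟩

theorem IsPert.orbit {a P : ℝ} {n : ℕ} {S : ℝ → Sob n →L[ℂ] Sob n} (hS : IsPert a P n S)
    (v : Sob n) : Continuous fun t => S t v := hS.cont.comp continuous_id continuous_const

theorem tail_tail_flow (a : ℝ) {n : ℕ} (t : ℝ) (w : Sob (n + 2)) :
    tail (tail (flow a (n + 2) t w)) = ex 2 t • flow a n t (tail (tail w)) := by
  rw [tail_flow, map_smul, tail_flow, smul_smul, ← ex_add]
  norm_num

/-- Two derivatives intertwine the flows on `Hⁿ⁺²` and on `Hⁿ`, up to the factor `e^{-2t}`. -/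
theorem IsPert.tail_tail {a P : ℝ} (ha : 0 ≤ a) {n : ℕ} {S : ℝ → Sob (n + 2) →L[ℂ] Sob (n + 2)}
    {S' : ℝ → Sob n →L[ℂ] Sob n} (hS : IsPert a P (n + 2) S) (hS' : IsPert a P n S')
    (w : Sob (n + 2)) {t : ℝ} (ht : 0 ≤ t) :
    tail (tail (S t w)) = ex 2 t • S' t (tail (tail w)) := by
  have hc : Continuous fun t => tail (tail (S t w)) :=
    tail.continuous.comp (tail.continuous.comp (hS.orbit w))
  have hinv : ∀ t, ex (-2) t * ex 2 t = 1 := by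
    intro t
    rw [← ex_add]; simp [ex]
  have hfc : ∀ (t : ℝ), Continuous fun s => flow a (n + 2) (t - s) (potB P (n + 2) (S s w)) :=
    fun t => (flow_stronglyCont ha _).comp (continuous_const.sub continuous_id)
      ((potB P (n + 2)).continuous.comp (hS.orbit w))
  -- The second derivative of the orbit, multiplied by e^{2t}, solves the same Volterra equation on
  -- Hⁿ as the perturbed orbit of w''.
  have key := volterra_unique (flow_stronglyCont ha n) zero_le_one (norm_flow_le_of_nonneg ha n)
    (potB P n) (φ := fun t => ex (-2) t • tail (tail (S t w)))
    (g := fun t => flow a n t (tail (tail w)))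
    ((ex_continuous _).smul hc) (hS'.orbit (tail (tail w))) (by
      intro t ht
      change ex (-2) t • (tail.comp tail) (S t w) = _
      rw [hS.mild w t ht, map_add, smul_add,
        ← (tail.comp tail).intervalIntegral_comp_comm ((hfc t).intervalIntegrable _ _)]
      congr 1
      · change ex (-2) t • tail (tail (flow a (n + 2) t w)) = _
        rw [tail_tail_flow, smul_smul, hinv, one_smul]
      · rw [← intervalIntegral.integral_smul]
        refine intervalIntegral.integral_congr fun s hs => ?_
        rw [uIcc_of_le ht] at hs
        change ex (-2) t • tail (tail (flow a (n + 2) (t - s) (potB P (n + 2) (S s w)))) = _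
        rw [tail_tail_flow, tail_tail_potB, smul_smul, map_smul, map_smul]
        congr 1
        rw [ex_of_nonneg _ ht, ex_of_nonneg _ (sub_nonneg.2 hs.2), ex_of_nonneg _ hs.1,
          ← Complex.ofReal_mul, ← Real.exp_add]
        congr 2
        ring) (fun t ht => hS'.mild _ t ht) t ht
  have key' : ex (-2) t • tail (tail (S t w)) = S' t (tail (tail w)) := key
  rw [← key', smul_smul, mul_comm, hinv, one_smul]

/-! ### Scalar linear equations -/

/-- Factoring e^{-κt} out of the convolution leaves an ordinary primitive. It turns the mild
equation for the coordinates at 1 into a differential equation. -/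
theorem hasDerivAt_of_duhamel {κ : ℝ} {b y : ℝ → ℂ} {y₀ : ℂ} (hb : Continuous b)
    (hy : ∀ t, 0 ≤ t → y t = ex κ t * y₀ + ∫ s in (0 : ℝ)..t, ex κ (t - s) * b s) {t : ℝ}
    (ht : 0 < t) : HasDerivAt y (-κ * y t + b t) t := by
  have h0 : ∀ t, 0 ≤ t → y t = ex κ t * (y₀ + ∫ s in (0 : ℝ)..t, ex (-κ) s * b s) := by
    intro t ht
    rw [hy t ht, mul_add, ← intervalIntegral.integral_const_mul]
    congr 1
    refine intervalIntegral.integral_congr fun s hs => ?_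
    rw [uIcc_of_le ht] at hs
    rw [← mul_assoc]
    congr 1
    rw [ex_of_nonneg _ ht, ex_of_nonneg _ (sub_nonneg.2 hs.2), ex_of_nonneg _ hs.1,
      ← Complex.ofReal_mul, ← Real.exp_add]
    congr 2
    ring
  have hc : Continuous fun s => ex (-κ) s * b s := (ex_continuous _).mul hb
  have h1 : HasDerivAt (fun t => ex κ t * (y₀ + ∫ s in (0 : ℝ)..t, ex (-κ) s * b s))
      (-κ * y t + b t) t := by
    refine ((ex_hasDerivAt κ ht).mul
      ((hc.integral_hasStrictDerivAt 0 t).hasDerivAt.const_add y₀)).congr_deriv ?_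
    rw [h0 t ht.le, ← mul_assoc (ex κ t), ← ex_add, add_neg_cancel]
    have : ex 0 t = 1 := by simp [ex]
    rw [this]
    ring
  refine h1.congr_of_eventuallyEq ?_
  filter_upwards [lt_mem_nhds ht] with s hs
  exact h0 s (le_of_lt hs)

theorem duhamel_of_hasDerivAt {μ : ℝ} {f y : ℝ → ℂ} (hf : Continuous f) (hy : Continuous y)
    (hd : ∀ t, 0 < t → HasDerivAt y (μ * y t + f t) t) {t : ℝ} (ht : 0 ≤ t) :
    y t = Real.exp (μ * t) * (y 0 + ∫ s in (0 : ℝ)..t, Real.exp (-μ * s) * f s) := by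
  have hE : ∀ s, HasDerivAt (fun s => ((Real.exp (-μ * s) : ℝ) : ℂ))
      (-μ * (Real.exp (-μ * s) : ℝ)) s := by
    intro s
    have h2 : HasDerivAt (fun t => Real.exp (-μ * t)) (Real.exp (-μ * s) * (-μ)) s := by
      simpa using ((hasDerivAt_id s).const_mul (-μ)).exp
    refine h2.ofReal_comp.congr_deriv ?_
    push_cast
    ring
  have hEc : Continuous fun s => ((Real.exp (-μ * s) : ℝ) : ℂ) :=
    Complex.continuous_ofReal.comp (by fun_prop)
  have h1 := intervalIntegral.integral_eq_sub_of_hasDerivAt_of_le ht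
    (f := fun s => ((Real.exp (-μ * s) : ℝ) : ℂ) * y s)
    (f' := fun s => ((Real.exp (-μ * s) : ℝ) : ℂ) * f s) (hEc.mul hy).continuousOn
    (fun s hs => ((hE s).mul (hd s hs.1)).congr_deriv (by ring))
    ((hEc.mul hf).intervalIntegrable _ _)
  rw [h1]
  simp only [mul_zero, Real.exp_zero, Complex.ofReal_one, one_mul, add_sub_cancel]
  rw [← mul_assoc, ← Complex.ofReal_mul, ← Real.exp_add]
  simp

theorem integral_exp_le {κ t : ℝ} (hκ : κ ≠ 0) :
    ∫ s in (0 : ℝ)..t, Real.exp (κ * s) = κ⁻¹ * (Real.exp (κ * t) - 1) := by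
  rw [intervalIntegral.integral_comp_mul_left (fun s => Real.exp s) hκ, integral_exp]
  simp

theorem norm_duhamel_le {μ ν D : ℝ} {f y : ℝ → ℂ} (hf : Continuous f) (hy : Continuous y)
    (hd : ∀ t, 0 < t → HasDerivAt y (μ * y t + f t) t)
    (hfb : ∀ t, 0 ≤ t → ‖f t‖ ≤ D * Real.exp (ν * t)) {t : ℝ} (ht : 0 ≤ t) :
    ‖y t‖ ≤ Real.exp (μ * t) * (‖y 0‖ + D * ∫ s in (0 : ℝ)..t, Real.exp ((ν - μ) * s)) := by
  rw [duhamel_of_hasDerivAt hf hy hd ht, norm_mul, Complex.norm_real, Real.norm_eq_abs,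
    abs_of_pos (Real.exp_pos _)]
  refine mul_le_mul_of_nonneg_left ((norm_add_le _ _).trans (add_le_add le_rfl ?_))
    (Real.exp_pos _).le
  rw [← intervalIntegral.integral_const_mul]
  refine intervalIntegral.norm_integral_le_of_norm_le ht (Filter.Eventually.of_forall
    fun s hs => ?_) (Continuous.intervalIntegrable (by fun_prop) _ _)
  rw [norm_mul, Complex.norm_real, Real.norm_eq_abs, abs_of_pos (Real.exp_pos _)]
  refine (mul_le_mul_of_nonneg_left (hfb s hs.1.le) (Real.exp_pos _).le).trans (le_of_eq ?_)
  rw [mul_left_comm, ← Real.exp_add]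
  congr 2
  ring

/-- Exponential bound when the forcing dominates. -/
theorem norm_duhamel_le_forcing {μ ν D : ℝ} (hD : 0 ≤ D) (hμν : μ + 1 ≤ ν) {f y : ℝ → ℂ}
    (hf : Continuous f) (hy : Continuous y)
    (hd : ∀ t, 0 < t → HasDerivAt y (μ * y t + f t) t)
    (hfb : ∀ t, 0 ≤ t → ‖f t‖ ≤ D * Real.exp (ν * t)) {t : ℝ} (ht : 0 ≤ t) :
    ‖y t‖ ≤ (‖y 0‖ + D) * Real.exp (ν * t) := by
  refine (norm_duhamel_le hf hy hd hfb ht).trans ?_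
  have h1 : ∫ s in (0 : ℝ)..t, Real.exp ((ν - μ) * s) ≤ Real.exp ((ν - μ) * t) := by
    rw [integral_exp_le (by linarith)]
    -- The unit gap between the rates keeps the constant of the convolution at one.
    have h2 : (ν - μ)⁻¹ ≤ 1 := inv_le_one_of_one_le₀ (by linarith)
    have h3 : 0 ≤ Real.exp ((ν - μ) * t) - 1 := by
      have := Real.one_le_exp (show 0 ≤ (ν - μ) * t by nlinarith)
      linarith
    nlinarith
  have h4 : 1 ≤ Real.exp ((ν - μ) * t) := Real.one_le_exp (show 0 ≤ (ν - μ) * t by nlinarith)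
  calc _ ≤ Real.exp (μ * t) * ((‖y 0‖ + D) * Real.exp ((ν - μ) * t)) := by
        refine mul_le_mul_of_nonneg_left ?_ (Real.exp_pos _).le
        have := mul_le_mul_of_nonneg_left h1 hD
        have := le_mul_of_one_le_right (norm_nonneg (y 0)) h4
        nlinarith
    _ = _ := by
        rw [mul_left_comm, ← Real.exp_add]
        congr 2
        ring

/-- Exponential bound when the homogeneous part dominates. -/
theorem norm_duhamel_le_free {μ ν D : ℝ} (hD : 0 ≤ D) (hμν : ν + 1 ≤ μ) {f y : ℝ → ℂ}
    (hf : Continuous f) (hy : Continuous y)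
    (hd : ∀ t, 0 < t → HasDerivAt y (μ * y t + f t) t)
    (hfb : ∀ t, 0 ≤ t → ‖f t‖ ≤ D * Real.exp (ν * t)) {t : ℝ} (ht : 0 ≤ t) :
    ‖y t‖ ≤ (‖y 0‖ + D) * Real.exp (μ * t) := by
  refine (norm_duhamel_le hf hy hd hfb ht).trans ?_
  have h1 : ∫ s in (0 : ℝ)..t, Real.exp ((ν - μ) * s) ≤ 1 := by
    have := exp_conv_le (κ := μ - ν) (t := t) (by linarith)
    have e : ∫ s in (0 : ℝ)..t, Real.exp (-(μ - ν) * (t - s))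
        = ∫ s in (0 : ℝ)..t, Real.exp ((ν - μ) * s) := by
      have := intervalIntegral.integral_comp_sub_left (a := 0) (b := t)
        (fun s => Real.exp (-(μ - ν) * s)) t
      rw [sub_self, sub_zero] at this
      rw [this, neg_sub]
    rw [e] at this
    exact this.trans (inv_le_one_of_one_le₀ (by linarith))
  rw [mul_comm]
  refine mul_le_mul_of_nonneg_right ?_ (Real.exp_pos _).le
  nlinarith

/-! ### The two lowest modes -/

/-- The second primitive vanishing to second order at `1`. -/
def lift2 {n : ℕ} : Sob n →L[ℂ] Sob (n + 2) :=
  cons.comp ((0 : Sob n →L[ℂ] ℂ).prod (cons.comp ((0 : Sob n →L[ℂ] ℂ).prod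
    (ContinuousLinearMap.id ℂ (Sob n)))))

theorem lift2_apply {n : ℕ} (w : Sob n) : lift2 w = cons (0, cons (0, w)) := rfl

/-- First-order Taylor expansion at 1; the remainder is the double primitive of the second
derivative. -/
theorem Sob_decomp {n : ℕ} (w : Sob (n + 2)) :
    w = head w • cons (1, 0) + head (tail w) • cons (0, cons (1, 0)) + lift2 (tail (tail w)) := by
  refine Sob_ext ?_ (Sob_ext ?_ ?_)
  · simp [lift2_apply]
  · simp [lift2_apply]
  · simp [lift2_apply]

theorem ev_one_mode {n : ℕ} : ev n (cons (1, 0)) = constCI 1 := by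
  rw [ev_eq_prim0, head_cons, tail_cons, map_zero, prim0_apply, map_zero, add_zero]

theorem xt_primCI_const {x : ℝ} (hx : x ∈ Icc (-1 : ℝ) 1) (c : ℂ) :
    xt (primCI (constCI c)) x = (x - 1) * c := by
  rw [xt_primCI _ hx]
  simp

/-- The value at `1` of the potential term. -/
def pot0 (P : ℝ) (n : ℕ) : Sob (n + 2) →L[ℂ] ℂ := head.comp (potB P (n + 2))

/-- The first derivative at `1` of the potential term. -/
def pot1 (P : ℝ) (n : ℕ) : Sob (n + 2) →L[ℂ] ℂ := head.comp (tail.comp (potB P (n + 2)))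

theorem pot0_eq (P : ℝ) {n : ℕ} (w : Sob (n + 2)) :
    pot0 P n w = P * ((1 / 2 : ℂ) * integ (n + 2) w) := head_pot P w

theorem pot1_eq (P : ℝ) {n : ℕ} (w : Sob (n + 2)) :
    pot1 P n w = P * ((1 / 2 : ℂ) * (head w + xt (ev (n + 1) w) (-1))) := by
  change head (tail (pot P (n + 2) w)) = _
  rw [tail_pot, map_smul, head_evenP, smul_eq_mul]

theorem integ_eq {n : ℕ} (w : Sob (n + 1)) :
    integ (n + 1) w = -∫ s in (1 : ℝ)..(-1), xt (ev n w) s := by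
  rw [integ_apply, toL2_succ]
  congr 1
  exact xt_primCI _ (by norm_num)

theorem xt_ev_linear_mode {n : ℕ} {x : ℝ} (hx : x ∈ Icc (-1 : ℝ) 1) :
    xt (ev (n + 1) (cons (0, cons (1, 0)))) x = x - 1 := by
  rw [ev_succ, head_cons, tail_cons, ev_one_mode, xt_add, xt_constCI, xt_primCI_const hx]
  ring

/-- The Taylor polynomial w(1) + w'(1)(x-1) has the constant even part w(1) - w'(1), whose integral
over (0,1) is that same constant. -/
theorem pot0_decomp (P : ℝ) {n : ℕ} (w : Sob (n + 2)) :
    pot0 P n w = P * (head w - head (tail w)) + pot0 P n (lift2 (tail (tail w))) := by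
  have h0 : pot0 P n (cons (1, 0)) = P := by
    rw [pot0_eq, integ_eq, ev_one_mode]
    simp only [xt_constCI, intervalIntegral.integral_const]
    norm_num
  have h1 : pot0 P n (cons (0, cons (1, 0))) = -P := by
    rw [pot0_eq, integ_eq]
    have : ∫ s in (1 : ℝ)..(-1), xt (ev (n + 1) (cons (0, cons (1, 0)))) s
        = ∫ s in (1 : ℝ)..(-1), (((s - 1 : ℝ)) : ℂ) := by
      refine intervalIntegral.integral_congr fun s hs => ?_
      rw [uIcc_of_ge (by norm_num)] at hs
      rw [xt_ev_linear_mode hs]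
      push_cast
      rfl
    rw [this, intervalIntegral.integral_ofReal]
    have : ∫ s in (1 : ℝ)..(-1), (s - 1) = 2 := by
      rw [intervalIntegral.integral_sub (by simp) (by simp), integral_id]
      norm_num
    rw [this]
    push_cast
    ring
  conv_lhs => rw [Sob_decomp w]
  rw [map_add, map_add, map_smul, map_smul, h0, h1, smul_eq_mul, smul_eq_mul]
  ring

/-- The derivative of the potential term at 1 is P w_even(1), and the even part of the Taylor
polynomial is the constant w(1) - w'(1). -/
theorem pot1_decomp (P : ℝ) {n : ℕ} (w : Sob (n + 2)) :
    pot1 P n w = P * (head w - head (tail w)) + pot1 P n (lift2 (tail (tail w))) := by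
  have h0 : pot1 P n (cons (1, 0)) = P := by
    rw [pot1_eq, ev_one_mode, head_cons, xt_constCI]
    norm_num
  have h1 : pot1 P n (cons (0, cons (1, 0))) = -P := by
    rw [pot1_eq, xt_ev_linear_mode (by norm_num), head_cons]
    push_cast
    ring
  conv_lhs => rw [Sob_decomp w]
  rw [map_add, map_add, map_smul, map_smul, h0, h1, smul_eq_mul, smul_eq_mul]
  ring

/-- The coordinate of the growing mode. -/
def mode1 (a : ℝ) (n : ℕ) : Sob (n + 2) →L[ℂ] ℂ :=
  ((2 + a : ℝ) : ℂ) • head - ((1 + a : ℝ) : ℂ) • head.comp tail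

/-- The coordinate of the decaying mode. -/
def mode2 (a : ℝ) (n : ℕ) : Sob (n + 2) →L[ℂ] ℂ :=
  ((1 + a : ℝ) : ℂ) • head - ((2 + a : ℝ) : ℂ) • head.comp tail

/-- The coupling of the growing mode to the second derivative. -/
def coup1 (a P : ℝ) (n : ℕ) : Sob n →L[ℂ] ℂ :=
  (((2 + a : ℝ) : ℂ) • pot0 P n - ((1 + a : ℝ) : ℂ) • pot1 P n).comp lift2

/-- The coupling of the decaying mode to the second derivative. -/
def coup2 (a P : ℝ) (n : ℕ) : Sob n →L[ℂ] ℂ :=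
  (((1 + a : ℝ) : ℂ) • pot0 P n - ((2 + a : ℝ) : ℂ) • pot1 P n).comp lift2

theorem mode1_apply (a : ℝ) {n : ℕ} (w : Sob (n + 2)) :
    mode1 a n w = (2 + a) * head w - (1 + a) * head (tail w) := by
  simp [mode1]

theorem mode2_apply (a : ℝ) {n : ℕ} (w : Sob (n + 2)) :
    mode2 a n w = (1 + a) * head w - (2 + a) * head (tail w) := by
  simp [mode2]

theorem head_of_modes {a : ℝ} {n : ℕ} (w : Sob (n + 2)) :
    (3 + 2 * a) * head w = (2 + a) * mode1 a n w - (1 + a) * mode2 a n w := by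
  rw [mode1_apply, mode2_apply]; ring

theorem head_tail_of_modes {a : ℝ} {n : ℕ} (w : Sob (n + 2)) :
    (3 + 2 * a) * head (tail w) = (1 + a) * mode1 a n w - (2 + a) * mode2 a n w := by
  rw [mode1_apply, mode2_apply]; ring

/-- The change from (w(1), w'(1)) to the modes has determinant of modulus (2+a)² - (1+a)² = 3 + 2a.
The inverse has coefficients at most one in absolute value, hence no constant appears. -/
theorem norm_le_modes {a : ℝ} (ha : 0 ≤ a) {n : ℕ} (w : Sob (n + 2)) :
    ‖w‖ ≤ ‖mode1 a n w‖ + ‖mode2 a n w‖ + ‖tail (tail w)‖ := by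
  have aux : ∀ (b c : ℝ) (x y z : ℂ), 0 ≤ b → 0 ≤ c → b ≤ 3 + 2 * a → c ≤ 3 + 2 * a →
      (3 + 2 * a) * x = b * y - c * z → ‖x‖ ≤ ‖y‖ + ‖z‖ := by
    intro b c x y z hb hc hb' hc' h
    have h1 : ‖((3 + 2 * a : ℝ) : ℂ) * x‖ ≤ ‖((b : ℝ) : ℂ) * y‖ + ‖((c : ℝ) : ℂ) * z‖ := by
      push_cast
      rw [h]
      exact norm_sub_le _ _
    rw [norm_mul, norm_mul, norm_mul, Complex.norm_real, Complex.norm_real, Complex.norm_real,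
      Real.norm_of_nonneg hb, Real.norm_of_nonneg hc, Real.norm_of_nonneg (by positivity)] at h1
    have h2 := mul_le_mul_of_nonneg_right hb' (norm_nonneg y)
    have h3 := mul_le_mul_of_nonneg_right hc' (norm_nonneg z)
    have h4 : (3 + 2 * a) * ‖x‖ ≤ (3 + 2 * a) * (‖y‖ + ‖z‖) := by linarith
    exact le_of_mul_le_mul_left h4 (by positivity)
  have h0 := aux (2 + a) (1 + a) _ _ _ (by positivity) (by positivity) (by linarith) (by linarith)
    (by push_cast; exact head_of_modes w)
  have h1 := aux (1 + a) (2 + a) _ _ _ (by positivity) (by positivity) (by linarith) (by linarith)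
    (by push_cast; exact head_tail_of_modes w)
  refine (norm_Sob_le w).trans (max_le ?_ ((norm_Sob_le (tail w)).trans (max_le ?_ ?_)))
  · linarith [norm_nonneg (tail (tail w))]
  · linarith [norm_nonneg (tail (tail w))]
  · linarith [norm_nonneg (mode1 a n w), norm_nonneg (mode2 a n w)]

theorem IsPert.head_hasDerivAt {a P : ℝ} (ha : 0 ≤ a) {n : ℕ}
    {S : ℝ → Sob (n + 2) →L[ℂ] Sob (n + 2)}
    (hS : IsPert a P (n + 2) S) (w : Sob (n + 2)) {t : ℝ} (ht : 0 < t) :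
    HasDerivAt (fun t => head (S t w)) (-a * head (S t w) + pot0 P n (S t w)) t := by
  refine hasDerivAt_of_duhamel (b := fun s => pot0 P n (S s w)) (y₀ := head w)
    ((pot0 P n).continuous.comp (hS.orbit w)) (fun t ht => ?_) ht
  have hfc : Continuous fun s => flow a (n + 2) (t - s) (potB P (n + 2) (S s w)) :=
    (flow_stronglyCont ha _).comp (continuous_const.sub continuous_id)
      ((potB P (n + 2)).continuous.comp (hS.orbit w))
  rw [hS.mild w t ht, map_add, head_flow,
    ← head.intervalIntegral_comp_comm (hfc.intervalIntegrable _ _)]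
  congr 1
  refine intervalIntegral.integral_congr fun s _ => ?_
  simp only [head_flow]
  rfl

theorem IsPert.head_tail_hasDerivAt {a P : ℝ} (ha : 0 ≤ a) {n : ℕ}
    {S : ℝ → Sob (n + 2) →L[ℂ] Sob (n + 2)}
    (hS : IsPert a P (n + 2) S) (w : Sob (n + 2)) {t : ℝ} (ht : 0 < t) :
    HasDerivAt (fun t => head (tail (S t w)))
      (-(1 + a) * head (tail (S t w)) + pot1 P n (S t w)) t := by
  have key := hasDerivAt_of_duhamel (κ := 1 + a) (b := fun s => pot1 P n (S s w))
    (y := fun t => head (tail (S t w))) (y₀ := head (tail w))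
    ((pot1 P n).continuous.comp (hS.orbit w)) (fun t ht => by
      have hfc : Continuous fun s => flow a (n + 2) (t - s) (potB P (n + 2) (S s w)) :=
        (flow_stronglyCont ha _).comp (continuous_const.sub continuous_id)
          ((potB P (n + 2)).continuous.comp (hS.orbit w))
      change (head.comp tail) (S t w) = _
      rw [hS.mild w t ht, map_add,
        ← (head.comp tail).intervalIntegral_comp_comm (hfc.intervalIntegrable _ _)]
      have hh : ∀ t v, (head.comp tail) (flow a (n + 2) t v) = ex (1 + a) t * head (tail v) := by
        intro t v
        change head (tail (flow a (n + 2) t v)) = _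
        rw [tail_flow, map_smul, head_flow, smul_eq_mul, ← mul_assoc, ← ex_add]
      simp only [hh]
      rfl) ht
  refine key.congr_deriv ?_
  push_cast
  rfl

/-- Up to the coupling with w'', the pair (w(1), w'(1)) evolves by the matrix with rows (P - a, -P)
and (P, -P - 1 - a). Its trace is -1-2a and, for P = (1+a)(2+a), its determinant is -2-2a, so its
eigenvalues are 1 and -2-2a. `mode1` is the left eigenvector for 1. -/
theorem IsPert.mode1_hasDerivAt {a P : ℝ} (ha : 0 ≤ a) (hP : P = (1 + a) * (2 + a)) {n : ℕ}
    {S : ℝ → Sob (n + 2) →L[ℂ] Sob (n + 2)} (hS : IsPert a P (n + 2) S) (w : Sob (n + 2))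
    {t : ℝ} (ht : 0 < t) :
    HasDerivAt (fun t => mode1 a n (S t w))
      ((1 : ℝ) * mode1 a n (S t w) + coup1 a P n (tail (tail (S t w)))) t := by
  simp only [mode1_apply]
  refine (((hS.head_hasDerivAt ha w ht).const_mul _).sub
    ((hS.head_tail_hasDerivAt ha w ht).const_mul _)).congr_deriv ?_
  rw [pot0_decomp, pot1_decomp]
  have : coup1 a P n (tail (tail (S t w))) = (2 + a) * pot0 P n (lift2 (tail (tail (S t w)))) -
    (1 + a) * pot1 P n (lift2 (tail (tail (S t w)))) := by simp [coup1]
  rw [this, hP]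
  push_cast
  ring

/-- `mode2` is the left eigenvector of the same matrix for the eigenvalue -2-2a. -/
theorem IsPert.mode2_hasDerivAt {a P : ℝ} (ha : 0 ≤ a) (hP : P = (1 + a) * (2 + a)) {n : ℕ}
    {S : ℝ → Sob (n + 2) →L[ℂ] Sob (n + 2)} (hS : IsPert a P (n + 2) S) (w : Sob (n + 2))
    {t : ℝ} (ht : 0 < t) :
    HasDerivAt (fun t => mode2 a n (S t w))
      ((-2 - 2 * a : ℝ) * mode2 a n (S t w) + coup2 a P n (tail (tail (S t w)))) t := by
  simp only [mode2_apply]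
  refine (((hS.head_hasDerivAt ha w ht).const_mul _).sub
    ((hS.head_tail_hasDerivAt ha w ht).const_mul _)).congr_deriv ?_
  rw [pot0_decomp, pot1_decomp]
  have : coup2 a P n (tail (tail (S t w))) = (1 + a) * pot0 P n (lift2 (tail (tail (S t w)))) -
    (2 + a) * pot1 P n (lift2 (tail (tail (S t w)))) := by simp [coup2]
  rw [this, hP]
  push_cast
  ring

/-! ### Growth of the perturbed flow -/

theorem dl_zero (f : L2s) : dl 0 f = f := by
  refine L2s_clm_ext (A := dl 0) (B := ContinuousLinearMap.id ℂ L2s) (fun g => ?_) f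
  rw [dl_cl]
  change cl (dlC 0 g) = cl g
  congr 1
  refine CI_ext fun x hx => ?_
  rw [xt_dlC _ _ hx]
  simp [sc]

theorem flow_zero_apply (a : ℝ) {n : ℕ} (w : Sob n) : flow a n 0 w = w := by
  refine Prod.ext (funext fun j => ?_) ?_
  · rw [flow_fst, ex_zero, one_mul]
  · rw [flow_snd, ex_zero, one_smul, dl_zero]

theorem IsPert.zero_apply {a P : ℝ} {n : ℕ} {S : ℝ → Sob n →L[ℂ] Sob n} (hS : IsPert a P n S)
    (w : Sob n) : S 0 w = w := by
  rw [hS.mild w 0 le_rfl, flow_zero_apply]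
  simp

theorem norm_tail_le {n : ℕ} (w : Sob (n + 1)) : ‖tail w‖ ≤ ‖w‖ := by
  rw [Prod.norm_def, Prod.norm_def w]
  refine max_le_max ?_ le_rfl
  exact (pi_norm_le_iff_of_nonneg (norm_nonneg _)).2 fun j => norm_le_pi_norm w.1 j.succ

/-- The perturbed flow on `Hⁿ` has exponential growth rate at most `γ`. -/
def HasGrowth (a P : ℝ) (n : ℕ) (γ : ℝ) : Prop :=
  ∃ (S : ℝ → Sob n →L[ℂ] Sob n) (M : ℝ), IsPert a P n S ∧ 0 ≤ M ∧
    ∀ t, 0 ≤ t → ‖S t‖ ≤ M * Real.exp (γ * t)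

/-- By the intertwining relation two derivatives improve the rate by two. -/
theorem HasGrowth.norm_tail_tail_le {a P : ℝ} (ha : 0 ≤ a) {n : ℕ} {γ : ℝ}
    (h : HasGrowth a P n γ) {S : ℝ → Sob (n + 2) →L[ℂ] Sob (n + 2)} (hS : IsPert a P (n + 2) S) :
    ∃ M, 0 ≤ M ∧ ∀ t, 0 ≤ t → ∀ w,
      ‖tail (tail (S t w))‖ ≤ M * ‖w‖ * Real.exp ((γ - 2) * t) := by
  obtain ⟨S', M, hS', hM, hb⟩ := h
  refine ⟨M, hM, fun t ht w => ?_⟩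
  rw [hS.tail_tail ha hS' w ht, norm_smul, norm_ex, max_eq_left ht]
  have h1 : ‖S' t (tail (tail w))‖ ≤ M * Real.exp (γ * t) * ‖w‖ :=
    ((S' t).le_opNorm _).trans (mul_le_mul (hb t ht)
      ((norm_tail_le _).trans (norm_tail_le _)) (norm_nonneg _) (by positivity))
  refine (mul_le_mul_of_nonneg_left h1 (Real.exp_pos _).le).trans (le_of_eq ?_)
  have : Real.exp ((γ - 2) * t) = Real.exp (-2 * t) * Real.exp (γ * t) := by
    rw [← Real.exp_add]; congr 1; ring
  rw [this]
  ring

/-- Since γ - 2 ≥ -1, the mode's own rate -2-2a lies below the rate of its forcing by at least one,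
so the forcing dominates. -/
theorem IsPert.mode2_le {a P : ℝ} (ha : 0 ≤ a) (hP : P = (1 + a) * (2 + a)) {n : ℕ} {γ : ℝ}
    (hγ : 1 ≤ γ) {S : ℝ → Sob (n + 2) →L[ℂ] Sob (n + 2)} (hS : IsPert a P (n + 2) S) {M : ℝ}
    (hM : 0 ≤ M) (hb : ∀ t, 0 ≤ t → ∀ w,
      ‖tail (tail (S t w))‖ ≤ M * ‖w‖ * Real.exp ((γ - 2) * t)) {t : ℝ} (ht : 0 ≤ t)
    (w : Sob (n + 2)) : ‖mode2 a n (S t w)‖ ≤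
      (‖mode2 a n‖ + ‖coup2 a P n‖ * M) * ‖w‖ * Real.exp ((γ - 2) * t) := by
  have h := norm_duhamel_le_forcing (μ := -2 - 2 * a) (ν := γ - 2)
    (D := ‖coup2 a P n‖ * (M * ‖w‖)) (by positivity) (by linarith)
    (f := fun t => coup2 a P n (tail (tail (S t w)))) (y := fun t => mode2 a n (S t w))
    ((coup2 a P n).continuous.comp (tail.continuous.comp (tail.continuous.comp (hS.orbit w))))
    ((mode2 a n).continuous.comp (hS.orbit w)) (fun t ht => hS.mode2_hasDerivAt ha hP w ht)
    (fun t ht => by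
      refine ((coup2 a P n).le_opNorm _).trans ?_
      rw [mul_assoc]
      exact mul_le_mul_of_nonneg_left (hb t ht w) (norm_nonneg _)) ht
  refine h.trans (mul_le_mul_of_nonneg_right ?_ (Real.exp_pos _).le)
  simp only [hS.zero_apply]
  have := (mode2 a n).le_opNorm w
  linarith

/-- The new rate is the larger of γ - 2, from the second derivative, and 1, from the growing mode.
The two alternatives keep these rates at distance at least one, which avoids resonance and lets one
of the two Duhamel bounds apply. -/
theorem HasGrowth.step {a P : ℝ} (ha : 0 ≤ a) (hP : P = (1 + a) * (2 + a)) {n : ℕ} {γ γ' : ℝ}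
    (h : HasGrowth a P n γ) (hγ : 1 ≤ γ) (hγ' : (4 ≤ γ ∧ γ' = γ - 2) ∨ (γ ≤ 2 ∧ γ' = 1)) :
    HasGrowth a P (n + 2) γ' := by
  obtain ⟨S, -, -, hS, -, -⟩ := exists_isPert ha P (n + 2)
  obtain ⟨M, hM, hb⟩ := h.norm_tail_tail_le ha hS
  have hle : γ - 2 ≤ γ' := by
    rcases hγ' with h | h
    · linarith [h.2]
    · linarith [h.1, h.2]
  refine ⟨S, (‖mode1 a n‖ + ‖coup1 a P n‖ * M) + (‖mode2 a n‖ + ‖coup2 a P n‖ * M) + M, hS,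
    by positivity, fun t ht => ContinuousLinearMap.opNorm_le_bound _ (by positivity) fun w => ?_⟩
  have hexp : Real.exp ((γ - 2) * t) ≤ Real.exp (γ' * t) :=
    Real.exp_le_exp.2 (mul_le_mul_of_nonneg_right hle ht)
  have h2 := hS.mode2_le ha hP hγ hM hb ht w
  have h3 := hb t ht w
  have h1 : ‖mode1 a n (S t w)‖ ≤
      (‖mode1 a n‖ + ‖coup1 a P n‖ * M) * ‖w‖ * Real.exp (γ' * t) := by
    have hf : Continuous fun t => coup1 a P n (tail (tail (S t w))) :=
      (coup1 a P n).continuous.comp (tail.continuous.comp (tail.continuous.comp (hS.orbit w)))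
    have hy : Continuous fun t => mode1 a n (S t w) := (mode1 a n).continuous.comp (hS.orbit w)
    have hfb : ∀ t, 0 ≤ t → ‖coup1 a P n (tail (tail (S t w)))‖
        ≤ ‖coup1 a P n‖ * (M * ‖w‖) * Real.exp ((γ - 2) * t) := fun t ht => by
      refine ((coup1 a P n).le_opNorm _).trans ?_
      rw [mul_assoc]
      exact mul_le_mul_of_nonneg_left (hb t ht w) (norm_nonneg _)
    have key : ‖mode1 a n (S t w)‖ ≤ (‖mode1 a n (S 0 w)‖ + ‖coup1 a P n‖ * (M * ‖w‖)) *
        Real.exp (γ' * t) := by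
      rcases hγ' with ⟨h4, rfl⟩ | ⟨h4, rfl⟩
      · exact norm_duhamel_le_forcing (by positivity) (by linarith) hf hy
          (fun t ht => hS.mode1_hasDerivAt ha hP w ht) hfb ht
      · exact norm_duhamel_le_free (by positivity) (by linarith) hf hy
          (fun t ht => hS.mode1_hasDerivAt ha hP w ht) hfb ht
    refine key.trans (mul_le_mul_of_nonneg_right ?_ (Real.exp_pos _).le)
    rw [hS.zero_apply]
    have := (mode1 a n).le_opNorm w
    linarith
  refine (norm_le_modes ha (S t w)).trans ?_
  have h2' := h2.trans (mul_le_mul_of_nonneg_left hexp (by positivity))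
  have h3' := h3.trans (mul_le_mul_of_nonneg_left hexp (by positivity))
  calc _ ≤ _ := add_le_add (add_le_add h1 h2') h3'
    _ = _ := by ring

theorem exists_hasGrowth_one {a P : ℝ} (ha : 0 ≤ a) (hP : P = (1 + a) * (2 + a)) :
    ∃ m : ℕ, ∀ j, m ≤ j → HasGrowth a P (2 * j) 1 := by
  obtain ⟨S, M, β, hS, hM, hb⟩ := exists_isPert ha P 0
  obtain ⟨m, hm⟩ := exists_nat_ge (max β 1)
  have hm1 : 1 ≤ m := by
    have := (le_max_right β 1).trans hm
    exact_mod_cast this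
  have hβ : β ≤ m := (le_max_left β 1).trans hm
  -- Rounding the L² rate up to an even integer 2m makes the descent pass through 2m, 2m-2, …, 4, 2,
  -- 1, 1, …, so no rate falls strictly between 2 and 4, where `HasGrowth.step` does not apply.
  have key : ∀ j : ℕ, HasGrowth a P (2 * j) (if j < m then 2 * ((m : ℝ) - j) else 1) := by
    intro j
    induction j with
    | zero =>
      refine ⟨S, M, hS, hM, fun t ht => (hb t ht).trans ?_⟩
      refine mul_le_mul_of_nonneg_left (Real.exp_le_exp.2 (mul_le_mul_of_nonneg_right ?_ ht)) hM
      rw [if_pos (by omega)]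
      have : (1 : ℝ) ≤ m := by exact_mod_cast hm1
      push_cast
      linarith
    | succ j ih =>
      rcases lt_trichotomy (j + 1) m with hlt | heq | hgt
      · have h2 : ((j : ℝ) + 1) + 1 ≤ m := by exact_mod_cast hlt
        rw [if_pos (by omega)] at ih
        rw [if_pos hlt]
        refine ih.step ha hP (by linarith) (Or.inl ⟨by linarith, ?_⟩)
        push_cast; ring
      · rw [if_pos (by omega)] at ih
        rw [if_neg (by omega)]
        have h2 : (m : ℝ) = j + 1 := by rw [← heq]; push_cast; ring
        rw [h2] at ih
        exact ih.step ha hP (by linarith) (Or.inr ⟨by linarith, rfl⟩)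
      · rw [if_neg (by omega)] at ih
        rw [if_neg (by omega)]
        exact ih.step ha hP le_rfl (Or.inr ⟨by norm_num, rfl⟩)
  refine ⟨m, fun j hj => ?_⟩
  have := key j
  rwa [if_neg (by omega)] at this

/-! ### Splitting off the growing mode -/

/-- The growing mode `x ↦ (1 + a) x + 1`. -/
def growMode (a : ℝ) (n : ℕ) : Sob (n + 2) :=
  cons (((2 + a : ℝ) : ℂ), cons (((1 + a : ℝ) : ℂ), 0))

theorem mode1_growMode (a : ℝ) (n : ℕ) : mode1 a n (growMode a n) = ((3 + 2 * a : ℝ) : ℂ) := by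
  rw [mode1_apply, growMode, head_cons, tail_cons, head_cons]
  push_cast
  ring

theorem mode2_growMode (a : ℝ) (n : ℕ) : mode2 a n (growMode a n) = 0 := by
  rw [mode2_apply, growMode, head_cons, tail_cons, head_cons]
  push_cast
  ring

theorem tail_tail_growMode (a : ℝ) (n : ℕ) : tail (tail (growMode a n)) = 0 := by
  rw [growMode, tail_cons, tail_cons]

theorem eq_of_modes {a : ℝ} (ha : 0 ≤ a) {n : ℕ} {v w : Sob (n + 2)}
    (h1 : mode1 a n v = mode1 a n w) (h2 : mode2 a n v = mode2 a n w)
    (h3 : tail (tail v) = tail (tail w)) : v = w := by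
  have := norm_le_modes ha (v - w)
  simp only [map_sub, h1, h2, h3, sub_self, norm_zero, add_zero] at this
  exact sub_eq_zero.1 (norm_eq_zero.1 (le_antisymm this (norm_nonneg _)))

/-- The perturbed flow splits into a one-dimensional part growing like `e^t` and a remainder
decaying like `e^{-t}`. -/
theorem exists_dichotomy {a P : ℝ} (ha : 0 ≤ a) (hP : P = (1 + a) * (2 + a)) {n : ℕ}
    (hn : HasGrowth a P n 1) :
    ∃ (S : ℝ → Sob (n + 2) →L[ℂ] Sob (n + 2)) (C : ℝ) (l : Sob (n + 2) →L[ℂ] ℂ),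
      IsPert a P (n + 2) S ∧ 0 ≤ C ∧
      (∀ t, 0 ≤ t → S t (growMode a n) = (Real.exp t : ℂ) • growMode a n) ∧
      ∀ t, 0 ≤ t → ∀ w,
        ‖S t w - ((Real.exp t : ℂ) * l w) • growMode a n‖ ≤ C * Real.exp (-t) * ‖w‖ := by
  obtain ⟨S, -, -, hS, -, -⟩ := exists_isPert ha P (n + 2)
  obtain ⟨M, hM, hb⟩ := hn.norm_tail_tail_le ha hS
  have ha3 : (0 : ℝ) < 3 + 2 * a := by positivity
  set f : Sob (n + 2) → ℝ → ℂ := fun w t => coup1 a P n (tail (tail (S t w))) with hf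
  set D := ‖coup1 a P n‖ * M with hD
  have hD0 : 0 ≤ D := by positivity
  have hfc : ∀ w, Continuous (f w) := fun w =>
    (coup1 a P n).continuous.comp (tail.continuous.comp (tail.continuous.comp (hS.orbit w)))
  have hfb : ∀ w t, 0 ≤ t → ‖f w t‖ ≤ D * ‖w‖ * Real.exp (-t) := by
    intro w t ht
    refine ((coup1 a P n).le_opNorm _).trans ?_
    rw [hD, mul_assoc, mul_assoc]
    refine mul_le_mul_of_nonneg_left ((hb t ht w).trans (le_of_eq ?_)) (norm_nonneg _)
    rw [mul_assoc]
    norm_num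
  set F : Sob (n + 2) → ℝ → ℂ := fun w s => ((Real.exp (-(1 : ℝ) * s) : ℝ) : ℂ) * f w s with hF
  have hFc : ∀ w, Continuous (F w) := fun w =>
    (Complex.continuous_ofReal.comp (by fun_prop)).mul (hfc w)
  have hFb : ∀ w t, 0 ≤ t → ‖F w t‖ ≤ D * ‖w‖ * Real.exp (-2 * t) := by
    intro w t ht
    rw [hF]
    simp only
    rw [norm_mul, Complex.norm_real, Real.norm_of_nonneg (Real.exp_pos _).le]
    refine (mul_le_mul_of_nonneg_left (hfb w t ht) (Real.exp_pos _).le).trans (le_of_eq ?_)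
    rw [mul_left_comm, ← Real.exp_add]
    congr 2
    ring
  have hgi : ∀ (w : Sob (n + 2)) (c : ℝ), IntegrableOn (fun s => D * ‖w‖ * Real.exp (-2 * s)) (Ioi c) :=
    fun w c => (integrableOn_exp_mul_Ioi (by norm_num) c).const_mul _
  have hFi : ∀ w t, 0 ≤ t → IntegrableOn (F w) (Ioi t) := by
    intro w t ht
    refine Integrable.mono' (hgi w t) (hFc w).aestronglyMeasurable ?_
    refine (ae_restrict_iff' measurableSet_Ioi).2 (Filter.Eventually.of_forall fun s hs => ?_)
    exact hFb w s (ht.trans (le_of_lt hs))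
  have hFn : ∀ w t, 0 ≤ t → ‖∫ s in Ioi t, F w s‖ ≤ D * ‖w‖ * Real.exp (-2 * t) := by
    intro w t ht
    have h1 : ‖∫ s in Ioi t, F w s‖ ≤ ∫ s in Ioi t, D * ‖w‖ * Real.exp (-2 * s) := by
      refine norm_integral_le_of_norm_le (hgi w t) ?_
      refine (ae_restrict_iff' measurableSet_Ioi).2 (Filter.Eventually.of_forall fun s hs => ?_)
      exact hFb w s (ht.trans (le_of_lt hs))
    refine h1.trans ?_
    rw [integral_const_mul, integral_exp_mul_Ioi (by norm_num)]
    refine mul_le_mul_of_nonneg_left ?_ (by positivity)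
    have := Real.exp_pos (-2 * t)
    linarith
  -- The bracket is the limit of e^{-t} times the growing coordinate of the orbit; the integral
  -- converges because its integrand decays like e^{-2s}. Division by 3 + 2a, the coordinate of the
  -- growing mode itself, normalizes the functional.
  let l0 : Sob (n + 2) →ₗ[ℂ] ℂ :=
    { toFun := fun w => ((3 + 2 * a : ℝ) : ℂ)⁻¹ * (mode1 a n w + ∫ s in Ioi (0 : ℝ), F w s)
      map_add' := by
        intro v w
        have : ∀ s, F (v + w) s = F v s + F w s := by
          intro s; simp only [hF, hf, map_add, mul_add]
        simp only [this]
        rw [integral_add (hFi v 0 le_rfl) (hFi w 0 le_rfl), map_add]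
        ring
      map_smul' := by
        intro c w
        have : ∀ s, F (c • w) s = c * F w s := by
          intro s; simp only [hF, hf, map_smul, smul_eq_mul]; ring
        simp only [this]
        rw [integral_const_mul, map_smul, RingHom.id_apply, smul_eq_mul, smul_eq_mul]
        ring }
  have hl0 : ∀ w, ‖l0 w‖ ≤ (‖((3 + 2 * a : ℝ) : ℂ)⁻¹‖ * (‖mode1 a n‖ + D)) * ‖w‖ := by
    intro w
    change ‖((3 + 2 * a : ℝ) : ℂ)⁻¹ * (mode1 a n w + ∫ s in Ioi (0 : ℝ), F w s)‖ ≤ _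
    rw [norm_mul, mul_assoc]
    refine mul_le_mul_of_nonneg_left ((norm_add_le _ _).trans ?_) (norm_nonneg _)
    have h1 := hFn w 0 le_rfl
    have h2 := (mode1 a n).le_opNorm w
    rw [mul_zero, Real.exp_zero, mul_one] at h1
    linarith
  let l := l0.mkContinuous _ hl0
  have hl : ∀ w, ((3 + 2 * a : ℝ) : ℂ) * l w = mode1 a n w + ∫ s in Ioi (0 : ℝ), F w s := by
    intro w
    change ((3 + 2 * a : ℝ) : ℂ) *
      (((3 + 2 * a : ℝ) : ℂ)⁻¹ * (mode1 a n w + ∫ s in Ioi (0 : ℝ), F w s)) = _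
    rw [← mul_assoc, mul_inv_cancel₀ (by exact_mod_cast ha3.ne'), one_mul]
  have hm1 : ∀ w t, 0 ≤ t → mode1 a n (S t w) =
      Real.exp t * (mode1 a n w + ∫ s in (0 : ℝ)..t, F w s) := by
    intro w t ht
    have := duhamel_of_hasDerivAt (hfc w) ((mode1 a n).continuous.comp (hS.orbit w))
      (fun t ht => hS.mode1_hasDerivAt ha hP w ht) ht
    simp only [Function.comp_apply, hS.zero_apply, one_mul] at this
    exact this
  refine ⟨S, D + (‖mode2 a n‖ + ‖coup2 a P n‖ * M) + M, l, hS, by positivity, ?_, ?_⟩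
  · intro t ht
    -- The growing mode is affine, so its second derivative stays zero, both couplings vanish, and
    -- the mode is an exact eigenfunction.
    have htt : ∀ t, 0 ≤ t → tail (tail (S t (growMode a n))) = 0 := by
      intro t ht
      obtain ⟨S', M', hS', -, -⟩ := hn
      rw [hS.tail_tail ha hS' _ ht, tail_tail_growMode, map_zero, smul_zero]
    refine eq_of_modes ha ?_ ?_ ?_
    · rw [hm1 _ t ht, map_smul, smul_eq_mul]
      have : ∫ s in (0 : ℝ)..t, F (growMode a n) s = 0 := by
        refine (intervalIntegral.integral_congr (g := fun _ => 0) fun s hs => ?_).trans (by simp)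
        rw [uIcc_of_le ht] at hs
        simp only [hF, hf, htt s hs.1, map_zero, mul_zero]
      rw [this, add_zero]
    · have := duhamel_of_hasDerivAt (f := fun t => coup2 a P n (tail (tail (S t (growMode a n)))))
        ((coup2 a P n).continuous.comp (tail.continuous.comp (tail.continuous.comp
          (hS.orbit (growMode a n))))) ((mode2 a n).continuous.comp (hS.orbit (growMode a n)))
        (fun t ht => hS.mode2_hasDerivAt ha hP _ ht) ht
      simp only [Function.comp_apply, hS.zero_apply, mode2_growMode, zero_add] at this
      rw [this, map_smul, mode2_growMode, smul_zero]
      have h0 : ∫ s in (0 : ℝ)..t, (Real.exp (-(-2 - 2 * a) * s) : ℂ) *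
          coup2 a P n (tail (tail (S s (growMode a n)))) = 0 := by
        refine (intervalIntegral.integral_congr (g := fun _ => 0) fun s hs => ?_).trans (by simp)
        rw [uIcc_of_le ht] at hs
        simp only [htt s hs.1, map_zero, mul_zero]
      rw [h0, mul_zero]
    · rw [htt t ht, map_smul, map_smul, tail_tail_growMode, smul_zero]
  · intro t ht w
    refine (norm_le_modes ha _).trans ?_
    -- Removing the limiting coefficient leaves only the integral over times after t, which is of
    -- size e^{-2t}; the prefactor e^t turns this into e^{-t}.
    have e1 : mode1 a n (S t w - ((Real.exp t : ℂ) * l w) • growMode a n)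
        = -(Real.exp t * ∫ s in Ioi t, F w s) := by
      rw [map_sub, map_smul, hm1 w t ht, mode1_growMode, smul_eq_mul, mul_assoc,
        mul_comm (l w), hl, ← intervalIntegral.integral_interval_add_Ioi (hFi w 0 le_rfl)
          (hFi w t ht)]
      ring
    have e2 : mode2 a n (S t w - ((Real.exp t : ℂ) * l w) • growMode a n)
        = mode2 a n (S t w) := by
      rw [map_sub, map_smul, mode2_growMode, smul_zero, sub_zero]
    have e3 : tail (tail (S t w - ((Real.exp t : ℂ) * l w) • growMode a n))
        = tail (tail (S t w)) := by
      rw [map_sub, map_sub, map_smul, map_smul, tail_tail_growMode, smul_zero, sub_zero]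
    have h1 : ‖-(Real.exp t * ∫ s in Ioi t, F w s)‖ ≤ D * ‖w‖ * Real.exp (-t) := by
      rw [norm_neg, norm_mul, Complex.norm_real, Real.norm_of_nonneg (Real.exp_pos _).le]
      refine (mul_le_mul_of_nonneg_left (hFn w t ht) (Real.exp_pos _).le).trans (le_of_eq ?_)
      rw [mul_left_comm, ← Real.exp_add]
      congr 2
      ring
    have h2 := hS.mode2_le ha hP le_rfl hM hb ht w
    have h3 := hb t ht w
    have e4 : ((1 : ℝ) - 2) * t = -t := by ring
    rw [e4] at h2 h3
    rw [e1, e2, e3]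
    linarith

/-! ### Products -/

theorem ev_cons {n : ℕ} (c : ℂ) (w : Sob n) : ev n (cons (c, w)) = prim0 (c, toL2 n w) := by
  rw [ev_eq_prim0, head_cons, tail_cons]

/-- H¹ and all higher spaces are algebras: (vw)' = vw' + wv', and each summand is a product one
order lower. At the bottom it is a bounded function times an L² function. -/
theorem exists_mul (n : ℕ) : ∃ m : Sob (n + 1) →L[ℂ] Sob (n + 1) →L[ℂ] Sob (n + 1),
    ∀ v w, ev n (m v w) = ev n v * ev n w := by
  let cL : ∀ n, ℂ →L[ℂ] Sob (n + 1) := fun n =>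
    cons.comp (ContinuousLinearMap.inl ℂ ℂ (Sob n))
  let cR : ∀ n, Sob n →L[ℂ] Sob (n + 1) := fun n =>
    cons.comp (ContinuousLinearMap.inr ℂ ℂ (Sob n))
  have hc : ∀ n (c : ℂ) (w : Sob n), cL n c + cR n w = cons (c, w) := by
    intro n c w
    change cons (c, 0) + cons (0, w) = cons (c, w)
    rw [← map_add]
    simp
  induction n with
  | zero =>
    let i2 : L2s →L[ℂ] Sob 0 := ContinuousLinearMap.inr ℂ (Fin 0 → ℂ) L2s
    let m0 : Sob 1 →L[ℂ] Sob 1 →L[ℂ] Sob 0 :=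
      (ContinuousLinearMap.compL ℂ (Sob 1) L2s (Sob 0) i2).comp
        (mulL2.bilinearComp (ev 0) ((toL2 0).comp tail))
    refine ⟨(ContinuousLinearMap.compL ℂ (Sob 1) ℂ (Sob 1) (cL 0)).comp
      ((ContinuousLinearMap.mul ℂ ℂ).bilinearComp head head) +
      (ContinuousLinearMap.compL ℂ (Sob 1) (Sob 0) (Sob 1) (cR 0)).comp (m0 + m0.flip),
      fun v w => ?_⟩
    change ev 0 (cL 0 (head v * head w) + cR 0 (m0 v w + m0 w v)) = _
    rw [hc, ev_cons, map_add, ev_eq_prim0 v, ev_eq_prim0 w, prim0_mul]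
    rfl
  | succ n ih =>
    obtain ⟨m, hm⟩ := ih
    let m0 : Sob (n + 2) →L[ℂ] Sob (n + 2) →L[ℂ] Sob (n + 1) := m.bilinearComp incl tail
    refine ⟨(ContinuousLinearMap.compL ℂ (Sob (n + 2)) ℂ (Sob (n + 2)) (cL (n + 1))).comp
      ((ContinuousLinearMap.mul ℂ ℂ).bilinearComp head head) +
      (ContinuousLinearMap.compL ℂ (Sob (n + 2)) (Sob (n + 1)) (Sob (n + 2)) (cR (n + 1))).comp
        (m0 + m0.flip), fun v w => ?_⟩
    change ev (n + 1) (cL (n + 1) (head v * head w) + cR (n + 1) (m (incl v) (tail w) +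
      m (incl w) (tail v))) = _
    rw [hc, ev_cons, toL2_succ, map_add, hm, hm, ev_incl, ev_incl, ev_eq_prim0 v, ev_eq_prim0 w,
      prim0_mul, toL2_succ, toL2_succ, mulL2_cl, mulL2_cl, map_add]

/-- Multiplication in `Hⁿ⁺¹(-1,1)`. -/
def mulS (n : ℕ) : Sob (n + 1) →L[ℂ] Sob (n + 1) →L[ℂ] Sob (n + 1) := (exists_mul n).choose

theorem ev_mulS {n : ℕ} (v w : Sob (n + 1)) : ev n (mulS n v w) = ev n v * ev n w :=
  (exists_mul n).choose_spec v w

/-- Powers in `Hⁿ⁺¹(-1,1)`. -/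
def powS (n : ℕ) : ℕ → Sob (n + 1) → Sob (n + 1)
  | 0, _ => cons (1, 0)
  | k + 1, w => mulS n w (powS n k w)

theorem ev_powS {n : ℕ} (k : ℕ) (w : Sob (n + 1)) {x : ℝ} :
    xt (ev n (powS n k w)) x = xt (ev n w) x ^ k := by
  induction k with
  | zero => rw [powS, ev_one_mode, xt_constCI, pow_zero]
  | succ k ih => rw [powS, ev_mulS, xt_mul, ih, pow_succ']

theorem continuous_mulS {n : ℕ} {α : Type*} [TopologicalSpace α] {f g : α → Sob (n + 1)}
    (hf : Continuous f) (hg : Continuous g) : Continuous fun x => mulS n (f x) (g x) :=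
  ((mulS n).continuous.comp hf).clm_apply hg

theorem continuous_powS (n k : ℕ) : Continuous (powS n k) := by
  induction k with
  | zero => exact continuous_const
  | succ k ih => exact continuous_mulS continuous_id ih

/-! ### Averages -/

/-- The weighted average `g ↦ ∫₀¹ tʲ g(t x) dt`. -/
def avFun (j : ℕ) (g : CI) (x : ℝ) : ℂ := ∫ t in (0 : ℝ)..1, (t : ℂ) ^ j * xt g (t * x)

theorem avFun_integrand_continuous (j : ℕ) (g : CI) :
    Continuous fun q : ℝ × ℝ => (q.2 : ℂ) ^ j * xt g (q.2 * q.1) :=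
  ((Complex.continuous_ofReal.comp continuous_snd).pow j).mul
    ((xt_continuous g).comp (by fun_prop))

theorem avFun_continuous (j : ℕ) (g : CI) : Continuous (avFun j g) :=
  intervalIntegral.continuous_parametric_intervalIntegral_of_continuous'
    (f := fun x t => (t : ℂ) ^ j * xt g (t * x)) (avFun_integrand_continuous j g) 0 1

theorem avFun_slice (j : ℕ) (g : CI) (x : ℝ) :
    Continuous fun t : ℝ => (t : ℂ) ^ j * xt g (t * x) :=
  (avFun_integrand_continuous j g).comp (Continuous.prodMk_right x)

/-- The weighted average on `C[-1,1]`. -/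
def avC (j : ℕ) : CI →L[ℂ] CI :=
  LinearMap.mkContinuous
    { toFun := fun g => toCI (avFun j g) (avFun_continuous j g)
      map_add' := by
        intro g h
        ext x
        change avFun j (g + h) x = avFun j g x + avFun j h x
        simp only [avFun, xt_add, mul_add]
        exact intervalIntegral.integral_add ((avFun_slice j g x).intervalIntegrable _ _)
          ((avFun_slice j h x).intervalIntegrable _ _)
      map_smul' := by
        intro c g
        ext x
        change avFun j (c • g) x = c * avFun j g x
        simp only [avFun, xt_smul]
        rw [← intervalIntegral.integral_const_mul]
        exact intervalIntegral.integral_congr fun t _ => mul_left_comm _ _ _ } 1 (by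
      intro g
      rw [one_mul, ContinuousMap.norm_le _ (norm_nonneg _)]
      intro x
      change ‖∫ t in (0 : ℝ)..1, (t : ℂ) ^ j * xt g (t * x)‖ ≤ _
      have := intervalIntegral.norm_integral_le_of_norm_le_const (a := 0) (b := 1) (C := ‖g‖)
        (f := fun t : ℝ => (t : ℂ) ^ j * xt g (t * x)) (fun t ht => by
          rw [uIoc_of_le zero_le_one] at ht
          rw [norm_mul, norm_pow, Complex.norm_real, Real.norm_of_nonneg ht.1.le]
          have := pow_le_one₀ ht.1.le ht.2 (n := j)
          have h2 := norm_xt_le g (t * x)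
          have := mul_le_mul this h2 (norm_nonneg _) zero_le_one
          linarith)
      simpa using this)

theorem xt_avC (j : ℕ) (g : CI) {x : ℝ} (hx : x ∈ Icc (-1 : ℝ) 1) :
    xt (avC j g) x = ∫ t in (0 : ℝ)..1, (t : ℂ) ^ j * xt g (t * x) := xt_of_mem _ hx

theorem avC_eq_integral (j : ℕ) (g : CI) :
    avC j g = ∫ t in (0 : ℝ)..1, (t : ℂ) ^ j • affCI 0 t g := by
  have hc : Continuous fun t : ℝ => (t : ℂ) ^ j • affCI 0 t g :=
    (Complex.continuous_ofReal.pow j).smul (continuous_affCI continuous_const continuous_id g)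
  refine CI_ext fun x hx => ?_
  rw [xt_avC _ _ hx, xt_intervalIntegral hc]
  refine intervalIntegral.integral_congr fun t _ => ?_
  rw [xt_smul, xt_affCI _ _ _ hx, zero_add]

/-- Composition with x ↦ tx costs t^{-1/2} in L², which the weight tʲ with j ≥ 1 absorbs. -/
theorem norm_cl_avC_le {j : ℕ} (hj : 1 ≤ j) (g : CI) : ‖cl (avC j g)‖ ≤ 1 * ‖cl g‖ := by
  have hc : Continuous fun t : ℝ => (t : ℂ) ^ j • affCI 0 t g :=
    (Complex.continuous_ofReal.pow j).smul (continuous_affCI continuous_const continuous_id g)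
  rw [avC_eq_integral, ← cl.intervalIntegral_comp_comm (hc.intervalIntegrable _ _)]
  have := intervalIntegral.norm_integral_le_of_norm_le_const (a := 0) (b := 1) (C := ‖cl g‖)
    (f := fun t : ℝ => cl ((t : ℂ) ^ j • affCI 0 t g)) (fun t ht => by
      rw [uIoc_of_le zero_le_one] at ht
      have hab : |(0 : ℝ)| + |t| ≤ 1 := by rw [abs_zero, abs_of_pos ht.1]; linarith [ht.2]
      rw [map_smul, ← affL2_cl ht.1.ne' hab, norm_smul, norm_pow, Complex.norm_real,
        Real.norm_of_nonneg ht.1.le]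
      have h1 : ‖affL2 0 t (cl g)‖ ≤ √|t⁻¹| * ‖cl g‖ := ((affL2 0 t).le_opNorm _).trans
        (mul_le_mul_of_nonneg_right (norm_affL2_le ht.1.ne' hab) (norm_nonneg _))
      have h2 : t ^ j * √|t⁻¹| ≤ 1 := by
        have h3 : t ^ j ≤ t := pow_le_of_le_one ht.1.le ht.2 (by omega)
        rw [abs_of_pos (inv_pos.2 ht.1), Real.sqrt_inv]
        have h4 : 0 < √t := Real.sqrt_pos.2 ht.1
        rw [← div_eq_mul_inv, div_le_one h4]
        refine h3.trans (Real.le_sqrt_of_sq_le ?_)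
        nlinarith [ht.1, ht.2]
      calc t ^ j * ‖affL2 0 t (cl g)‖ ≤ t ^ j * (√|t⁻¹| * ‖cl g‖) :=
            mul_le_mul_of_nonneg_left h1 (pow_nonneg ht.1.le _)
        _ = (t ^ j * √|t⁻¹|) * ‖cl g‖ := by ring
        _ ≤ 1 * ‖cl g‖ := mul_le_mul_of_nonneg_right h2 (norm_nonneg _)
        _ = ‖cl g‖ := one_mul _)
  simpa using this

/-- The weighted average on `L²(-1,1)`. -/
def avL (j : ℕ) : L2s →L[ℂ] L2s :=
  ((cl.comp (avC j)).toLinearMap).extendOfNorm cl.toLinearMap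

theorem avL_cl {j : ℕ} (hj : 1 ≤ j) (g : CI) : avL j (cl g) = cl (avC j g) :=
  LinearMap.extendOfNorm_eq (f := (cl.comp (avC j)).toLinearMap) (e := cl.toLinearMap) dense_cl
    ⟨1, norm_cl_avC_le hj⟩ g

/-- Differentiation under the integral turns the weight tʲ into tʲ⁺¹, since the chain rule supplies
a factor t. Derivatives of averages are thus averages with a higher weight, for which the L² bound
holds. -/
theorem avC_prim0_cl (j : ℕ) (c : ℂ) (g : CI) : avC j (prim0 (c, cl g)) =
    prim0 (xt (avC j (prim0 (c, cl g))) 1, cl (avC (j + 1) g)) := by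
  refine CI_ext fun x hx => ?_
  have hmem : ∀ t ∈ Icc (0 : ℝ) 1, ∀ y ∈ Icc (-1 : ℝ) 1, t * y ∈ Icc (-1 : ℝ) 1 := by
    intro t ht y hy
    constructor <;> nlinarith [ht.1, ht.2, hy.1, hy.2]
  have hval : ∀ y ∈ Icc (-1 : ℝ) 1, xt (avC j (prim0 (c, cl g))) y =
      ∫ t in (0 : ℝ)..1, (t : ℂ) ^ j * (c + ∫ s in (1 : ℝ)..(t * y), xt g s) := by
    intro y hy
    rw [xt_avC _ _ hy]
    refine intervalIntegral.integral_congr fun t ht => ?_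
    rw [uIcc_of_le zero_le_one] at ht
    rw [xt_prim0_cl _ _ (hmem t ht y hy)]
  have hprim : Continuous fun y => ∫ s in (1 : ℝ)..y, xt g s :=
    intervalIntegral.continuous_primitive (fun a b => (xt_continuous g).intervalIntegrable a b) 1
  have hcy : ∀ y : ℝ, Continuous fun t : ℝ =>
      (t : ℂ) ^ j * (c + ∫ s in (1 : ℝ)..(t * y), xt g s) := fun y =>
    (Complex.continuous_ofReal.pow j).mul
      (continuous_const.add (hprim.comp (continuous_id.mul continuous_const)))
  rw [xt_prim0_cl _ _ hx, hval x hx, hval 1 (by norm_num)]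
  have e1 : ∫ s in (1 : ℝ)..x, xt (avC (j + 1) g) s =
      ∫ s in (1 : ℝ)..x, ∫ t in (0 : ℝ)..1, (t : ℂ) ^ (j + 1) * xt g (t * s) := by
    refine intervalIntegral.integral_congr fun s hs => ?_
    rw [uIcc_of_ge hx.2] at hs
    exact xt_avC _ _ ⟨hx.1.trans hs.1, hs.2⟩
  have hsw := intervalIntegral_intervalIntegral_swap (a := 1) (b := x) (c := 0) (d := 1)
    (F := fun s t => (t : ℂ) ^ (j + 1) * xt g (t * s)) (by
      have := (avFun_integrand_continuous (j + 1) g).continuousOn.integrableOn_compact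
        (μ := volume.prod volume) (isCompact_uIcc (a := 1) (b := x) |>.prod
          (isCompact_uIcc (a := (0 : ℝ)) (b := 1)))
      exact this.mono_set (prod_mono uIoc_subset_uIcc uIoc_subset_uIcc))
  have e2 : ∀ t : ℝ, ∫ s in (1 : ℝ)..x, (t : ℂ) ^ (j + 1) * xt g (t * s) =
      (t : ℂ) ^ j * (c + ∫ s in (1 : ℝ)..(t * x), xt g s) -
      (t : ℂ) ^ j * (c + ∫ s in (1 : ℝ)..(t * 1), xt g s) := by
    intro t
    have h1 := intervalIntegral.smul_integral_comp_mul_left (a := 1) (b := x) (xt g) t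
    rw [Complex.real_smul] at h1
    rw [intervalIntegral.integral_const_mul, pow_succ, mul_assoc, h1,
      ← intervalIntegral.integral_add_adjacent_intervals (a := 1) (b := t * 1) (c := t * x)
        ((xt_continuous g).intervalIntegrable _ _) ((xt_continuous g).intervalIntegrable _ _)]
    ring
  rw [e1, hsw]
  simp only [e2]
  rw [intervalIntegral.integral_sub ((hcy x).intervalIntegrable _ _)
    ((hcy 1).intervalIntegrable _ _)]
  ring

theorem avC_prim0 (j : ℕ) (c : ℂ) (f : L2s) : avC j (prim0 (c, f)) =
    prim0 (xt (avC j (prim0 (c, f))) 1, avL (j + 1) f) := by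
  refine dense_cl.induction_on (p := fun f => avC j (prim0 (c, f)) =
    prim0 (xt (avC j (prim0 (c, f))) 1, avL (j + 1) f)) f ?_ fun g => ?_
  · have h1 : Continuous fun f => avC j (prim0 (c, f)) :=
      (avC j).continuous.comp (prim0.continuous.comp (by fun_prop))
    exact isClosed_eq h1 (prim0.continuous.comp
      (((evalCI 1).continuous.comp h1).prodMk (avL (j + 1)).continuous))
  · rw [avL_cl (by omega)]
    exact avC_prim0_cl j c g

/-- The statement is quantified over j inside the induction because passing to the derivative raises
the weight. -/
theorem exists_avS (n : ℕ) : ∀ j, ∃ A : Sob (n + 1) →L[ℂ] Sob (n + 1),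
    ∀ w, ev n (A w) = avC j (ev n w) := by
  induction n with
  | zero =>
    intro j
    refine ⟨cons.comp (((evalCI 1).comp ((avC j).comp (ev 0))).prod
      ((ContinuousLinearMap.inr ℂ (Fin 0 → ℂ) L2s).comp ((avL (j + 1)).comp
        ((toL2 0).comp tail)))), fun w => ?_⟩
    refine (ev_cons (xt (avC j (ev 0 w)) 1) _).trans ?_
    rw [ev_eq_prim0 w]
    exact (avC_prim0 j _ _).symm
  | succ n ih =>
    intro j
    obtain ⟨A, hA⟩ := ih (j + 1)
    refine ⟨cons.comp (((evalCI 1).comp ((avC j).comp (ev (n + 1)))).prod (A.comp tail)),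
      fun w => ?_⟩
    refine (ev_cons (xt (avC j (ev (n + 1) w)) 1) _).trans ?_
    rw [ev_eq_prim0 w]
    change prim0 (_, cl (ev n (A (tail w)))) = avC j (prim0 (head w, cl (ev n (tail w))))
    rw [hA]
    exact (avC_prim0_cl j _ _).symm

/-- The average `w ↦ ∫₀¹ w(t x) dt` on `Hⁿ⁺¹(-1,1)`. -/
def avS (n : ℕ) : Sob (n + 1) →L[ℂ] Sob (n + 1) := (exists_avS n 0).choose

theorem ev_avS {n : ℕ} (w : Sob (n + 1)) : ev n (avS n w) = avC 0 (ev n w) :=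
  (exists_avS n 0).choose_spec w

/-- The substitution s = tx identifies the average with x⁻¹∫₀ˣ g, the quantity in the nonlinearity,
without a singularity at 0. -/
theorem mul_xt_avC (g : CI) {x : ℝ} (hx : x ∈ Icc (-1 : ℝ) 1) :
    x * xt (avC 0 g) x = ∫ s in (0 : ℝ)..x, xt g s := by
  have h1 := intervalIntegral.smul_integral_comp_mul_right (a := 0) (b := 1) (xt g) x
  rw [Complex.real_smul] at h1
  rw [xt_avC _ _ hx]
  simp only [pow_zero, one_mul]
  rw [h1]
  simp

/-! ### Lipschitz estimates on the unit ball -/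

section Lipschitz

variable {X Y Z V : Type*} [NormedAddCommGroup X] [NormedSpace ℂ X] [NormedAddCommGroup Y]
  [NormedSpace ℂ Y] [NormedAddCommGroup Z] [NormedSpace ℂ Z] [NormedAddCommGroup V]
  [NormedSpace ℂ V]

/-- `F` is Lipschitz on the unit ball. -/
def BallLip (F : X → Y) : Prop :=
  ∃ C, 0 ≤ C ∧ ∀ v w, ‖v‖ ≤ 1 → ‖w‖ ≤ 1 → ‖F v - F w‖ ≤ C * ‖v - w‖

/-- `F` is quadratically small near the origin, in the Lipschitz sense. -/
def QuadLip (F : X → Y) : Prop :=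
  ∃ C, 0 ≤ C ∧ ∀ v w, ‖v‖ ≤ 1 → ‖w‖ ≤ 1 → ‖F v - F w‖ ≤ C * (‖v‖ + ‖w‖) * ‖v - w‖

theorem bilin_sub_le (B : Y →L[ℂ] Z →L[ℂ] V) (L : X →L[ℂ] Y) (G : X → Z) (v w : X) :
    ‖B (L v) (G v) - B (L w) (G w)‖ ≤
      ‖B‖ * (‖L‖ * ‖v - w‖) * ‖G v‖ + ‖B‖ * (‖L‖ * ‖w‖) * ‖G v - G w‖ := by
  have e : B (L v) (G v) - B (L w) (G w) = B (L (v - w)) (G v) + B (L w) (G v - G w) := by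
    simp only [map_sub, sub_apply]
    abel
  rw [e]
  refine (norm_add_le _ _).trans (add_le_add ?_ ?_)
  · refine (B.le_opNorm₂ _ _).trans ?_
    gcongr
    exact L.le_opNorm _
  · refine (B.le_opNorm₂ _ _).trans ?_
    gcongr
    exact L.le_opNorm _

theorem BallLip.bilin (B : Y →L[ℂ] Z →L[ℂ] V) (L : X →L[ℂ] Y) {G : X → Z} (hG : BallLip G) :
    BallLip fun v => B (L v) (G v) := by
  obtain ⟨C, hC, h⟩ := hG
  refine ⟨‖B‖ * ‖L‖ * (‖G 0‖ + C) + ‖B‖ * ‖L‖ * C, by positivity, fun v w hv hw => ?_⟩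
  have h0 : ‖G v‖ ≤ ‖G 0‖ + C := by
    have h1 := h v 0 hv (by simp)
    rw [sub_zero] at h1
    have h2 := norm_sub_norm_le (G v) (G 0)
    nlinarith
  calc ‖B (L v) (G v) - B (L w) (G w)‖
      ≤ ‖B‖ * (‖L‖ * ‖v - w‖) * ‖G v‖ + ‖B‖ * (‖L‖ * ‖w‖) * ‖G v - G w‖ := bilin_sub_le B L G v w
    _ ≤ ‖B‖ * (‖L‖ * ‖v - w‖) * (‖G 0‖ + C) + ‖B‖ * (‖L‖ * 1) * (C * ‖v - w‖) := by
        gcongr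
        exact h v w hv hw
    _ = _ := by ring

theorem QuadLip.bilin (B : Y →L[ℂ] Z →L[ℂ] V) (L : X →L[ℂ] Y) {G : X → Z} (hG : BallLip G)
    (h0 : G 0 = 0) : QuadLip fun v => B (L v) (G v) := by
  obtain ⟨C, hC, h⟩ := hG
  refine ⟨‖B‖ * ‖L‖ * C, by positivity, fun v w hv hw => ?_⟩
  have hv' : ‖G v‖ ≤ C * ‖v‖ := by simpa [h0] using h v 0 hv (by simp)
  calc ‖B (L v) (G v) - B (L w) (G w)‖
      ≤ ‖B‖ * (‖L‖ * ‖v - w‖) * ‖G v‖ + ‖B‖ * (‖L‖ * ‖w‖) * ‖G v - G w‖ := bilin_sub_le B L G v w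
    _ ≤ ‖B‖ * (‖L‖ * ‖v - w‖) * (C * ‖v‖) + ‖B‖ * (‖L‖ * ‖w‖) * (C * ‖v - w‖) := by
        gcongr
        exact h v w hv hw
    _ = _ := by ring

set_option linter.unusedSectionVars false in
theorem QuadLip.add {F G : X → Y} (hF : QuadLip F) (hG : QuadLip G) :
    QuadLip fun v => F v + G v := by
  obtain ⟨C, hC, h⟩ := hF
  obtain ⟨D, hD, h'⟩ := hG
  refine ⟨C + D, by positivity, fun v w hv hw => ?_⟩
  rw [add_sub_add_comm, add_mul, add_mul]
  exact (norm_add_le _ _).trans (add_le_add (h v w hv hw) (h' v w hv hw))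

set_option linter.unusedSectionVars false in
theorem QuadLip.clm (L : Y →L[ℂ] Z) {F : X → Y} (hF : QuadLip F) : QuadLip fun v => L (F v) := by
  obtain ⟨C, hC, h⟩ := hF
  refine ⟨‖L‖ * C, by positivity, fun v w hv hw => ?_⟩
  rw [← map_sub, mul_assoc, mul_assoc, ← mul_assoc C]
  exact (L.le_opNorm _).trans (mul_le_mul_of_nonneg_left (h v w hv hw) (norm_nonneg _))

theorem QuadLip.smul (c : ℂ) {F : X → Y} (hF : QuadLip F) : QuadLip fun v => c • F v :=
  hF.clm (c • ContinuousLinearMap.id ℂ Y)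

set_option linter.unusedSectionVars false in
theorem QuadLip.sum {ι : Type*} (s : Finset ι) {F : ι → X → Y} (hF : ∀ i ∈ s, QuadLip (F i)) :
    QuadLip fun v => ∑ i ∈ s, F i v := by
  classical
  induction s using Finset.induction_on with
  | empty => exact ⟨0, le_rfl, fun v w _ _ => by simp⟩
  | insert i s hi ih =>
    simp only [Finset.sum_insert hi]
    exact (hF i (Finset.mem_insert_self i s)).add
      (ih fun k hk => hF k (Finset.mem_insert_of_mem hk))

end Lipschitz

theorem ballLip_powS {n m : ℕ} (L : Sob m →L[ℂ] Sob (n + 1)) (k : ℕ) :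
    BallLip fun w => powS n k (L w) := by
  induction k with
  | zero => exact ⟨0, le_rfl, fun v w _ _ => by simp [powS]⟩
  | succ k ih => exact BallLip.bilin (mulS n) L ih

theorem powS_zero {n k : ℕ} (hk : k ≠ 0) : powS n k 0 = 0 := by
  obtain ⟨k, rfl⟩ := Nat.exists_eq_succ_of_ne_zero hk
  simp [powS]

/-! ### The nonlinearity -/

/-- The average of the even part. -/
def avE (n : ℕ) : Sob (n + 1) →L[ℂ] Sob (n + 1) := (avS n).comp (evenP (n + 1))

/-- The function `x (A w_e(x))ᵏ⁺¹`, as an element of `Hⁿ⁺²(-1,1)`, for `w ∈ Hⁿ⁺¹(-1,1)`. -/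
def monom (n k : ℕ) (w : Sob (n + 1)) : Sob (n + 2) :=
  cons.comp (head.prod (ContinuousLinearMap.id ℂ (Sob (n + 1))))
      (mulS n (avE n w) (powS n k (avE n w))) +
    (cons.comp (ContinuousLinearMap.inr ℂ ℂ (Sob (n + 1))))
      (((k + 1 : ℕ) : ℂ) • mulS n ((evenP (n + 1) - avE n) w) (powS n k (avE n w)))

/-- Each summand is bilinear in a linear factor and a power of positive exponent. The power vanishes
at the origin, which makes the product quadratically small. -/
theorem quadLip_monom (n : ℕ) {k : ℕ} (hk : k ≠ 0) : QuadLip (monom n k) := by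
  have h := ballLip_powS (avE n) k
  have h0 : powS n k (avE n 0) = 0 := by rw [map_zero, powS_zero hk]
  exact ((QuadLip.bilin (mulS n) (avE n) h h0).clm _).add
    (((QuadLip.bilin (mulS n) (evenP (n + 1) - avE n) h h0).smul _).clm _)

theorem continuous_monom (n k : ℕ) : Continuous (monom n k) := by
  have h : Continuous fun w => powS n k (avE n w) := (continuous_powS n k).comp (avE n).continuous
  exact ((ContinuousLinearMap.continuous _).comp (continuous_mulS (avE n).continuous h)).add
    ((ContinuousLinearMap.continuous _).comp
      ((continuous_mulS (ContinuousLinearMap.continuous _) h).fun_const_smul _))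

theorem head_monom (n k : ℕ) (w : Sob (n + 1)) :
    head (monom n k w) = head (mulS n (avE n w) (powS n k (avE n w))) := by
  change head (cons (_, _) + cons (0, _)) = _
  rw [map_add, head_cons, head_cons, add_zero]
  rfl

theorem tail_monom (n k : ℕ) (w : Sob (n + 1)) :
    tail (monom n k w) = mulS n (avE n w) (powS n k (avE n w)) +
      ((k + 1 : ℕ) : ℂ) • mulS n (evenP (n + 1) w - avE n w) (powS n k (avE n w)) := by
  change tail (cons (_, _) + cons (0, _)) = _
  rw [map_add, tail_cons, tail_cons]
  rfl

/-- The quotient rule for x⁻¹∫₀ˣ g. The factor x in x(Ag)ᵏ⁺¹ cancels the division by x, so the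
derivative of that product involves no derivative of g; this is how `monom` gains one order of
smoothness. -/
theorem hasDerivAt_avC (g : CI) {x : ℝ} (hx : x ∈ Ioo (-1 : ℝ) 1) (h0 : x ≠ 0) :
    HasDerivAt (xt (avC 0 g)) ((xt g x - xt (avC 0 g) x) / x) x := by
  have hx0 : (x : ℂ) ≠ 0 := by exact_mod_cast h0
  have h1 : HasDerivAt (fun y : ℝ => (∫ s in (0 : ℝ)..y, xt g s) / (y : ℂ))
      ((xt g x * x - (∫ s in (0 : ℝ)..x, xt g s) * 1) / (x : ℂ) ^ 2) x :=
    ((xt_continuous g).integral_hasStrictDerivAt 0 x).hasDerivAt.div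
      (hasDerivAt_id x).ofReal_comp hx0
  refine (h1.congr_of_eventuallyEq ?_).congr_deriv ?_
  · filter_upwards [Ioo_mem_nhds hx.1 hx.2, isOpen_ne.mem_nhds h0] with y hy hy0
    have hy0' : (y : ℂ) ≠ 0 := by exact_mod_cast hy0
    rw [← mul_xt_avC g (Ioo_subset_Icc_self hy)]
    field_simp
  · rw [← mul_xt_avC g (Ioo_subset_Icc_self hx)]
    field_simp

theorem xt_ev_monom (n k : ℕ) (w : Sob (n + 1)) {x : ℝ} (hx : x ∈ Icc (-1 : ℝ) 1) :
    xt (ev (n + 1) (monom n k w)) x = x * xt (avC 0 (ev n (evenP (n + 1) w))) x ^ (k + 1) := by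
  set g := ev n (evenP (n + 1) w) with hg
  have hA : ev n (avE n w) = avC 0 g := ev_avS _
  have hint : ∀ s, xt (ev n (tail (monom n k w))) s = xt (avC 0 g) s ^ (k + 1) +
      (k + 1 : ℕ) * ((xt g s - xt (avC 0 g) s) * xt (avC 0 g) s ^ k) := by
    intro s
    rw [tail_monom, map_add, map_smul, ev_mulS, ev_mulS, xt_add, xt_smul, xt_mul, xt_mul, ev_powS,
      map_sub, xt_sub, hA, pow_succ']
  have hcont : Continuous fun s => xt (avC 0 g) s ^ (k + 1) +
      (k + 1 : ℕ) * ((xt g s - xt (avC 0 g) s) * xt (avC 0 g) s ^ k) := by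
    have h1 := xt_continuous g
    have h2 := xt_continuous (avC 0 g)
    fun_prop
  have hF : Continuous fun s : ℝ => (s : ℂ) * xt (avC 0 g) s ^ (k + 1) := by
    have h2 := xt_continuous (avC 0 g)
    fun_prop
  rw [xt_ev_succ _ hx, head_monom, ← xt_ev_one, ev_mulS, xt_mul, ev_powS, hA, ← pow_succ']
  simp only [hint]
  -- The formula for the derivative of the average is available only away from 0, so the fundamental
  -- theorem is used with that single exceptional point.
  have key := integral_eq_of_hasDerivAt_off_countable_of_le
    (fun s : ℝ => (s : ℂ) * xt (avC 0 g) s ^ (k + 1)) _ (a := x) (b := 1) hx.2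
    (countable_singleton (0 : ℝ)) hF.continuousOn
    (fun s hs => by
      have hs0 : s ≠ 0 := hs.2
      have hs0' : (s : ℂ) ≠ 0 := by exact_mod_cast hs0
      have := (hasDerivAt_id s).ofReal_comp.mul
        ((hasDerivAt_avC g ⟨hx.1.trans_lt hs.1.1, hs.1.2⟩ hs0).pow (k + 1))
      refine this.congr_deriv (f' := _) (g' := xt (avC 0 g) s ^ (k + 1) +
        (k + 1 : ℕ) * ((xt g s - xt (avC 0 g) s) * xt (avC 0 g) s ^ k)) ?_
      simp only [Nat.add_sub_cancel, id, Complex.ofReal_one, Pi.pow_apply]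
      field_simp)
    (hcont.intervalIntegrable _ _)
  rw [intervalIntegral.integral_symm, key]
  push_cast
  ring

/-- The nonlinearity `∑ b_j x (A w_e(x))ʲ`, from `Hⁿ⁺¹(-1,1)` to `Hⁿ⁺²(-1,1)`. -/
def nonlin (b : ℕ → ℝ) (p n : ℕ) (w : Sob (n + 1)) : Sob (n + 2) :=
  ∑ j ∈ Finset.Icc 2 p, (b j : ℂ) • monom n (j - 1) w

theorem quadLip_nonlin (b : ℕ → ℝ) (p n : ℕ) : QuadLip (nonlin b p n) :=
  QuadLip.sum _ fun j hj => (quadLip_monom n (by rw [Finset.mem_Icc] at hj; omega)).smul _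

theorem continuous_nonlin (b : ℕ → ℝ) (p n : ℕ) : Continuous (nonlin b p n) :=
  continuous_finsetSum _ fun j _ => (continuous_monom n (j - 1)).fun_const_smul _

theorem xt_finset_sum {ι : Type*} (s : Finset ι) (F : ι → CI) (x : ℝ) :
    xt (∑ i ∈ s, F i) x = ∑ i ∈ s, xt (F i) x := by
  classical
  induction s using Finset.induction_on with
  | empty => simp [xt_zero]
  | insert i s hi ih => rw [Finset.sum_insert hi, Finset.sum_insert hi, xt_add, ih]

theorem xt_ev_nonlin (b : ℕ → ℝ) (p n : ℕ) (w : Sob (n + 1)) {x : ℝ} (hx : x ∈ Icc (-1 : ℝ) 1) :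
    xt (ev (n + 1) (nonlin b p n w)) x =
      ∑ j ∈ Finset.Icc 2 p, b j * (x * xt (avC 0 (ev n (evenP (n + 1) w))) x ^ j) := by
  rw [nonlin, map_sum, xt_finset_sum]
  refine Finset.sum_congr rfl fun j hj => ?_
  rw [Finset.mem_Icc] at hj
  rw [map_smul, xt_smul, xt_ev_monom _ _ _ hx, Nat.sub_add_cancel (by omega)]

theorem nonlin_zero (b : ℕ → ℝ) (p n : ℕ) : nonlin b p n 0 = 0 := by
  refine Finset.sum_eq_zero fun j hj => ?_
  rw [monom]
  simp only [map_zero, zero_apply, smul_zero, add_zero]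

/-! ### The Lyapunov-Perron method -/

section LyapunovPerron

variable {X : Type*} [NormedAddCommGroup X] [NormedSpace ℂ X]

/-- The coefficient of the growing mode that removes the growth. -/
def perronCoeff (l : X →L[ℂ] ℂ) (u : X) (G : ℝ → X) : ℂ :=
  -l u - ∫ s in Ioi (0 : ℝ), (Real.exp (-s) : ℂ) * l (G s)

/-- The solution of the inhomogeneous linear equation with corrected initial data. -/
def perron (S : ℝ → X →L[ℂ] X) (l : X →L[ℂ] ℂ) (g u : X) (G : ℝ → X) (t : ℝ) : X :=
  S t (u + perronCoeff l u G • g) + ∫ s in (0 : ℝ)..t, S (t - s) (G s)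

theorem perron_continuous {S : ℝ → X →L[ℂ] X} (hS : StronglyCont S) (l : X →L[ℂ] ℂ) (g u : X)
    {G : ℝ → X} (hG : Continuous G) : Continuous (perron S l g u G) :=
  (hS.comp continuous_id continuous_const).add (hS.continuous_conv hG)

theorem perron_integrand_bound (l : X →L[ℂ] ℂ) {G : ℝ → X} {M : ℝ}
    (hM : ∀ s, 0 ≤ s → ‖G s‖ ≤ M * Real.exp (-(2 * s))) {t s : ℝ} (ht : 0 ≤ t) (hs : t ≤ s) :
    ‖(Real.exp (-s) : ℂ) * l (G s)‖ ≤ ‖l‖ * M * Real.exp (-(2 * t)) * Real.exp (-s) := by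
  have hM0 : 0 ≤ M := by simpa using (norm_nonneg _).trans (hM 0 le_rfl)
  rw [norm_mul, Complex.norm_real, Real.norm_of_nonneg (Real.exp_pos _).le]
  have h1 : ‖l (G s)‖ ≤ ‖l‖ * (M * Real.exp (-(2 * s))) :=
    (l.le_opNorm _).trans (mul_le_mul_of_nonneg_left (hM s (ht.trans hs)) (norm_nonneg _))
  have h2 : Real.exp (-(2 * s)) ≤ Real.exp (-(2 * t)) := Real.exp_le_exp.2 (by linarith)
  calc Real.exp (-s) * ‖l (G s)‖ ≤ Real.exp (-s) * (‖l‖ * (M * Real.exp (-(2 * s)))) := by gcongr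
    _ ≤ Real.exp (-s) * (‖l‖ * (M * Real.exp (-(2 * t)))) := by gcongr
    _ = _ := by ring

theorem perron_integrand_integrable (l : X →L[ℂ] ℂ) {G : ℝ → X} (hG : Continuous G) {M : ℝ}
    (hM : ∀ s, 0 ≤ s → ‖G s‖ ≤ M * Real.exp (-(2 * s))) {t : ℝ} (ht : 0 ≤ t) :
    IntegrableOn (fun s : ℝ => (Real.exp (-s) : ℂ) * l (G s)) (Ioi t) := by
  refine Integrable.mono' ((integrableOn_exp_neg_Ioi t).const_mul (‖l‖ * M * Real.exp (-(2 * t))))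
    (Continuous.aestronglyMeasurable (by fun_prop)) ?_
  filter_upwards [ae_restrict_mem measurableSet_Ioi] with s hs
  exact perron_integrand_bound l hM ht (le_of_lt hs)

/-- The construction is affine in the forcing, so a difference has zero data and obeys the same
estimate as a single solution. -/
theorem perron_sub {S : ℝ → X →L[ℂ] X} (hS : StronglyCont S) (l : X →L[ℂ] ℂ) (g u : X)
    {G G' : ℝ → X} (hG : Continuous G) (hG' : Continuous G') {M M' : ℝ}
    (hM : ∀ s, 0 ≤ s → ‖G s‖ ≤ M * Real.exp (-(2 * s)))
    (hM' : ∀ s, 0 ≤ s → ‖G' s‖ ≤ M' * Real.exp (-(2 * s))) (t : ℝ) :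
    perron S l g u G t - perron S l g u G' t = perron S l g 0 (fun s => G s - G' s) t := by
  have h1 : perronCoeff l 0 (fun s => G s - G' s) = perronCoeff l u G - perronCoeff l u G' := by
    simp only [perronCoeff, map_sub, mul_sub, map_zero]
    rw [integral_sub (perron_integrand_integrable l hG hM le_rfl)
      (perron_integrand_integrable l hG' hM' le_rfl)]
    ring
  have hi : ∀ {F : ℝ → X}, Continuous F →
      IntervalIntegrable (fun s => S (t - s) (F s)) volume 0 t := fun hF =>
    (hS.comp (continuous_const.sub continuous_id) hF).intervalIntegrable _ _
  simp only [perron, h1, map_sub]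
  rw [intervalIntegral.integral_sub (hi hG) (hi hG')]
  simp only [map_add, sub_smul, map_sub, map_zero]
  abel

theorem norm_perron_le [CompleteSpace X] {S : ℝ → X →L[ℂ] X} (hS : StronglyCont S) {C : ℝ} (hC : 0 ≤ C)
    (l : X →L[ℂ] ℂ) {g : X} (hg : ∀ t, 0 ≤ t → S t g = (Real.exp t : ℂ) • g)
    (hd : ∀ t, 0 ≤ t → ∀ w, ‖S t w - ((Real.exp t : ℂ) * l w) • g‖ ≤ C * Real.exp (-t) * ‖w‖)
    (u : X) {G : ℝ → X} (hG : Continuous G) {M : ℝ}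
    (hM : ∀ s, 0 ≤ s → ‖G s‖ ≤ M * Real.exp (-(2 * s))) {t : ℝ} (ht : 0 ≤ t) :
    ‖perron S l g u G t‖ ≤ (C * ‖u‖ + (C + ‖l‖ * ‖g‖) * M) * Real.exp (-t) := by
  have hM0 : 0 ≤ M := by simpa using (norm_nonneg _).trans (hM 0 le_rfl)
  set J := ∫ s in Ioi t, (Real.exp (-s) : ℂ) * l (G s) with hJ
  have hI := intervalIntegral.integral_interval_add_Ioi
    (perron_integrand_integrable l hG hM le_rfl) (perron_integrand_integrable l hG hM ht)
  have hc1 : Continuous fun s => S (t - s) (G s) := hS.comp (continuous_const.sub continuous_id) hG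
  have hc2 : Continuous fun s => ((Real.exp (t - s) : ℂ) * l (G s)) • g := by fun_prop
  have hexp : ∫ s in (0 : ℝ)..t, ((Real.exp (t - s) : ℂ) * l (G s)) • g =
      ((Real.exp t : ℂ) * ∫ s in (0 : ℝ)..t, (Real.exp (-s) : ℂ) * l (G s)) • g := by
    rw [intervalIntegral.integral_smul_const, ← intervalIntegral.integral_const_mul]
    congr 2
    ext s
    rw [← mul_assoc, ← Complex.ofReal_mul, ← Real.exp_add, ← sub_eq_add_neg]
  -- After the correction, the growing parts of the data and of the forcing up to time t cancel.
  -- What remains are two decaying remainders and the growing part of the future forcing, which is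
  -- of size e^t ∫ₜ^∞ e^{-s} e^{-2s} ds.
  have hdec : perron S l g u G t = (S t u - ((Real.exp t : ℂ) * l u) • g) +
      (∫ s in (0 : ℝ)..t, (S (t - s) (G s) - ((Real.exp (t - s) : ℂ) * l (G s)) • g)) -
      ((Real.exp t : ℂ) * J) • g := by
    rw [intervalIntegral.integral_sub (hc1.intervalIntegrable _ _) (hc2.intervalIntegrable _ _),
      hexp, perron, map_add, map_smul, hg t ht, perronCoeff, ← hI, smul_smul, ← hJ]
    module
  have b1 := hd t ht u
  have b2 : ‖∫ s in (0 : ℝ)..t, (S (t - s) (G s) - ((Real.exp (t - s) : ℂ) * l (G s)) • g)‖ ≤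
      ∫ s in (0 : ℝ)..t, C * M * Real.exp (-t) * Real.exp (-s) := by
    refine intervalIntegral.norm_integral_le_of_norm_le ht (Filter.Eventually.of_forall ?_)
      (Continuous.intervalIntegrable (by fun_prop) _ _)
    intro s hs
    refine (hd (t - s) (by linarith [hs.2]) (G s)).trans ?_
    calc C * Real.exp (-(t - s)) * ‖G s‖
        ≤ C * Real.exp (-(t - s)) * (M * Real.exp (-(2 * s))) := by
          gcongr
          exact hM s hs.1.le
      _ = C * M * (Real.exp (-(t - s)) * Real.exp (-(2 * s))) := by ring
      _ = C * M * (Real.exp (-t) * Real.exp (-s)) := by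
          rw [← Real.exp_add, ← Real.exp_add]
          ring_nf
      _ = _ := by ring
  have b2' : ∫ s in (0 : ℝ)..t, C * M * Real.exp (-t) * Real.exp (-s) ≤
      C * M * Real.exp (-t) := by
    rw [intervalIntegral.integral_const_mul]
    refine mul_le_of_le_one_right (by positivity) ?_
    have e : ∫ s in (0 : ℝ)..t, Real.exp (-s) = 1 - Real.exp (-t) := by
      rw [intervalIntegral.integral_comp_neg fun s => Real.exp s]
      simp
    rw [e]
    linarith [Real.exp_pos (-t)]
  have b3 : ‖J‖ ≤ ‖l‖ * M * Real.exp (-(2 * t)) * Real.exp (-t) := by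
    rw [← integral_exp_neg_Ioi t, ← integral_const_mul]
    refine norm_integral_le_of_norm_le ((integrableOn_exp_neg_Ioi t).const_mul _) ?_
    filter_upwards [ae_restrict_mem measurableSet_Ioi] with s hs
    exact perron_integrand_bound l hM ht (le_of_lt hs)
  have b4 : ‖((Real.exp t : ℂ) * J) • g‖ ≤ ‖l‖ * ‖g‖ * M * Real.exp (-t) := by
    rw [norm_smul, norm_mul, Complex.norm_real, Real.norm_of_nonneg (Real.exp_pos _).le]
    calc Real.exp t * ‖J‖ * ‖g‖
        ≤ Real.exp t * (‖l‖ * M * Real.exp (-(2 * t)) * Real.exp (-t)) * ‖g‖ := by gcongr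
      _ = ‖l‖ * ‖g‖ * M * (Real.exp t * Real.exp (-t) * Real.exp (-(2 * t))) := by ring
      _ = ‖l‖ * ‖g‖ * M * Real.exp (-(2 * t)) := by rw [← Real.exp_add]; simp
      _ ≤ ‖l‖ * ‖g‖ * M * Real.exp (-t) := by
          gcongr
          linarith
  rw [hdec]
  refine (norm_sub_le _ _).trans ?_
  have b5 := norm_add_le (S t u - ((Real.exp t : ℂ) * l u) • g)
    (∫ s in (0 : ℝ)..t, (S (t - s) (G s) - ((Real.exp (t - s) : ℂ) * l (G s)) • g))
  nlinarith [b1, b2, b2', b4, b5]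

/-- Existence of a decaying solution of the integral equation, for suitably corrected small
initial data. -/
theorem exists_decaying [CompleteSpace X] {S : ℝ → X →L[ℂ] X} (hS : StronglyCont S) {C : ℝ}
    (hC : 0 ≤ C) (l : X →L[ℂ] ℂ) {g : X} (hg : ∀ t, 0 ≤ t → S t g = (Real.exp t : ℂ) • g)
    (hd : ∀ t, 0 ≤ t → ∀ w, ‖S t w - ((Real.exp t : ℂ) * l w) • g‖ ≤ C * Real.exp (-t) * ‖w‖)
    {F : X → X} (hF : Continuous F) (hQ : QuadLip F) (hF0 : F 0 = 0) :
    ∃ ε > 0, ∀ u, ‖u‖ ≤ ε → ∃ (α : ℂ) (φ : ℝ → X), Continuous φ ∧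
      (∀ t, 0 ≤ t → φ t = S t (u + α • g) + ∫ s in (0 : ℝ)..t, S (t - s) (F (φ s))) ∧
      ∀ t, 0 ≤ t → ‖φ t‖ ≤ Real.exp (-t) := by
  obtain ⟨K, hK, hQ⟩ := hQ
  set D := (C + ‖l‖ * ‖g‖) * K with hD
  have hD0 : 0 ≤ D := by positivity
  -- The bound D r ≤ 1/4 makes the contraction constant 2Dr at most 1/2, and r ≤ 1 keeps the
  -- iteration inside the unit ball where `QuadLip` gives information.
  set r := (4 * D + 1)⁻¹ with hr
  have hr0 : 0 < r := by positivity
  have hr1 : r ≤ 1 := inv_le_one_of_one_le₀ (by linarith)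
  have hDr : D * r ≤ 1 / 4 := by
    rw [hr, ← div_eq_mul_inv, div_le_iff₀ (by positivity)]
    linarith
  -- The data may use half of the radius; the quadratic term uses at most a quarter of it.
  refine ⟨r / (2 * (C + 1)), by positivity, fun u hu => ?_⟩
  have hCu : C * ‖u‖ ≤ r / 2 := by
    calc C * ‖u‖ ≤ (C + 1) * (r / (2 * (C + 1))) := by gcongr; linarith
      _ = r / 2 := by field_simp
  let B := Metric.closedBall (0 : BoundedContinuousFunction ℝ X) r
  have : CompleteSpace B := Metric.isClosed_closedBall.completeSpace_coe
  -- The iteration runs on ψ(t) = e^t φ(t), so that the supremum norm encodes the decay; `ph`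
  -- recovers φ at nonnegative times.
  let ph : BoundedContinuousFunction ℝ X → ℝ → X := fun ψ s => (Real.exp (-|s|) : ℂ) • ψ s
  have hphc : ∀ ψ, Continuous (ph ψ) := fun ψ => by
    have := ψ.continuous
    fun_prop
  have hphn : ∀ ψ s, 0 ≤ s → ‖ph ψ s‖ ≤ Real.exp (-s) * ‖ψ‖ := by
    intro ψ s hs
    simp only [ph]
    rw [norm_smul, Complex.norm_real, Real.norm_of_nonneg (Real.exp_pos _).le, abs_of_nonneg hs]
    gcongr
    exact ψ.norm_coe_le_norm s
  have hphsub : ∀ ψ χ s, ph ψ s - ph χ s = ph (ψ - χ) s := by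
    intro ψ χ s
    simp only [ph, BoundedContinuousFunction.coe_sub, Pi.sub_apply, smul_sub]
  have hB : ∀ ψ : B, ‖ψ.1‖ ≤ r := fun ψ => mem_closedBall_zero_iff.1 ψ.2
  have hph1 : ∀ (ψ : B) s, 0 ≤ s → ‖ph ψ s‖ ≤ Real.exp (-s) * r := fun ψ s hs =>
    (hphn ψ s hs).trans (mul_le_mul_of_nonneg_left (hB ψ) (Real.exp_pos _).le)
  have hph2 : ∀ (ψ : B) s, 0 ≤ s → ‖ph ψ s‖ ≤ 1 := fun ψ s hs =>
    (hph1 ψ s hs).trans (mul_le_one₀ (Real.exp_le_one_iff.2 (by linarith)) hr0.le hr1)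
  have hexp2 : ∀ s : ℝ, Real.exp (-s) * Real.exp (-s) = Real.exp (-(2 * s)) := by
    intro s
    rw [← Real.exp_add]
    ring_nf
  have hGd : ∀ (ψ χ : B) s, 0 ≤ s →
      ‖F (ph ψ s) - F (ph χ s)‖ ≤ K * (2 * r) * ‖ψ.1 - χ.1‖ * Real.exp (-(2 * s)) := by
    intro ψ χ s hs
    refine (hQ _ _ (hph2 ψ s hs) (hph2 χ s hs)).trans ?_
    rw [hphsub]
    calc K * (‖ph ψ s‖ + ‖ph χ s‖) * ‖ph (ψ.1 - χ.1) s‖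
        ≤ K * (Real.exp (-s) * r + Real.exp (-s) * r) * (Real.exp (-s) * ‖ψ.1 - χ.1‖) := by
          gcongr
          · exact hph1 ψ s hs
          · exact hph1 χ s hs
          · exact hphn _ s hs
      _ = K * (2 * r) * ‖ψ.1 - χ.1‖ * (Real.exp (-s) * Real.exp (-s)) := by ring
      _ = _ := by rw [hexp2]
  have hGn : ∀ (ψ : B) s, 0 ≤ s → ‖F (ph ψ s)‖ ≤ K * r * r * Real.exp (-(2 * s)) := by
    intro ψ s hs
    have h1 := hQ (ph ψ s) 0 (hph2 ψ s hs) (by simp)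
    rw [hF0, sub_zero, sub_zero, norm_zero, add_zero] at h1
    refine h1.trans ?_
    calc K * ‖ph ψ s‖ * ‖ph ψ s‖
        ≤ K * (Real.exp (-s) * r) * (Real.exp (-s) * r) := by
          gcongr <;> exact hph1 ψ s hs
      _ = K * r * r * (Real.exp (-s) * Real.exp (-s)) := by ring
      _ = _ := by rw [hexp2]
  have hGc : ∀ ψ, Continuous fun s => F (ph ψ s) := fun ψ => hF.comp (hphc ψ)
  let Lp : BoundedContinuousFunction ℝ X → ℝ → X := fun ψ t =>
    (Real.exp (max t 0) : ℂ) • perron S l g u (fun s => F (ph ψ s)) (max t 0)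
  have hLc : ∀ ψ, Continuous (Lp ψ) := fun ψ => by
    have h1 := (perron_continuous hS l g u (hGc ψ)).comp
      (continuous_id.max (continuous_const (y := (0 : ℝ))))
    exact Continuous.smul (by fun_prop) h1
  have hwt : ∀ (x : X) (c t : ℝ), 0 ≤ t → ‖x‖ ≤ c * Real.exp (-t) →
      ‖(Real.exp t : ℂ) • x‖ ≤ c := by
    intro x c t _ h
    rw [norm_smul, Complex.norm_real, Real.norm_of_nonneg (Real.exp_pos _).le]
    calc Real.exp t * ‖x‖ ≤ Real.exp t * (c * Real.exp (-t)) := by gcongr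
      _ = c * (Real.exp t * Real.exp (-t)) := by ring
      _ = c := by rw [← Real.exp_add]; simp
  have hLn : ∀ (ψ : B) t, ‖Lp ψ t‖ ≤ r := by
    intro ψ t
    refine hwt _ _ _ (le_max_right t 0) ((norm_perron_le hS hC l hg hd u (hGc ψ) (hGn ψ)
      (le_max_right t 0)).trans (mul_le_mul_of_nonneg_right ?_ (Real.exp_pos _).le))
    have : (C + ‖l‖ * ‖g‖) * (K * r * r) = D * r * r := by rw [hD]; ring
    rw [this]
    nlinarith
  let Λ : B → B := fun ψ => ⟨BoundedContinuousFunction.ofNormedAddCommGroup (Lp ψ) (hLc ψ) r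
    (hLn ψ), by
      rw [mem_closedBall_zero_iff]
      exact BoundedContinuousFunction.norm_ofNormedAddCommGroup_le _ hr0.le (hLn ψ)⟩
  have hΛ : ContractingWith (1 / 2 : NNReal) Λ := by
    refine ⟨by rw [← NNReal.coe_lt_coe]; norm_num, LipschitzWith.of_dist_le_mul fun ψ χ => ?_⟩
    change dist (Λ ψ).1 (Λ χ).1 ≤ _ * dist ψ.1 χ.1
    rw [BoundedContinuousFunction.dist_le (by positivity)]
    intro t
    change dist (Lp ψ t) (Lp χ t) ≤ _
    rw [dist_eq_norm, dist_eq_norm, ← smul_sub, perron_sub hS l g u (hGc ψ) (hGc χ) (hGn ψ) (hGn χ)]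
    refine hwt _ _ _ (le_max_right t 0) ((norm_perron_le hS hC l hg hd 0 ((hGc ψ).sub (hGc χ))
      (hGd ψ χ) (le_max_right t 0)).trans (mul_le_mul_of_nonneg_right ?_ (Real.exp_pos _).le))
    have : C * ‖(0 : X)‖ + (C + ‖l‖ * ‖g‖) * (K * (2 * r) * ‖ψ.1 - χ.1‖) =
        2 * (D * r) * ‖ψ.1 - χ.1‖ := by rw [hD, norm_zero]; ring
    rw [this]
    refine mul_le_mul_of_nonneg_right ?_ (norm_nonneg _)
    have h2 : (((1 / 2 : NNReal)) : ℝ) = 1 / 2 := by norm_num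
    rw [h2]
    linarith
  have : Nonempty B := ⟨⟨0, by simp [B, hr0.le]⟩⟩
  set ψ := hΛ.fixedPoint Λ with hψ
  have hfix : Λ ψ = ψ := hΛ.fixedPoint_isFixedPt
  have hval : ∀ t, Lp ψ t = ψ.1 t := fun t => by
    conv_rhs => rw [← hfix]
    rfl
  refine ⟨perronCoeff l u fun s => F (ph ψ s), ph ψ, hphc _, fun t ht => ?_, fun t ht => ?_⟩
  · have h1 : ph ψ t = (Real.exp (-|t|) : ℂ) • Lp ψ t := by rw [hval]
    rw [h1]
    simp only [Lp]
    rw [max_eq_left ht, abs_of_nonneg ht, smul_smul, ← Complex.ofReal_mul, ← Real.exp_add]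
    simp [perron]
  · refine (hph1 ψ t ht).trans ?_
    exact mul_le_of_le_one_right (Real.exp_pos _).le hr1

end LyapunovPerron

/-! ### Classical solutions in the model space -/

theorem ev_const_mode {n : ℕ} (c : ℂ) : ev n (cons (c, 0)) = constCI c := by
  rw [ev_eq_prim0, head_cons, tail_cons, map_zero, prim0_apply, map_zero, add_zero]

theorem xt_ev_affine {n : ℕ} (c d : ℂ) {x : ℝ} (hx : x ∈ Icc (-1 : ℝ) 1) :
    xt (ev (n + 1) (cons (c, cons (d, 0)))) x = c + (x - 1) * d := by
  rw [ev_succ, head_cons, tail_cons, ev_const_mode, xt_add, xt_constCI, xt_primCI_const hx]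

theorem freeGen_incl (a : ℝ) {n : ℕ} (w : Sob (n + 2)) :
    freeGen a (incl w) = incl (freeGen a w) := by
  apply toL2_injective n
  rw [toL2_freeGen, toL2_incl, toL2_incl, toL2_freeGen, tail_incl, toL2_incl]

/-- The free generator sends (1+a)x + 1 to 1 - (1+a)²x, again affine. Adding a multiple of the
growing mode therefore keeps the data in the domain. -/
theorem incl_eq_freeGen_growMode (a : ℝ) (n : ℕ) :
    incl (cons (((-(a * (2 + a)) : ℝ) : ℂ), cons (((-(1 + a) ^ 2 : ℝ) : ℂ), 0))) =
      freeGen a (growMode a n) := by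
  apply toL2_injective (n + 1)
  rw [toL2_incl, toL2_freeGen, growMode, tail_cons, toL2_succ, toL2_succ, toL2_succ, mulL2_cl,
    ← map_smul, ← map_sub]
  congr 1
  refine CI_ext fun x hx => ?_
  rw [xt_ev_affine _ _ hx, xt_sub, xt_mul, xt_smul, xt_ev_affine _ _ hx, xt_oneSub hx,
    ev_const_mode, xt_constCI]
  push_cast
  ring

theorem flow_of_incl_eq {a : ℝ} (ha : 0 ≤ a) {n : ℕ} {v z : Sob (n + 1)}
    (hz : incl z = freeGen a v) {t : ℝ} (ht : 0 ≤ t) :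
    flow a (n + 1) t v = v + ∫ s in (0 : ℝ)..t, flow a (n + 1) s z := by
  apply incl_injective
  have hc : Continuous fun s => flow a (n + 1) s z :=
    (flow_stronglyCont ha (n + 1)).comp continuous_id continuous_const
  rw [incl_flow, flow_incl ha v ht, map_add, ← incl.intervalIntegral_comp_comm
    (hc.intervalIntegrable _ _)]
  simp only [incl_flow, hz]

/-- `φ` solves `φ' = (1 - x) φ_x - a φ + P ∫₀ˣ φ_even + N(φ)` at time `t`. -/
def SolvesAt (a P : ℝ) (b : ℕ → ℝ) (p n : ℕ) (φ : ℝ → Sob (n + 2)) (t : ℝ) : Prop :=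
  ∃ z, incl z = freeGen a (φ t) ∧
    HasDerivAt φ (z + incl (pot P (n + 2) (φ t) + nonlin b p (n + 1) (φ t))) t

/-- `duhamel_mild` moves the potential into the forcing, so that only the explicit free flow
remains. Potential and nonlinearity both take values one order above the phase space, and
`mild_integral_form` then writes φ as an integral of a continuous function. -/
theorem IsPert.solvesAt {a P : ℝ} (ha : 0 ≤ a) {b : ℕ → ℝ} {p n : ℕ}
    {S : ℝ → Sob (n + 2) →L[ℂ] Sob (n + 2)} (hS : IsPert a P (n + 2) S) {v z : Sob (n + 2)}
    (hz : incl z = freeGen a v) {φ : ℝ → Sob (n + 2)} (hc : Continuous φ)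
    (hφ : ∀ t, 0 ≤ t →
      φ t = S t v + ∫ s in (0 : ℝ)..t, S (t - s) (incl (nonlin b p (n + 1) (φ s)))) :
    φ 0 = v ∧ ∀ t, 0 < t → SolvesAt a P b p n φ t := by
  have hT := flow_stronglyCont ha (n + 2)
  set h : ℝ → Sob (n + 3) := fun s => pot P (n + 2) (φ s) + nonlin b p (n + 1) (φ s) with hh
  have hhc : Continuous h :=
    ((pot P (n + 2)).continuous.comp hc).add ((continuous_nonlin b p (n + 1)).comp hc)
  have hmild : ∀ t, 0 ≤ t →
      φ t = flow a (n + 2) t v + ∫ s in (0 : ℝ)..t, flow a (n + 2) (t - s) (incl (h s)) := by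
    intro t ht
    have := duhamel_mild hT hS.cont (potB P (n + 2)) hS.mild
      (incl.continuous.comp ((continuous_nonlin b p (n + 1)).comp hc)) v hφ ht
    rw [this]
    simp only [hh, map_add, potB_apply, Function.comp_apply]
    rfl
  set Z : ℝ → Sob (n + 2) := fun s => flow a (n + 2) s z +
    ∫ r in (0 : ℝ)..s, flow a (n + 2) (s - r) (freeGen a (h r)) with hZ
  have hfh : Continuous fun r => freeGen a (h r) := (freeGen a).continuous.comp hhc
  have hZc : Continuous Z := (hT.comp continuous_id continuous_const).add (hT.continuous_conv hfh)
  have hih : Continuous fun s => incl (h s) := incl.continuous.comp hhc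
  have hint : ∀ t, 0 ≤ t →
      φ t = v + (∫ s in (0 : ℝ)..t, Z s) + ∫ s in (0 : ℝ)..t, incl (h s) := by
    intro t ht
    rw [hmild t ht]
    exact mild_integral_form hT (j := incl) (A := freeGen a) (fun y t ht => flow_incl ha y ht)
      (fun t ht => flow_of_incl_eq ha hz ht) hhc ht
  refine ⟨by simpa using hint 0 le_rfl, fun t ht => ⟨Z t, ?_, ?_⟩⟩
  · rw [hmild t ht.le, hZ]
    simp only [map_add]
    have c1 : Continuous fun r => flow a (n + 2) (t - r) (freeGen a (h r)) :=
      hT.comp (continuous_const.sub continuous_id) hfh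
    have c2 : Continuous fun r => flow a (n + 2) (t - r) (incl (h r)) :=
      hT.comp (continuous_const.sub continuous_id) hih
    rw [← incl.intervalIntegral_comp_comm (c1.intervalIntegrable _ _),
      ← (freeGen a).intervalIntegral_comp_comm (c2.intervalIntegrable _ _)]
    simp only [incl_flow, freeGen_flow, hz, freeGen_incl]
  · have hd : HasDerivAt (fun t => v + (∫ s in (0 : ℝ)..t, Z s) + ∫ s in (0 : ℝ)..t, incl (h s))
        (Z t + incl (h t)) t :=
      ((hZc.integral_hasStrictDerivAt 0 t).hasDerivAt.const_add v).add
        (hih.integral_hasStrictDerivAt 0 t).hasDerivAt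
    refine hd.congr_of_eventuallyEq ?_
    filter_upwards [lt_mem_nhds ht] with s hs
    exact hint s hs.le

theorem exists_strong_solution {a P : ℝ} (ha : 0 ≤ a) (hP : P = (1 + a) * (2 + a)) (b : ℕ → ℝ)
    (p : ℕ) {n : ℕ} (hn : HasGrowth a P n 1) :
    ∃ ε > 0, ∀ u z : Sob (n + 2), incl z = freeGen a u → ‖u‖ ≤ ε →
      ∃ (α : ℂ) (φ : ℝ → Sob (n + 2)), Continuous φ ∧ φ 0 = u + α • growMode a n ∧
        (∀ t, 0 < t → SolvesAt a P b p n φ t) ∧ ∀ t, 0 ≤ t → ‖φ t‖ ≤ Real.exp (-t) := by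
  obtain ⟨S, C, l, hS, hC, hg, hd⟩ := exists_dichotomy ha hP hn
  obtain ⟨ε, hε, h⟩ := exists_decaying hS.cont hC l hg hd
    (F := fun w => incl (nonlin b p (n + 1) w))
    (incl.continuous.comp (continuous_nonlin b p (n + 1)))
    ((quadLip_nonlin b p (n + 1)).clm incl) (by rw [nonlin_zero, map_zero])
  refine ⟨ε, hε, fun u z hz hu => ?_⟩
  obtain ⟨α, φ, hc, hφ, hb⟩ := h u hu
  set y : Sob (n + 2) := cons (((-(a * (2 + a)) : ℝ) : ℂ), cons (((-(1 + a) ^ 2 : ℝ) : ℂ), 0))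
    with hy
  have hz' : incl (z + α • y) = freeGen a (u + α • growMode a n) := by
    rw [map_add, map_add, map_smul, map_smul, hz, hy, incl_eq_freeGen_growMode]
  obtain ⟨h0, hs⟩ := hS.solvesAt ha hz' hc hφ
  exact ⟨α, φ, hc, h0, hs, hb⟩

/-! ### Restriction to the unit interval -/

theorem ae_unit_of_ae_sym {q : ℝ → Prop} (h : ∀ᵐ x ∂symMeasure, q x) :
    (∀ᵐ x ∂unitMeasure, q x) ∧ ∀ᵐ x ∂unitMeasure, q (-x) := by
  rw [ae_restrict_iff' measurableSet_Ioo] at h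
  constructor <;> rw [ae_restrict_iff' measurableSet_Ioo]
  · filter_upwards [h] with x hx hx1
    exact hx ⟨by linarith [hx1.1], hx1.2⟩
  · filter_upwards [(Measure.measurePreserving_neg (volume : Measure ℝ)).quasiMeasurePreserving.ae h]
      with x hx hx1
    exact hx ⟨by linarith [hx1.2], by linarith [hx1.1]⟩

theorem ae_sym_of_ae_unit {q : ℝ → Prop} (h1 : ∀ᵐ x ∂unitMeasure, q x)
    (h2 : ∀ᵐ x ∂unitMeasure, q (-x)) : ∀ᵐ x ∂symMeasure, q x := by
  rw [ae_restrict_iff' measurableSet_Ioo] at h1 h2 ⊢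
  filter_upwards [h1, (Measure.measurePreserving_neg (volume : Measure ℝ)).quasiMeasurePreserving.ae
    h2, Measure.ae_ne volume (0 : ℝ)] with x a1 a2 a3 hx
  rcases lt_or_gt_of_ne a3 with h | h
  · simpa using a2 ⟨by linarith, by linarith [hx.1]⟩
  · exact a1 ⟨h, hx.2⟩

theorem exists_resP : ∃ A : L2s →L[ℂ] L2, ∀ f, A f =ᵐ[unitMeasure] fun x => f x := by
  obtain ⟨A, hA, -⟩ := exists_compLp (μ := unitMeasure) (ν := symMeasure)
    (φ := fun x => 0 + 1 * x) (by fun_prop) (map_affine_restrict_le one_ne_zero measurableSet_Ioo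
      fun x hx => by simp only [zero_add, one_mul]; exact ⟨by linarith [hx.1], hx.2⟩)
  exact ⟨A, fun f => by simpa using hA f⟩

theorem exists_resN : ∃ A : L2s →L[ℂ] L2, ∀ f, A f =ᵐ[unitMeasure] fun x => f (-x) := by
  obtain ⟨A, hA, -⟩ := exists_compLp (μ := unitMeasure) (ν := symMeasure)
    (φ := fun x => 0 + -1 * x) (by fun_prop) (map_affine_restrict_le refl_ne measurableSet_Ioo
      fun x hx => by
        simp only [zero_add, neg_mul, one_mul]
        exact ⟨by linarith [hx.2], by linarith [hx.1]⟩)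
  exact ⟨A, fun f => by simpa using hA f⟩

/-- Restriction of a function on `(-1,1)` to `(0,1)`. -/
def resP : L2s →L[ℂ] L2 := exists_resP.choose

/-- The function `x ↦ f (-x)` on `(0,1)`. -/
def resN : L2s →L[ℂ] L2 := exists_resN.choose

theorem resP_ae (f : L2s) : resP f =ᵐ[unitMeasure] fun x => f x := exists_resP.choose_spec f

theorem resN_ae (f : L2s) : resN f =ᵐ[unitMeasure] fun x => f (-x) := exists_resN.choose_spec f

theorem resP_cl (g : CI) : resP (cl g) =ᵐ[unitMeasure] xt g :=
  (resP_ae _).trans (ae_unit_of_ae_sym (cl_ae g)).1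

theorem resN_cl (g : CI) : resN (cl g) =ᵐ[unitMeasure] fun x => xt g (-x) :=
  (resN_ae _).trans (ae_unit_of_ae_sym (cl_ae g)).2

theorem res_injective {f g : L2s} (h1 : resP f = resP g) (h2 : resN f = resN g) : f = g := by
  apply Lp.ext
  refine ae_sym_of_ae_unit ?_ ?_
  · filter_upwards [resP_ae f, resP_ae g] with x a b
    rw [← a, ← b, h1]
  · filter_upwards [resN_ae f, resN_ae g] with x a b
    rw [← a, ← b, h2]

theorem exists_glue (u v : L2) : ∃ f : L2s, resP f = u ∧ resN f = v := by
  obtain ⟨A, hA, -⟩ := exists_compLp (μ := volume.restrict (Ioo (-1) 0)) (ν := unitMeasure)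
    (φ := fun x => 0 + -1 * x) (by fun_prop) (map_affine_restrict_le refl_ne measurableSet_Ioo
      fun x hx => by
        simp only [zero_add, neg_mul, one_mul]
        exact ⟨by linarith [hx.2], by linarith [hx.1]⟩)
  have m1 : MemLp ((Ioo (0 : ℝ) 1).indicator u) 2 symMeasure :=
    ((memLp_indicator_iff_restrict measurableSet_Ioo).2 (Lp.memLp u)).restrict _
  have m2 : MemLp ((Ioo (-1 : ℝ) 0).indicator (A v)) 2 symMeasure :=
    ((memLp_indicator_iff_restrict measurableSet_Ioo).2 (Lp.memLp (A v))).restrict _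
  have hAv : ∀ᵐ x ∂unitMeasure, A v (-x) = v x := by
    have h := hA v
    rw [Filter.EventuallyEq, ae_restrict_iff' measurableSet_Ioo] at h
    rw [ae_restrict_iff' measurableSet_Ioo]
    filter_upwards [(Measure.measurePreserving_neg (volume : Measure ℝ)).quasiMeasurePreserving.ae h]
      with x hx hx1
    simpa using hx ⟨by linarith [hx1.2], by linarith [hx1.1]⟩
  refine ⟨(m1.add m2).toLp _, ?_, ?_⟩ <;> apply Lp.ext
  · filter_upwards [resP_ae ((m1.add m2).toLp _), (ae_unit_of_ae_sym (m1.add m2).coeFn_toLp).1,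
      ae_mem_unit] with x a b hx
    rw [a, b, Pi.add_apply, indicator_of_mem hx,
      indicator_of_notMem (fun h => by linarith [h.2, hx.1]), add_zero]
  · filter_upwards [resN_ae ((m1.add m2).toLp _), (ae_unit_of_ae_sym (m1.add m2).coeFn_toLp).2,
      ae_mem_unit, hAv] with x a b hx c
    rw [a, b, Pi.add_apply, indicator_of_notMem (fun h => by linarith [h.1, hx.1]),
      indicator_of_mem (mem_Ioo.2 ⟨by linarith [hx.2], by linarith [hx.1]⟩), zero_add, c]

/-- The odd part and the even part, restricted to `(0,1)`. -/
def split : L2s →L[ℂ] H :=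
  ((WithLp.prodContinuousLinearEquiv 2 ℂ L2 L2).symm : L2 × L2 →L[ℂ] H).comp
    (((1 / 2 : ℂ) • (resP - resN)).prod ((1 / 2 : ℂ) • (resP + resN)))

theorem split_fst (f : L2s) : (split f).fst = (1 / 2 : ℂ) • (resP f - resN f) := rfl

theorem split_snd (f : L2s) : (split f).snd = (1 / 2 : ℂ) • (resP f + resN f) := rfl

theorem resP_eq (f : L2s) : resP f = (split f).fst + (split f).snd := by
  rw [split_fst, split_snd]
  module

theorem resN_eq (f : L2s) : resN f = (split f).snd - (split f).fst := by
  rw [split_fst, split_snd]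
  module

theorem split_injective : Function.Injective split := fun f g h =>
  res_injective (by rw [resP_eq, resP_eq, h]) (by rw [resN_eq, resN_eq, h])

theorem split_surjective : Function.Surjective split := by
  intro u
  obtain ⟨f, h1, h2⟩ := exists_glue (u.fst + u.snd) (u.snd - u.fst)
  refine ⟨f, WithLp.ofLp_injective 2 (Prod.ext ?_ ?_)⟩
  · change (split f).fst = u.fst
    rw [split_fst, h1, h2]
    module
  · change (split f).snd = u.snd
    rw [split_snd, h1, h2]
    module

/-- The open mapping theorem applied to the bijection `split`. -/
theorem exists_norm_le_split : ∃ C, 0 ≤ C ∧ ∀ f : L2s, ‖f‖ ≤ C * ‖split f‖ := by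
  let e := ContinuousLinearEquiv.ofBijective split (LinearMap.ker_eq_bot.2 split_injective)
    (LinearMap.range_eq_top.2 split_surjective)
  refine ⟨‖(e.symm : H →L[ℂ] L2s)‖, norm_nonneg _, fun f => ?_⟩
  have h := (e.symm : H →L[ℂ] L2s).le_opNorm (split f)
  have h2 : (e.symm : H →L[ℂ] L2s) (split f) = f := e.symm_apply_apply f
  rwa [h2] at h

/-! ### Weak derivatives -/

theorem continuous_pairing {ψ : ℝ → ℝ} (hc : Continuous ψ) (hs : HasCompactSupport ψ) :
    Continuous fun v : L2 => ∫ ρ, ψ ρ • v ρ ∂unitMeasure := by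
  have hm : MemLp (fun x => (ψ x : ℂ)) 2 unitMeasure := by
    obtain ⟨C, hC⟩ := hs.exists_bound_of_continuous hc
    exact MemLp.of_bound (by fun_prop) C (Filter.Eventually.of_forall fun x => by
      rw [Complex.norm_real]; exact hC x)
  have e : ∀ v : L2, ∫ ρ, ψ ρ • v ρ ∂unitMeasure = inner ℂ (hm.toLp _) v := by
    intro v
    rw [MeasureTheory.L2.inner_def]
    apply integral_congr_ae
    filter_upwards [hm.coeFn_toLp] with x hx
    rw [hx, RCLike.inner_apply, Complex.conj_ofReal, Complex.real_smul, mul_comm]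
  simp only [e]
  exact continuous_const.inner continuous_id

theorem isClosed_isWeakDeriv {α : Type*} [TopologicalSpace α] {F G : α → L2} (hF : Continuous F)
    (hG : Continuous G) : IsClosed {x | IsWeakDeriv (F x) (G x)} := by
  simp only [IsWeakDeriv, ofPred_forall]
  refine isClosed_iInter fun φ => isClosed_iInter fun h1 => isClosed_iInter fun h2 =>
    isClosed_iInter fun _ => isClosed_eq ?_ ?_
  · exact (continuous_pairing (h1.continuous_deriv (by simp)) h2.deriv).comp hF
  · exact ((continuous_pairing h1.continuous h2).comp hG).neg

theorem isWeakDeriv_of_hasDerivAt {v w : L2} {F G : ℝ → ℂ} (hv : v =ᵐ[unitMeasure] F)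
    (hw : w =ᵐ[unitMeasure] G) (hFG : ∀ x, HasDerivAt F (G x) x) (hG : Continuous G) :
    IsWeakDeriv v w := by
  intro φ hφ hs ht
  have hd : Continuous (deriv φ) := hφ.continuous_deriv (by simp)
  have hF : Continuous F := continuous_iff_continuousAt.2 fun x => (hFG x).continuousAt
  have z : ∀ x, x ∉ Ioo (0 : ℝ) 1 → φ x = 0 := fun x hx =>
    image_eq_zero_of_notMem_tsupport fun h => hx (ht h)
  have e1 : ∫ ρ, deriv φ ρ • v ρ ∂unitMeasure = ∫ ρ in (0 : ℝ)..1, deriv φ ρ • F ρ := by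
    rw [intervalIntegral.integral_of_le zero_le_one, integral_Ioc_eq_integral_Ioo]
    apply integral_congr_ae
    filter_upwards [hv] with x hx
    rw [hx]
  have e2 : ∫ ρ, φ ρ • w ρ ∂unitMeasure = ∫ ρ in (0 : ℝ)..1, φ ρ • G ρ := by
    rw [intervalIntegral.integral_of_le zero_le_one, integral_Ioc_eq_integral_Ioo]
    apply integral_congr_ae
    filter_upwards [hw] with x hx
    rw [hx]
  have c1 : Continuous fun x => deriv φ x • F x := hd.smul hF
  have c2 : Continuous fun x => φ x • G x := hφ.continuous.smul hG
  have key := intervalIntegral.integral_eq_sub_of_hasDerivAt (a := 0) (b := 1)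
    (f := fun x => φ x • F x) (f' := fun x => φ x • G x + deriv φ x • F x)
    (fun x _ => (hφ.differentiable (by simp) x).hasDerivAt.smul (hFG x))
    ((c2.add c1).intervalIntegrable _ _)
  rw [intervalIntegral.integral_add (c2.intervalIntegrable _ _) (c1.intervalIntegrable _ _),
    z 0 (by simp), z 1 (by simp), zero_smul, zero_smul, sub_zero] at key
  rw [e1, e2]
  exact eq_neg_of_add_eq_zero_right key

theorem prim0_cl_ae (c : ℂ) (g : CI) :
    cl (prim0 (c, cl g)) =ᵐ[symMeasure] fun x => c + ∫ s in (1 : ℝ)..x, xt g s := by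
  filter_upwards [cl_ae (prim0 (c, cl g)), ae_mem_sym] with x hx hm
  rw [hx, xt_prim0_cl _ _ (Ioo_subset_Icc_self hm)]

theorem isWeakDeriv_resP (c : ℂ) (f : L2s) : IsWeakDeriv (resP (cl (prim0 (c, f)))) (resP f) := by
  refine dense_cl.induction_on (p := fun f => IsWeakDeriv (resP (cl (prim0 (c, f)))) (resP f)) f
    (isClosed_isWeakDeriv (by fun_prop) (by fun_prop)) fun g => ?_
  exact isWeakDeriv_of_hasDerivAt ((resP_ae _).trans (ae_unit_of_ae_sym (prim0_cl_ae c g)).1)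
    (resP_cl g) (fun x => ((xt_continuous g).integral_hasStrictDerivAt 1 x).hasDerivAt.const_add c)
    (xt_continuous g)

theorem isWeakDeriv_resN (c : ℂ) (f : L2s) :
    IsWeakDeriv (resN (cl (prim0 (c, f)))) (-resN f) := by
  refine dense_cl.induction_on (p := fun f => IsWeakDeriv (resN (cl (prim0 (c, f)))) (-resN f)) f
    (isClosed_isWeakDeriv (by fun_prop) (by fun_prop)) fun g => ?_
  refine isWeakDeriv_of_hasDerivAt (G := fun x => -xt g (-x))
    ((resN_ae _).trans (ae_unit_of_ae_sym (prim0_cl_ae c g)).2) ?_ (fun x => ?_)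
    (((xt_continuous g).comp continuous_neg).neg)
  · filter_upwards [Lp.coeFn_neg (resN (cl g)), resN_cl g] with x h1 h2
    rw [h1, Pi.neg_apply, h2]
  · have h1 := ((xt_continuous g).integral_hasStrictDerivAt 1 (-x)).hasDerivAt.scomp x
      (hasDerivAt_neg x)
    exact (h1.const_add c).congr_deriv (by simp)

/-- A test function of mean zero is the derivative of a test function: its primitive from 0 vanishes
to the left of the support, and to the right of it because the total integral is zero. -/
theorem exists_test_primitive {χ : ℝ → ℝ} (hχ : ContDiff ℝ ∞ χ) (hs : HasCompactSupport χ)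
    (ht : tsupport χ ⊆ Ioo 0 1) (h0 : ∫ x in (0 : ℝ)..1, χ x = 0) :
    ∃ ψ : ℝ → ℝ, ContDiff ℝ ∞ ψ ∧ HasCompactSupport ψ ∧ tsupport ψ ⊆ Ioo 0 1 ∧ deriv ψ = χ := by
  set ψ : ℝ → ℝ := fun x => ∫ s in (0 : ℝ)..x, χ s with hψ
  have hd : ∀ x, HasDerivAt ψ (χ x) x := fun x =>
    (hχ.continuous.integral_hasStrictDerivAt 0 x).hasDerivAt
  have hderiv : deriv ψ = χ := funext fun x => (hd x).deriv
  obtain ⟨a, b, ha, hb, hab⟩ : ∃ a b : ℝ, 0 < a ∧ b < 1 ∧ tsupport χ ⊆ Icc a b := by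
    rcases (tsupport χ).eq_empty_or_nonempty with h | h
    -- For empty support the empty interval `Icc 1 0` serves.
    · exact ⟨1, 0, one_pos, zero_lt_one, by simp [h]⟩
    · obtain ⟨a, ha⟩ := hs.isCompact.exists_isLeast h
      obtain ⟨b, hb⟩ := hs.isCompact.exists_isGreatest h
      exact ⟨a, b, (ht ha.1).1, (ht hb.1).2, fun x hx => ⟨ha.2 hx, hb.2 hx⟩⟩
  have hz : ∀ x, x ∉ Icc a b → χ x = 0 := fun x hx =>
    image_eq_zero_of_notMem_tsupport fun h => hx (hab h)
  have hsupp : tsupport ψ ⊆ Icc a b := by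
    refine closure_minimal (fun x hx => ?_) isClosed_Icc
    by_contra hx'
    refine hx ?_
    rw [mem_Icc, not_and_or, not_le, not_le] at hx'
    rcases hx' with h | h
    · refine (intervalIntegral.integral_congr (g := fun _ => 0) fun s hs => hz s fun hs' => ?_).trans
        (by simp)
      have := hs.2
      rw [le_sup_iff] at this
      rcases this with h' | h' <;> linarith [hs'.1]
    · have e : ∫ s in x..1, χ s = 0 := by
        refine (intervalIntegral.integral_congr (g := fun _ => 0) fun s hs => hz s fun hs' => ?_).trans
          (by simp)
        have := hs.1
        rw [inf_le_iff] at this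
        rcases this with h' | h' <;> linarith [hs'.2]
      have := intervalIntegral.integral_add_adjacent_intervals (a := 0) (b := x) (c := 1)
        (hχ.continuous.intervalIntegrable _ _) (hχ.continuous.intervalIntegrable (μ := volume) _ _)
      rw [e, h0, add_zero] at this
      exact this
  refine ⟨ψ, ?_, HasCompactSupport.of_support_subset_isCompact isCompact_Icc
    ((subset_tsupport ψ).trans hsupp), fun x hx => ?_, hderiv⟩
  · rw [contDiff_infty_iff_deriv, hderiv]
    exact ⟨fun x => (hd x).differentiableAt, hχ⟩
  · exact ⟨ha.trans_le (hsupp hx).1, (hsupp hx).2.trans_lt hb⟩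

/-- A function on `(0,1)` with vanishing weak derivative is constant. -/
theorem ae_const_of_isWeakDeriv_zero {v : L2} (h : IsWeakDeriv v 0) :
    ∃ c : ℂ, v =ᵐ[unitMeasure] fun _ => c := by
  let η : ContDiffBump (1 / 2 : ℝ) := ⟨1 / 8, 1 / 4, by norm_num, by norm_num⟩
  set e : ℝ → ℝ := η.normed volume with he
  have he1 : ContDiff ℝ ∞ e := η.contDiff_normed
  have he2 : HasCompactSupport e := η.hasCompactSupport_normed
  have he3 : tsupport e ⊆ Ioo 0 1 := by
    rw [he, η.tsupport_normed_eq, Real.closedBall_eq_Icc]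
    intro x hx
    exact ⟨by linarith [hx.1, show η.rOut = 1 / 4 from rfl],
      by linarith [hx.2, show η.rOut = 1 / 4 from rfl]⟩
  have hint : ∀ φ : ℝ → ℝ, tsupport φ ⊆ Ioo 0 1 → ∫ x in (0 : ℝ)..1, φ x = ∫ x, φ x := by
    intro φ hφ
    exact intervalIntegral.integral_eq_integral_of_support_subset
      ((subset_tsupport φ).trans (hφ.trans Ioo_subset_Ioc_self))
  set c := ∫ ρ, e ρ • v ρ ∂unitMeasure with hc
  have hv : Integrable (v : ℝ → ℂ) unitMeasure := (Lp.memLp v).integrable (by norm_num)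
  refine ⟨c, ?_⟩
  have key := IsOpen.ae_eq_zero_of_integral_contDiff_smul_eq_zero (μ := unitMeasure)
    (f := fun x => v x - c) (U := Ioo 0 1) isOpen_Ioo
    ((hv.sub (integrable_const c)).integrableOn.locallyIntegrableOn) ?_
  · filter_upwards [key, ae_mem_unit] with x h1 h2
    exact sub_eq_zero.1 (h1 h2)
  intro φ hφ hs ht
  -- Subtracting m times the bump of integral one from φ leaves a test function of mean zero,
  -- against which v integrates to zero.
  set m := ∫ x in (0 : ℝ)..1, φ x with hm
  have hχs : HasCompactSupport (φ - fun x => m * e x) := hs.sub he2.mul_left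
  have hχt : tsupport (φ - fun x => m * e x) ⊆ Ioo 0 1 :=
    (tsupport_sub _ _).trans (union_subset ht ((tsupport_mul_subset_right).trans he3))
  obtain ⟨ψ, p1, p2, p3, p4⟩ := exists_test_primitive (χ := φ - fun x => m * e x)
    (hφ.sub (contDiff_const.mul he1)) hχs hχt (by
      have h1 : IntervalIntegrable (fun x => m * e x) volume 0 1 :=
        (continuous_const.mul he1.continuous).intervalIntegrable _ _
      have h2 := intervalIntegral.integral_sub (hφ.continuous.intervalIntegrable 0 1) h1
      refine h2.trans ?_
      rw [intervalIntegral.integral_const_mul, hint e he3, he, η.integral_normed, mul_one, hm,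
        sub_self])
  have h1 := h ψ p1 p2 p3
  have h0 : ∫ ρ, ψ ρ • (0 : L2) ρ ∂unitMeasure = 0 := by
    apply integral_eq_zero_of_ae
    filter_upwards [Lp.coeFn_zero ℂ 2 unitMeasure] with ρ hρ
    rw [hρ]; simp
  have i1 := test_integrable hφ.continuous hs v
  have i2 := test_integrable he1.continuous he2 v
  have i2' : Integrable (fun ρ => m • (e ρ • v ρ)) unitMeasure := i2.smul m
  have h2 : ∫ ρ, φ ρ • v ρ ∂unitMeasure = m • c := by
    rw [h0, neg_zero, p4] at h1
    have e1 : ∫ ρ, (φ - fun x => m * e x) ρ • v ρ ∂unitMeasure =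
        ∫ ρ, (φ ρ • v ρ - m • (e ρ • v ρ)) ∂unitMeasure := by
      congr 1
      ext ρ
      rw [Pi.sub_apply, sub_smul, mul_smul]
    rw [e1, integral_sub i1 i2', integral_smul] at h1
    exact sub_eq_zero.1 h1
  have h3 : ∫ ρ, φ ρ • c ∂unitMeasure = m • c := by
    rw [integral_smul_const, hm, intervalIntegral.integral_of_le zero_le_one,
      integral_Ioc_eq_integral_Ioo]
  have i3 : Integrable (fun ρ => φ ρ • c) unitMeasure :=
    ((hφ.continuous.integrable_of_hasCompactSupport hs).smul_const c).restrict
  simp only [smul_sub]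
  rw [integral_sub i1 i3, h2, h3, sub_self]

theorem eq_zero_of_vanishesAtZero_const {v : L2} {c : ℂ} (hv : VanishesAtZero v)
    (hc : v =ᵐ[unitMeasure] fun _ => c) : c = 0 := by
  obtain ⟨f, hf, hvf, h0⟩ := hv
  have h1 : EqOn f (fun _ => c) (Ioo 0 1) :=
    Measure.eqOn_open_of_ae_eq (hvf.symm.trans hc) isOpen_Ioo (hf.mono Ioo_subset_Icc_self)
      continuousOn_const
  have h2 : EqOn f (fun _ => c) (Icc 0 1) :=
    h1.of_subset_closure hf continuousOn_const Ioo_subset_Icc_self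
      (by rw [closure_Ioo (by norm_num)])
  rw [← h0]
  exact (h2 (by simp)).symm

/-! ### The identification of the model space with `H^{2k}` -/

/-- The derivatives of order `j ≤ n` of a function in `Hⁿ(-1,1)`. -/
def der : (n : ℕ) → ℕ → Sob n →L[ℂ] L2s
  | n, 0 => toL2 n
  | 0, _ + 1 => 0
  | n + 1, j + 1 => (der n j).comp tail

theorem der_zero (n : ℕ) (w : Sob n) : der n 0 w = toL2 n w := by
  cases n <;> rfl

theorem der_succ (n j : ℕ) (w : Sob (n + 1)) : der (n + 1) (j + 1) w = der n j (tail w) := rfl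

theorem der_self : ∀ (n : ℕ) (w : Sob n), der n n w = w.2
  | 0, _ => rfl
  | n + 1, w => by rw [der_succ, der_self n, tail_snd]

theorem exists_der_eq : ∀ (n j : ℕ) (w : Sob n), j < n →
    ∃ c, der n j w = cl (prim0 (c, der n (j + 1) w))
  | 0, _, _, h => absurd h (by omega)
  | n + 1, 0, w, _ => ⟨head w, by rw [der_zero, der_succ, der_zero, toL2_succ, ev_eq_prim0]⟩
  | n + 1, j + 1, w, h => by
    simp only [der_succ]
    exact exists_der_eq n j (tail w) (by omega)

/-- Continuity of g across 0 means that the two one-sided traces agree. Applied to every derivative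
below the top order, this produces all boundary conditions at 0. -/
theorem vanishesAtZero_res_sub (g : CI) : VanishesAtZero (resP (cl g) - resN (cl g)) := by
  refine ⟨fun x => xt g x - xt g (-x), ?_, ?_, by simp⟩
  · exact ((xt_continuous g).sub ((xt_continuous g).comp continuous_neg)).continuousOn
  · filter_upwards [Lp.coeFn_sub (resP (cl g)) (resN (cl g)), resP_cl g, resN_cl g] with x a b c
    rw [a, Pi.sub_apply, b, c]

/-- A j and B j stand for the right half and the reflected left half of the j-th derivative.
Reflection changes sign under differentiation, so the derivatives of the odd part are ½(A j - (-1)ʲ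
B j) and those of the even part ½(A j + (-1)ʲ B j). At the orders constrained in `sobolev` both
reduce to ½(A j - B j). -/
theorem mem_sobolev_of_chain {k : ℕ} {A B : ℕ → L2}
    (hA : ∀ j < 2 * k, IsWeakDeriv (A j) (A (j + 1)))
    (hB : ∀ j < 2 * k, IsWeakDeriv (B j) (-B (j + 1)))
    (hV : ∀ j < 2 * k, VanishesAtZero (A j - B j)) {x : WithLp 2 (H × H)}
    (h1 : x.fst.fst = (1 / 2 : ℂ) • (A 0 - B 0)) (h2 : x.fst.snd = (1 / 2 : ℂ) • (A 0 + B 0))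
    (h3 : x.snd.fst = (1 / 2 : ℂ) • (A (2 * k) - B (2 * k)))
    (h4 : x.snd.snd = (1 / 2 : ℂ) • (A (2 * k) + B (2 * k))) : x ∈ sobolev k := by
  have hchain : ∀ e : ℂ, IsWeakDerivChain (2 * k) fun j =>
      (1 / 2 : ℂ) • (A j + (e * (-1) ^ j) • B j) := by
    intro e j hj
    have h := ((hA j hj).add ((hB j hj).smul (e * (-1) ^ j))).smul (1 / 2)
    have h2 : (e * (-1) ^ j) • -B (j + 1) = (e * (-1) ^ (j + 1)) • B (j + 1) := by
      rw [pow_succ]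
      module
    rwa [h2] at h
  have hsq : ∀ i, ((-1 : ℂ)) ^ (2 * i) = 1 := fun i => by rw [pow_mul]; simp
  have hm : ∀ i, (1 / 2 : ℂ) • (A i + (-1 * 1 : ℂ) • B i) = (1 / 2 : ℂ) • (A i - B i) := fun i => by
    module
  have hp : ∀ i, (1 / 2 : ℂ) • (A i + (1 * 1 : ℂ) • B i) = (1 / 2 : ℂ) • (A i + B i) := fun i => by
    module
  refine ⟨fun j => (1 / 2 : ℂ) • (A j + (-1 * (-1) ^ j) • B j),
    fun j => (1 / 2 : ℂ) • (A j + (1 * (-1) ^ j) • B j),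
    ?_, ?_, ?_, ?_, hchain _, hchain _, fun j hj => ⟨?_, ?_⟩⟩
  · beta_reduce
    rw [h1, pow_zero, hm]
  · beta_reduce
    rw [h2, pow_zero, hp]
  · beta_reduce
    rw [h3, hsq, hm]
  · beta_reduce
    rw [h4, hsq, hp]
  · beta_reduce
    rw [hsq, hm]
    exact (hV (2 * j) (by omega)).smul (1 / 2)
  · have h := (hV (2 * j + 1) (by omega)).smul (1 / 2)
    rw [← hm] at h
    have e : (1 * (-1) ^ (2 * j + 1) : ℂ) = -1 * 1 := by rw [pow_succ, hsq]; ring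
    beta_reduce
    rwa [e]

theorem split_mem_sobolev {k n : ℕ} (hn : n = 2 * k) (w : Sob n) :
    WithLp.toLp 2 (split (toL2 n w), split w.2) ∈ sobolev k := by
  subst hn
  refine mem_sobolev_of_chain (A := fun j => resP (der (2 * k) j w))
    (B := fun j => resN (der (2 * k) j w)) ?_ ?_ ?_ ?_ ?_ ?_ ?_
  · intro j hj
    obtain ⟨c, hc⟩ := exists_der_eq _ j w hj
    simp only [hc]
    exact isWeakDeriv_resP c _
  · intro j hj
    obtain ⟨c, hc⟩ := exists_der_eq _ j w hj
    simp only [hc]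
    exact isWeakDeriv_resN c _
  · intro j hj
    obtain ⟨c, hc⟩ := exists_der_eq _ j w hj
    simp only [hc]
    exact vanishesAtZero_res_sub _
  · simp only [der_zero]
    exact split_fst _
  · simp only [der_zero]
    exact split_snd _
  · simp only [der_self]
    exact split_fst _
  · simp only [der_self]
    exact split_snd _

/-- Converse of the preceding construction. The derivative is glued by induction; its primitive
matches each half up to a constant, since the differences have zero weak derivative, and the
vanishing of u 0 - v 0 at 0 forces the two constants to agree. -/
theorem exists_glue_chain : ∀ (n : ℕ) (u v : ℕ → L2),
    (∀ j < n, IsWeakDeriv (u j) (u (j + 1))) → (∀ j < n, IsWeakDeriv (v j) (-v (j + 1))) →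
    (∀ j < n, VanishesAtZero (u j - v j)) →
    ∃ w : Sob n, resP (toL2 n w) = u 0 ∧ resN (toL2 n w) = v 0 ∧
      resP w.2 = u n ∧ resN w.2 = v n
  | 0, u, v, _, _, _ => by
    obtain ⟨f, h1, h2⟩ := exists_glue (u 0) (v 0)
    exact ⟨(0, f), h1, h2, h1, h2⟩
  | n + 1, u, v, hu, hv, hV => by
    obtain ⟨w, h1, h2, h3, h4⟩ := exists_glue_chain n (fun j => u (j + 1)) (fun j => v (j + 1))
      (fun j hj => hu (j + 1) (by omega)) (fun j hj => hv (j + 1) (by omega))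
      (fun j hj => hV (j + 1) (by omega))
    simp only [zero_add] at h1 h2
    set f := toL2 n w with hf
    set F := cl (prim0 (0, f)) with hF
    have d1 : IsWeakDeriv (u 0 + (-1 : ℂ) • resP F) 0 := by
      have h := (hu 0 (by omega)).add ((isWeakDeriv_resP 0 f).smul (-1))
      rw [h1, zero_add] at h
      convert h using 1
      module
    have d2 : IsWeakDeriv (v 0 + (-1 : ℂ) • resN F) 0 := by
      have h := (hv 0 (by omega)).add ((isWeakDeriv_resN 0 f).smul (-1))
      rw [h2, zero_add] at h
      convert h using 1
      module
    obtain ⟨c, hc⟩ := ae_const_of_isWeakDeriv_zero d1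
    obtain ⟨d, hd⟩ := ae_const_of_isWeakDeriv_zero d2
    have hcd : c - d = 0 := by
      have hvan := (hV 0 (by omega)).add ((vanishesAtZero_res_sub (prim0 (0, f))).smul (-1))
      refine eq_zero_of_vanishesAtZero_const hvan ?_
      have e : u 0 - v 0 + (-1 : ℂ) • (resP (cl (prim0 (0, f))) - resN (cl (prim0 (0, f)))) =
          (u 0 + (-1 : ℂ) • resP F) - (v 0 + (-1 : ℂ) • resN F) := by
        rw [hF]
        module
      rw [e]
      filter_upwards [Lp.coeFn_sub (u 0 + (-1 : ℂ) • resP F) (v 0 + (-1 : ℂ) • resN F), hc, hd]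
        with x a1 a2 a3
      rw [a1, Pi.sub_apply, a2, a3]
    rw [sub_eq_zero] at hcd
    subst hcd
    have hw : toL2 (n + 1) (cons (c, w)) = cl (constCI c) + F := by
      rw [toL2_succ, ev_cons, prim0_apply, hF, prim0_apply, map_zero, zero_add, map_add]
    have hsnd : (cons (c, w)).2 = w.2 := by rw [← tail_snd, tail_cons]
    have eP : resP (cl (constCI c)) = u 0 + (-1 : ℂ) • resP F := by
      apply Lp.ext
      filter_upwards [resP_cl (constCI c), hc] with x a b
      rw [a, b, xt_constCI]
    have eN : resN (cl (constCI c)) = v 0 + (-1 : ℂ) • resN F := by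
      apply Lp.ext
      filter_upwards [resN_cl (constCI c), hd] with x a b
      rw [a, b, xt_constCI]
    refine ⟨cons (c, w), ?_, ?_, by rw [hsnd, h3], by rw [hsnd, h4]⟩
    · rw [hw, map_add, eP]
      module
    · rw [hw, map_add, eN]
      module

/-- Intermediate derivatives are controlled by the lowest and the highest. For a given top
derivative only a finite-dimensional Taylor polynomial is free, and an injective linear map on a
finite-dimensional space is bounded below. -/
theorem exists_norm_le (n : ℕ) : ∃ C, 0 ≤ C ∧ ∀ w : Sob n, ‖w‖ ≤ C * (‖toL2 n w‖ + ‖w.2‖) := by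
  let L : (Fin n → ℂ) →L[ℂ] L2s := (toL2 n).comp (ContinuousLinearMap.inl ℂ (Fin n → ℂ) L2s)
  let R : L2s →L[ℂ] L2s := (toL2 n).comp (ContinuousLinearMap.inr ℂ (Fin n → ℂ) L2s)
  have hL : LinearMap.ker L.toLinearMap = ⊥ := by
    rw [LinearMap.ker_eq_bot]
    intro c d h
    exact congrArg Prod.fst (toL2_injective n h)
  obtain ⟨K, -, hK⟩ := LinearMap.exists_antilipschitzWith L.toLinearMap hL
  refine ⟨K * (1 + ‖R‖) + 1, by positivity, fun w => ?_⟩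
  have e : toL2 n w = L w.1 + R w.2 := by
    change _ = toL2 n (w.1, 0) + toL2 n (0, w.2)
    rw [← map_add]
    simp
  have h1 : ‖w.1‖ ≤ K * ‖L w.1‖ := by
    have := hK.le_mul_dist w.1 0
    simpa using this
  have h2 : ‖L w.1‖ ≤ ‖toL2 n w‖ + ‖R‖ * ‖w.2‖ := by
    have : L w.1 = toL2 n w - R w.2 := by rw [e]; abel
    rw [this]
    exact (norm_sub_le _ _).trans (add_le_add le_rfl (R.le_opNorm _))
  have hK0 : (0 : ℝ) ≤ K := K.2
  have hR : 0 ≤ ‖R‖ := norm_nonneg _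
  have ha : 0 ≤ ‖toL2 n w‖ := norm_nonneg _
  have hb : 0 ≤ ‖w.2‖ := norm_nonneg _
  have h3 : ‖w.1‖ ≤ K * (1 + ‖R‖) * (‖toL2 n w‖ + ‖w.2‖) := by
    refine h1.trans ((mul_le_mul_of_nonneg_left h2 hK0).trans ?_)
    rw [mul_assoc]
    refine mul_le_mul_of_nonneg_left ?_ hK0
    nlinarith
  rw [Prod.norm_def]
  have h4 : 0 ≤ K * (1 + ‖R‖) * (‖toL2 n w‖ + ‖w.2‖) := by positivity
  refine max_le ?_ ?_ <;> linarith

/-- Gluing gives surjectivity, and `exists_norm_le` bounds the inverse. Only equivalence of the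
norms holds, which suffices as constants are free in the theorem. -/
theorem exists_equiv {k n : ℕ} (hn : n = 2 * k) :
    ∃ J : Sob n ≃L[ℂ] H2k k, ∀ w, toH (J w) = split (toL2 n w) := by
  let J₀ : Sob n →L[ℂ] WithLp 2 (H × H) :=
    ((WithLp.prodContinuousLinearEquiv 2 ℂ H H).symm : H × H →L[ℂ] WithLp 2 (H × H)).comp
      ((split.comp (toL2 n)).prod (split.comp (ContinuousLinearMap.snd ℂ (Fin n → ℂ) L2s)))
  let J₁ : Sob n →L[ℂ] H2k k := J₀.codRestrict (sobolev k) fun w => split_mem_sobolev hn w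
  have hJ : ∀ w, (J₁ w : WithLp 2 (H × H)) = WithLp.toLp 2 (split (toL2 n w), split w.2) :=
    fun _ => rfl
  have hinj : Function.Injective J₁ := by
    intro v w h
    have h1 : split (toL2 n v) = split (toL2 n w) := congrArg toH h
    exact toL2_injective n (split_injective h1)
  have hsurj : Function.Surjective J₁ := by
    rintro ⟨x, d₁, d₂, a1, a2, a3, a4, a5, a6, a7⟩
    rw [← hn] at a3 a4 a5 a6
    obtain ⟨w, h1, h2, h3, h4⟩ := exists_glue_chain n (fun j => d₁ j + d₂ j)
      (fun j => ((-1 : ℂ) ^ j) • (d₂ j + (-1 : ℂ) • d₁ j)) (fun j hj => (a5 j hj).add (a6 j hj))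
      (fun j hj => by
        have h := ((a6 j hj).add ((a5 j hj).smul (-1))).smul ((-1) ^ j)
        convert h using 1
        rw [pow_succ]
        module)
      (fun j hj => by
        rcases Nat.even_or_odd' j with ⟨i, rfl | rfl⟩
        · have h := (a7 i (by omega)).1.smul 2
          have e : ((-1 : ℂ)) ^ (2 * i) = 1 := by rw [pow_mul]; simp
          rw [e]
          convert h using 1
          module
        · have h := (a7 i (by omega)).2.smul 2
          have e : ((-1 : ℂ)) ^ (2 * i + 1) = -1 := by rw [pow_succ, pow_mul]; simp
          rw [e]
          convert h using 1
          module)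
    have e : ((-1 : ℂ)) ^ n = 1 := by rw [hn, pow_mul]; simp
    simp only [pow_zero, one_smul, e] at h1 h2 h3 h4
    refine ⟨w, Subtype.ext ?_⟩
    rw [hJ]
    refine WithLp.ofLp_injective 2 (Prod.ext (WithLp.ofLp_injective 2 (Prod.ext ?_ ?_))
      (WithLp.ofLp_injective 2 (Prod.ext ?_ ?_)))
    · change (split (toL2 n w)).fst = x.fst.fst
      rw [split_fst, h1, h2, ← a1]
      module
    · change (split (toL2 n w)).snd = x.fst.snd
      rw [split_snd, h1, h2, ← a2]
      module
    · change (split w.2).fst = x.snd.fst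
      rw [split_fst, h3, h4, ← a3]
      module
    · change (split w.2).snd = x.snd.snd
      rw [split_snd, h3, h4, ← a4]
      module
  obtain ⟨C, hC, hCb⟩ := exists_norm_le n
  obtain ⟨D, hD, hDb⟩ := exists_norm_le_split
  have hlow : ∀ w, ‖w‖ ≤ C * (D + D) * ‖J₁ w‖ := by
    intro w
    have n1 : ‖split (toL2 n w)‖ ≤ ‖J₁ w‖ := by
      rw [← Submodule.norm_coe, hJ]
      exact WithLp.norm_fst_le H (WithLp.toLp 2 (split (toL2 n w), split w.2))
    have n2 : ‖split w.2‖ ≤ ‖J₁ w‖ := by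
      rw [← Submodule.norm_coe, hJ]
      exact WithLp.norm_snd_le H (WithLp.toLp 2 (split (toL2 n w), split w.2))
    calc ‖w‖ ≤ C * (‖toL2 n w‖ + ‖w.2‖) := hCb w
      _ ≤ C * (D * ‖J₁ w‖ + D * ‖J₁ w‖) := by
          gcongr
          · exact (hDb _).trans (mul_le_mul_of_nonneg_left n1 hD)
          · exact (hDb _).trans (mul_le_mul_of_nonneg_left n2 hD)
      _ = _ := by ring
  let E := LinearEquiv.ofBijective J₁.toLinearMap ⟨hinj, hsurj⟩
  refine ⟨E.toContinuousLinearEquivOfBounds ‖J₁‖ (C * (D + D)) (fun w => J₁.le_opNorm w)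
    (fun x => ?_), fun w => rfl⟩
  have h := hlow (E.symm x)
  have h2 : J₁ (E.symm x) = x := E.apply_symm_apply x
  rwa [h2] at h

/-! ### The generator and the nonlinearity on the model space -/

theorem xt_ev_evenP {n : ℕ} (w : Sob (n + 1)) {x : ℝ} (hx : x ∈ Icc (-1 : ℝ) 1) :
    xt (ev n (evenP (n + 1) w)) x = (1 / 2 : ℂ) * (xt (ev n w) x + xt (ev n w) (-x)) := by
  rw [evenP_apply, map_smul, map_add, ev_refl, xt_smul, xt_add, xt_reflCI _ hx]

theorem integral_evenP {n : ℕ} (w : Sob (n + 1)) :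
    ∫ s in (0 : ℝ)..1, xt (ev n (evenP (n + 1) w)) s = (1 / 2 : ℂ) * integ (n + 1) w := by
  have hc := xt_continuous (ev n w)
  have e1 : ∫ s in (0 : ℝ)..1, xt (ev n (evenP (n + 1) w)) s =
      ∫ s in (0 : ℝ)..1, (1 / 2 : ℂ) * (xt (ev n w) s + xt (ev n w) (-s)) := by
    refine intervalIntegral.integral_congr fun s hs => ?_
    rw [uIcc_of_le zero_le_one] at hs
    exact xt_ev_evenP w ⟨by linarith [hs.1], hs.2⟩
  have hcn : Continuous fun s => xt (ev n w) (-s) := hc.comp continuous_neg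
  rw [e1, intervalIntegral.integral_const_mul, intervalIntegral.integral_add
    (hc.intervalIntegrable _ _) (hcn.intervalIntegrable _ _),
    intervalIntegral.integral_comp_neg (fun s => xt (ev n w) s), neg_zero, integ_eq,
    intervalIntegral.integral_symm (-1 : ℝ) 1, add_comm,
    intervalIntegral.integral_add_adjacent_intervals (hc.intervalIntegrable _ _)
      (hc.intervalIntegrable _ _)]
  ring

/-- The constant in `pot`, half the integral of w over (-1,1), equals ∫₀¹ w_even; it moves the base
point of the primitive from 1 to 0. -/
theorem xt_ev_pot (P : ℝ) {n : ℕ} (w : Sob (n + 1)) {x : ℝ} (hx : x ∈ Icc (-1 : ℝ) 1) :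
    xt (ev (n + 1) (pot P (n + 1) w)) x = P * ∫ s in (0 : ℝ)..x, xt (ev n (evenP (n + 1) w)) s := by
  have hc := xt_continuous (ev n (evenP (n + 1) w))
  rw [xt_ev_succ _ hx, head_pot, tail_pot, ← integral_evenP, map_smul]
  simp only [xt_smul]
  rw [intervalIntegral.integral_const_mul, ← mul_add,
    intervalIntegral.integral_add_adjacent_intervals (hc.intervalIntegrable _ _)
      (hc.intervalIntegrable _ _)]

theorem contDiff_one_of_hasDerivAt {F G : ℝ → ℂ} (h : ∀ x, HasDerivAt F (G x) x)
    (hG : Continuous G) : ContDiff ℝ 1 F := by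
  rw [contDiff_one_iff_deriv]
  refine ⟨fun x => (h x).differentiableAt, ?_⟩
  rwa [show deriv F = G from funext fun x => (h x).deriv]

/-- The generator acts on the model space by `w ↦ (1 - x) w' + P ∫₀ˣ w_even`. -/
theorem split_mem_graph (p : ℕ) {n : ℕ} (w : Sob (n + 2)) :
    (split (toL2 (n + 2) w), split (mulL2 oneSub (toL2 (n + 1) (tail w)) +
      toL2 (n + 3) (pot (p * c0 p) (n + 2) w))) ∈ (gen p).graph := by
  refine LinearPMap.le_graph_of_le (preGen p).le_closure ?_
  rw [preGen_graph]
  set g := ev n (tail w) with hg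
  have hgc := xt_continuous g
  -- With two derivatives available W is C¹ on the whole line, so its odd and even parts are
  -- admissible representatives already for the operator before closure.
  set W : ℝ → ℂ := fun x => head w + ∫ s in (1 : ℝ)..x, xt g s with hW
  have hWd : ∀ x, HasDerivAt W (xt g x) x := fun x =>
    (hgc.integral_hasStrictDerivAt 1 x).hasDerivAt.const_add _
  have hWn : ∀ x, HasDerivAt (fun x => W (-x)) (-xt g (-x)) x := fun x =>
    ((hWd (-x)).scomp x (hasDerivAt_neg x)).congr_deriv (by simp)
  have hWe : ∀ x ∈ Icc (-1 : ℝ) 1, xt (ev (n + 1) w) x = W x := fun x hx => xt_ev_succ w hx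
  have hPW : resP (toL2 (n + 2) w) =ᵐ[unitMeasure] W := by
    filter_upwards [resP_cl (ev (n + 1) w), ae_mem_unit] with x hx hm
    rw [toL2_succ, hx, hWe x ⟨by linarith [hm.1], hm.2.le⟩]
  have hNW : resN (toL2 (n + 2) w) =ᵐ[unitMeasure] fun x => W (-x) := by
    filter_upwards [resN_cl (ev (n + 1) w), ae_mem_unit] with x hx hm
    rw [toL2_succ, hx, hWe (-x) ⟨by linarith [hm.2], by linarith [hm.1]⟩]
  set f₁ : ℝ → ℂ := fun x => (1 / 2 : ℂ) * (W x - W (-x)) with hf₁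
  set f₂ : ℝ → ℂ := fun x => (1 / 2 : ℂ) * (W x + W (-x)) with hf₂
  have d₁ : ∀ x, HasDerivAt f₁ ((1 / 2 : ℂ) * (xt g x - -xt g (-x))) x := fun x =>
    ((hWd x).sub (hWn x)).const_mul _
  have d₂ : ∀ x, HasDerivAt f₂ ((1 / 2 : ℂ) * (xt g x + -xt g (-x))) x := fun x =>
    ((hWd x).add (hWn x)).const_mul _
  have hgn : Continuous fun x => xt g (-x) := hgc.comp continuous_neg
  have hmul : mulL2 oneSub (toL2 (n + 1) (tail w)) + toL2 (n + 3) (pot (p * c0 p) (n + 2) w) =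
      cl (oneSub * g + ev (n + 2) (pot (p * c0 p) (n + 2) w)) := by
    rw [toL2_succ, toL2_succ, mulL2_cl, map_add]
  rw [hmul]
  set h := oneSub * g + ev (n + 2) (pot (p * c0 p) (n + 2) w) with hh
  have hint : ∀ x ∈ Icc (-1 : ℝ) 1,
      ∫ s in (0 : ℝ)..x, xt (ev (n + 1) (evenP (n + 2) w)) s = ∫ s in (0 : ℝ)..x, f₂ s := by
    intro x hx
    refine intervalIntegral.integral_congr fun s hs => ?_
    have hs' : s ∈ Icc (-1 : ℝ) 1 := by
      have := uIcc_subset_Icc (a₂ := (-1 : ℝ)) (b₂ := 1) (by norm_num) hx hs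
      exact this
    rw [xt_ev_evenP w hs', hWe s hs', hWe (-s) (neg_mem_sym hs')]
  have hval : ∀ x ∈ Icc (-1 : ℝ) 1,
      xt h x = (1 - x) * xt g x + ((p * c0 p : ℝ) : ℂ) * ∫ s in (0 : ℝ)..x, f₂ s := by
    intro x hx
    rw [hh, xt_add, xt_mul, xt_oneSub hx, xt_ev_pot _ _ hx, hint x hx]
  have hodd : ∀ x, ∫ s in (0 : ℝ)..(-x), f₂ s = -∫ s in (0 : ℝ)..x, f₂ s := by
    intro x
    have h1 := intervalIntegral.integral_comp_neg (a := 0) (b := x) f₂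
    have h2 : (fun s => f₂ (-s)) = f₂ := by
      ext s
      simp only [hf₂, neg_neg]
      ring
    simp only [h2, neg_zero] at h1
    rw [h1, intervalIntegral.integral_symm]
  refine ⟨f₁, f₂, ⟨(contDiff_one_of_hasDerivAt d₁ (by fun_prop)).contDiffOn,
    (contDiff_one_of_hasDerivAt d₂ (by fun_prop)).contDiffOn, by simp [hf₁], ?_, ?_⟩, ?_, ?_⟩
  · change (split (toL2 (n + 2) w)).fst =ᵐ[unitMeasure] f₁
    rw [split_fst]
    filter_upwards [Lp.coeFn_smul (1 / 2 : ℂ) (resP (toL2 (n + 2) w) - resN (toL2 (n + 2) w)),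
      Lp.coeFn_sub (resP (toL2 (n + 2) w)) (resN (toL2 (n + 2) w)), hPW, hNW] with x a b c d
    rw [a, Pi.smul_apply, b, Pi.sub_apply, c, d, smul_eq_mul]
  · change (split (toL2 (n + 2) w)).snd =ᵐ[unitMeasure] f₂
    rw [split_snd]
    filter_upwards [Lp.coeFn_smul (1 / 2 : ℂ) (resP (toL2 (n + 2) w) + resN (toL2 (n + 2) w)),
      Lp.coeFn_add (resP (toL2 (n + 2) w)) (resN (toL2 (n + 2) w)), hPW, hNW] with x a b c d
    rw [a, Pi.smul_apply, b, Pi.add_apply, c, d, smul_eq_mul]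
  · change (split (cl h)).fst =ᵐ[unitMeasure] _
    rw [split_fst]
    filter_upwards [Lp.coeFn_smul (1 / 2 : ℂ) (resP (cl h) - resN (cl h)),
      Lp.coeFn_sub (resP (cl h)) (resN (cl h)), resP_cl h, resN_cl h, ae_mem_unit]
      with x a b c d hm
    have hx : x ∈ Icc (-1 : ℝ) 1 := ⟨by linarith [hm.1], hm.2.le⟩
    rw [a, Pi.smul_apply, b, Pi.sub_apply, c, d, smul_eq_mul, hval x hx, hval (-x) (neg_mem_sym hx),
      hodd, genFst, (d₁ x).deriv, (d₂ x).deriv]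
    push_cast
    ring
  · change (split (cl h)).snd =ᵐ[unitMeasure] _
    rw [split_snd]
    filter_upwards [Lp.coeFn_smul (1 / 2 : ℂ) (resP (cl h) + resN (cl h)),
      Lp.coeFn_add (resP (cl h)) (resN (cl h)), resP_cl h, resN_cl h, ae_mem_unit]
      with x a b c d hm
    have hx : x ∈ Icc (-1 : ℝ) 1 := ⟨by linarith [hm.1], hm.2.le⟩
    rw [a, Pi.smul_apply, b, Pi.add_apply, c, d, smul_eq_mul, hval x hx, hval (-x) (neg_mem_sym hx),
      hodd, genSnd, (d₁ x).deriv, (d₂ x).deriv]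
    push_cast
    ring

/-- The coefficients of the nonlinearity. -/
def coeffN (p j : ℕ) : ℝ := p.choose j * c0 p ^ (((p : ℝ) - j) / (p - 1))

theorem xt_avC_even {n : ℕ} (w : Sob (n + 1)) {x : ℝ} (hx : x ∈ Icc (-1 : ℝ) 1) (h0 : x ≠ 0) :
    xt (avC 0 (ev n (evenP (n + 1) w))) (-x) = xt (avC 0 (ev n (evenP (n + 1) w))) x := by
  set g := ev n (evenP (n + 1) w) with hg
  have h1 := mul_xt_avC g hx
  have h2 := mul_xt_avC g (neg_mem_sym hx)
  have h3 : ∫ s in (0 : ℝ)..(-x), xt g s = -∫ s in (0 : ℝ)..x, xt g s := by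
    have h4 := intervalIntegral.integral_comp_neg (a := 0) (b := x) (xt g)
    rw [neg_zero] at h4
    rw [intervalIntegral.integral_symm, ← h4]
    congr 1
    refine intervalIntegral.integral_congr fun s hs => ?_
    have hs' : s ∈ Icc (-1 : ℝ) 1 := uIcc_subset_Icc (a₂ := (-1 : ℝ)) (b₂ := 1) (by norm_num) hx hs
    rw [hg, xt_ev_evenP w hs', xt_ev_evenP w (neg_mem_sym hs'), neg_neg, add_comm]
  have hx0 : (x : ℂ) ≠ 0 := by exact_mod_cast h0
  rw [h3, ← h1] at h2
  push_cast at h2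
  rw [neg_mul, neg_inj] at h2
  exact mul_left_cancel₀ hx0 h2

/-- The average of an even function is even, so x times its powers is odd; the nonlinearity thus
falls entirely into the first component. -/
theorem isNonlinearity_split (p : ℕ) {n : ℕ} (w : Sob (n + 1)) :
    IsNonlinearity p (split (toL2 (n + 1) w))
      (split (toL2 (n + 2) (nonlin (coeffN p) p n w))) := by
  set h := ev (n + 1) (nonlin (coeffN p) p n w) with hh
  set A := avC 0 (ev n (evenP (n + 1) w)) with hA
  have hneg : ∀ x ∈ Ioo (0 : ℝ) 1, xt h (-x) = -xt h x := by
    intro x hx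
    have hx' : x ∈ Icc (-1 : ℝ) 1 := ⟨by linarith [hx.1], hx.2.le⟩
    rw [hh, xt_ev_nonlin _ _ _ _ hx', xt_ev_nonlin _ _ _ _ (neg_mem_sym hx'),
      xt_avC_even w hx' hx.1.ne', ← Finset.sum_neg_distrib]
    refine Finset.sum_congr rfl fun j _ => ?_
    push_cast
    ring
  have hsnd : (split (toL2 (n + 1) w)).snd =ᵐ[unitMeasure] xt (ev n (evenP (n + 1) w)) := by
    rw [split_snd, toL2_succ]
    filter_upwards [Lp.coeFn_smul (1 / 2 : ℂ) (resP (cl (ev n w)) + resN (cl (ev n w))),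
      Lp.coeFn_add (resP (cl (ev n w))) (resN (cl (ev n w))), resP_cl (ev n w), resN_cl (ev n w),
      ae_mem_unit] with x a b c d hm
    rw [a, Pi.smul_apply, b, Pi.add_apply, c, d, smul_eq_mul,
      xt_ev_evenP w ⟨by linarith [hm.1], hm.2.le⟩]
  have hprim : ∀ x ∈ Ioo (0 : ℝ) 1,
      (1 / (x : ℂ)) * ∫ ξ in (0 : ℝ)..x, (split (toL2 (n + 1) w)).snd ξ = xt A x := by
    intro x hx
    have hx0 : (x : ℂ) ≠ 0 := by exact_mod_cast hx.1.ne'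
    have e : ∫ ξ in (0 : ℝ)..x, (split (toL2 (n + 1) w)).snd ξ =
        ∫ ξ in (0 : ℝ)..x, xt (ev n (evenP (n + 1) w)) ξ := by
      rw [intervalIntegral.integral_of_le hx.1.le, intervalIntegral.integral_of_le hx.1.le]
      refine integral_congr_ae ?_
      rw [Filter.EventuallyEq, ae_restrict_iff' measurableSet_Ioo] at hsnd
      rw [Filter.EventuallyEq, ae_restrict_iff' measurableSet_Ioc]
      filter_upwards [hsnd] with s hs hs'
      exact hs ⟨hs'.1, hs'.2.trans_lt hx.2⟩
    rw [e, ← mul_xt_avC _ ⟨by linarith [hx.1], hx.2.le⟩]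
    field_simp
    rfl
  rw [toL2_succ (nonlin (coeffN p) p n w)]
  refine ⟨?_, ?_⟩
  · rw [split_fst]
    filter_upwards [Lp.coeFn_smul (1 / 2 : ℂ) (resP (cl h) - resN (cl h)),
      Lp.coeFn_sub (resP (cl h)) (resN (cl h)), resP_cl h, resN_cl h, ae_mem_unit]
      with x a b c d hm
    rw [a, Pi.smul_apply, b, Pi.sub_apply, c, d, smul_eq_mul, hneg x hm, hprim x hm, hh,
      xt_ev_nonlin _ _ _ _ ⟨by linarith [hm.1], hm.2.le⟩]
    simp only [coeffN]
    ring
  · rw [split_snd]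
    apply Lp.ext
    filter_upwards [Lp.coeFn_smul (1 / 2 : ℂ) (resP (cl h) + resN (cl h)),
      Lp.coeFn_add (resP (cl h)) (resN (cl h)), resP_cl h, resN_cl h, ae_mem_unit,
      Lp.coeFn_zero ℂ 2 unitMeasure] with x a b c d hm z
    rw [a, Pi.smul_apply, b, Pi.add_apply, c, d, smul_eq_mul, hneg x hm, z]
    simp

theorem IsNonlinearity.eq {p : ℕ} {u v w : H} (hv : IsNonlinearity p u v)
    (hw : IsNonlinearity p u w) : v = w :=
  WithLp.ofLp_injective 2 (Prod.ext (Lp.ext (hv.1.trans hw.1.symm)) (hv.2.trans hw.2.symm))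

/-! ### Uniqueness by an energy estimate -/

theorem re_inner_eq {y m : L2s} {F G : ℝ → ℂ} (hy : y =ᵐ[symMeasure] F) (hm : m =ᵐ[symMeasure] G)
    (hF : Continuous F) (hG : Continuous G) :
    (inner ℂ y m).re = ∫ x in (-1 : ℝ)..1, inner ℝ (F x) (G x) := by
  have hc : Continuous fun x => inner ℂ (F x) (G x) := hF.inner hG
  have e1 : inner ℂ y m = ∫ x in (-1 : ℝ)..1, inner ℂ (F x) (G x) := by
    rw [MeasureTheory.L2.inner_def, intervalIntegral.integral_of_le (by norm_num),
      integral_Ioc_eq_integral_Ioo]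
    refine integral_congr_ae ?_
    filter_upwards [hy, hm] with x a b
    rw [a, b]
  rw [e1, ← Complex.reCLM_apply, ← Complex.reCLM.intervalIntegral_comp_comm
    (hc.intervalIntegrable _ _)]
  refine intervalIntegral.integral_congr fun x _ => ?_
  simp [Complex.inner, mul_comm]

/-- Integration by parts of ½(1-x)(|w|²)': the boundary term vanishes at 1 and is -|w(-1)|² at -1.
This is the dissipativity behind uniqueness. -/
theorem re_inner_oneSub_le {n : ℕ} (w : Sob (n + 2)) :
    (inner ℂ (toL2 (n + 2) w) (mulL2 oneSub (toL2 (n + 1) (tail w)))).re ≤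
      1 / 2 * ‖toL2 (n + 2) w‖ ^ 2 := by
  set g := ev n (tail w) with hg
  have hgc := xt_continuous g
  set W : ℝ → ℂ := fun x => head w + ∫ s in (1 : ℝ)..x, xt g s with hW
  have hWd : ∀ x, HasDerivAt W (xt g x) x := fun x =>
    (hgc.integral_hasStrictDerivAt 1 x).hasDerivAt.const_add _
  have hWc : Continuous W := continuous_iff_continuousAt.2 fun x => (hWd x).continuousAt
  have hy : toL2 (n + 2) w =ᵐ[symMeasure] W := by
    rw [toL2_succ]
    filter_upwards [cl_ae (ev (n + 1) w), ae_mem_sym] with x hx hm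
    rw [hx, xt_ev_succ w (Ioo_subset_Icc_self hm)]
  have hm : mulL2 oneSub (toL2 (n + 1) (tail w)) =ᵐ[symMeasure]
      fun x => ((1 - x : ℝ) : ℂ) * xt g x := by
    rw [toL2_succ, mulL2_cl]
    filter_upwards [cl_ae (oneSub * ev n (tail w)), ae_mem_sym] with x hx hm
    rw [hx, xt_mul, xt_oneSub (Ioo_subset_Icc_self hm)]
    push_cast
    rfl
  have c1 : Continuous fun x => inner ℝ (W x) (((1 - x : ℝ) : ℂ) * xt g x) :=
    hWc.inner (by fun_prop)
  have c2 : Continuous fun x => inner ℝ (W x) (W x) := hWc.inner hWc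
  have hd : ∀ x, HasDerivAt (fun x => (1 / 2 * (1 - x)) * ‖W x‖ ^ 2)
      (inner ℝ (W x) (((1 - x : ℝ) : ℂ) * xt g x) - 1 / 2 * inner ℝ (W x) (W x)) x := by
    intro x
    have h1 := (((hasDerivAt_id x).const_sub 1).const_mul (1 / 2 : ℝ)).mul (hWd x).norm_sq
    refine h1.congr_deriv ?_
    rw [← Complex.real_smul, inner_smul_right, real_inner_self_eq_norm_sq]
    simp only [id]
    ring
  have key := intervalIntegral.integral_eq_sub_of_hasDerivAt (a := (-1 : ℝ)) (b := 1)
    (fun x _ => hd x) ((c1.sub (c2.const_mul (1 / 2))).intervalIntegrable _ _)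
  rw [intervalIntegral.integral_sub (c1.intervalIntegrable _ _)
    ((c2.const_mul (1 / 2)).intervalIntegrable _ _), intervalIntegral.integral_const_mul] at key
  have h2 : ‖toL2 (n + 2) w‖ ^ 2 = ∫ x in (-1 : ℝ)..1, inner ℝ (W x) (W x) := by
    rw [← re_inner_eq hy hy hWc hWc]
    exact (inner_self_eq_norm_sq (𝕜 := ℂ) _).symm
  rw [re_inner_eq hy hm hWc (by fun_prop), h2]
  nlinarith [sq_nonneg ‖W (-1)‖]

/-- The potential term is a bounded function of the L² class alone, as an estimate closing in L²
requires. -/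
theorem exists_pot_eq (P : ℝ) (n : ℕ) :
    ∃ K : L2s →L[ℂ] CI, ∀ w : Sob n, ev n (pot P n w) = K (toL2 n w) := by
  refine ⟨prim0.comp ((((P : ℂ) * (1 / 2)) • (-(evalCI (-1)).comp primL2)).prod
    ((P : ℂ) • ((1 / 2 : ℂ) • (ContinuousLinearMap.id ℂ L2s + reflL2)))), fun w => ?_⟩
  rw [ev_eq_prim0, head_pot, tail_pot, integ_apply, map_smul, evenP_apply, map_smul, map_add,
    toL2_refl, ← mul_assoc]
  rfl

theorem norm_pow_sub_pow_le_of_bound {x y : ℂ} {R : ℝ} (hR : 1 ≤ R) (hx : ‖x‖ ≤ R) (hy : ‖y‖ ≤ R)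
    (j : ℕ) : ‖x ^ j - y ^ j‖ ≤ j * R ^ j * ‖x - y‖ := by
  have hR0 : 0 ≤ R := by linarith
  induction j with
  | zero => simp
  | succ j ih =>
    have e : x ^ (j + 1) - y ^ (j + 1) = x ^ j * (x - y) + (x ^ j - y ^ j) * y := by ring
    have h1 : ‖x‖ ^ j ≤ R ^ j := pow_le_pow_left₀ (norm_nonneg _) hx j
    have h2 : R ^ j ≤ R ^ (j + 1) := pow_le_pow_right₀ hR (Nat.le_succ j)
    rw [e]
    refine (norm_add_le _ _).trans ?_
    rw [norm_mul, norm_mul, norm_pow]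
    calc ‖x‖ ^ j * ‖x - y‖ + ‖x ^ j - y ^ j‖ * ‖y‖
        ≤ R ^ (j + 1) * ‖x - y‖ + j * R ^ j * ‖x - y‖ * R := by
          gcongr
          exact h1.trans h2
      _ = ((j + 1 : ℕ) : ℝ) * R ^ (j + 1) * ‖x - y‖ := by
          push_cast
          ring

/-- On a ball of Hⁿ⁺¹ the averages are uniformly bounded, so differences of powers are controlled by
the difference of the averages. The prefactor x turns that difference into ∫₀ˣ of an even part,
which the L² norm bounds. -/
theorem exists_nonlin_lipschitz (b : ℕ → ℝ) (p n : ℕ) (M : ℝ) :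
    ∃ L, 0 ≤ L ∧ ∀ v w : Sob (n + 1), ‖v‖ ≤ M → ‖w‖ ≤ M →
      ‖ev (n + 1) (nonlin b p n v) - ev (n + 1) (nonlin b p n w)‖ ≤
        L * ‖toL2 (n + 1) (v - w)‖ := by
  let A : Sob (n + 1) →L[ℂ] CI := (avC 0).comp ((ev n).comp (evenP (n + 1)))
  obtain ⟨K, hK⟩ := exists_pot_eq 1 (n + 1)
  set R := max 1 (‖A‖ * M) with hR
  have hR0 : 0 ≤ R := zero_le_one.trans (le_max_left _ _)
  refine ⟨(∑ j ∈ Finset.Icc 2 p, |b j| * (j * R ^ j)) * ‖K‖, by positivity, fun v w hv hw => ?_⟩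
  have hb : ∀ u : Sob (n + 1), ‖u‖ ≤ M → ∀ x, ‖xt (A u) x‖ ≤ R := fun u hu x =>
    (norm_xt_le _ x).trans ((A.le_opNorm u).trans
      ((mul_le_mul_of_nonneg_left hu (norm_nonneg _)).trans (le_max_right _ _)))
  rw [ContinuousMap.norm_le _ (by positivity)]
  intro x
  have hx := x.2
  rw [← xt_coe, xt_sub, xt_ev_nonlin _ _ _ _ hx, xt_ev_nonlin _ _ _ _ hx, ← Finset.sum_sub_distrib,
    mul_assoc, Finset.sum_mul]
  refine norm_sum_le_of_le _ fun j _ => ?_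
  have hd : ‖(x : ℂ) * (xt (A v) x - xt (A w) x)‖ ≤ ‖K‖ * ‖toL2 (n + 1) (v - w)‖ := by
    have e : (x : ℂ) * (xt (A v) x - xt (A w) x) = xt (K (toL2 (n + 1) (v - w))) x := by
      rw [← xt_sub, ← map_sub, ← hK, xt_ev_pot _ _ hx, Complex.ofReal_one, one_mul]
      exact mul_xt_avC _ hx
    rw [e]
    exact (norm_xt_le _ _).trans (K.le_opNorm _)
  have e2 : (b j : ℂ) * (x * xt (A v) x ^ j) - (b j : ℂ) * (x * xt (A w) x ^ j) =
      (b j : ℂ) * (x * (xt (A v) x ^ j - xt (A w) x ^ j)) := by ring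
  change ‖(b j : ℂ) * (x * xt (A v) x ^ j) - (b j : ℂ) * (x * xt (A w) x ^ j)‖ ≤ _
  have h3 := norm_pow_sub_pow_le_of_bound (le_max_left 1 (‖A‖ * M)) (hb v hv x) (hb w hw x) j
  rw [norm_mul] at hd
  rw [e2, norm_mul, norm_mul, Complex.norm_real, Real.norm_eq_abs, mul_assoc]
  refine mul_le_mul_of_nonneg_left ?_ (abs_nonneg _)
  calc ‖(x : ℂ)‖ * ‖xt (A v) x ^ j - xt (A w) x ^ j‖
      ≤ ‖(x : ℂ)‖ * (j * R ^ j * ‖xt (A v) x - xt (A w) x‖) := by gcongr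
    _ = j * R ^ j * (‖(x : ℂ)‖ * ‖xt (A v) x - xt (A w) x‖) := by ring
    _ ≤ _ := by gcongr

/-- `φ` solves the evolution equation at time `t`, as an identity in `L²(-1,1)`. -/
def SolvesL2At (a P : ℝ) (b : ℕ → ℝ) (p n : ℕ) (φ : ℝ → Sob (n + 2)) (t : ℝ) : Prop :=
  ∃ φ', HasDerivAt φ φ' t ∧ toL2 (n + 2) φ' =
    mulL2 oneSub (toL2 (n + 1) (tail (φ t))) - (a : ℂ) • toL2 (n + 2) (φ t) +
      toL2 (n + 3) (pot P (n + 2) (φ t)) + toL2 (n + 3) (nonlin b p (n + 1) (φ t))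

theorem SolvesAt.solvesL2At {a P : ℝ} {b : ℕ → ℝ} {p n : ℕ} {φ : ℝ → Sob (n + 2)} {t : ℝ}
    (h : SolvesAt a P b p n φ t) : SolvesL2At a P b p n φ t := by
  obtain ⟨z, hz, hd⟩ := h
  refine ⟨_, hd, ?_⟩
  rw [map_add, toL2_incl, map_add, ← toL2_freeGen, ← hz, toL2_incl]
  exact (add_assoc _ _ _).symm

theorem continuousOn_of_hasDerivAt {E : Type*} [NormedAddCommGroup E] [NormedSpace ℝ E]
    {φ : ℝ → E} (h0 : ContinuousWithinAt φ (Ici 0) 0)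
    (hd : ∀ t > 0, DifferentiableAt ℝ φ t) : ContinuousOn φ (Ici 0) := by
  intro t ht
  rcases eq_or_lt_of_le (mem_Ici.1 ht) with h | h
  · rwa [← h]
  · exact (hd t h).continuousAt.continuousWithinAt

/-- Gronwall for the squared L² norm of the difference: transport contributes at most one half,
damping has the good sign, and the remaining terms are Lipschitz in L². -/
theorem eq_of_solvesL2At {a P : ℝ} (ha : 0 ≤ a) {b : ℕ → ℝ} {p n : ℕ} {φ ψ : ℝ → Sob (n + 2)}
    (hφ0 : ContinuousWithinAt φ (Ici 0) 0) (hψ0 : ContinuousWithinAt ψ (Ici 0) 0)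
    (h0 : φ 0 = ψ 0) (hφ : ∀ t > 0, SolvesL2At a P b p n φ t)
    (hψ : ∀ t > 0, SolvesL2At a P b p n ψ t) : EqOn φ ψ (Ici 0) := by
  intro T hT
  rw [mem_Ici] at hT
  have hcφ := continuousOn_of_hasDerivAt hφ0 fun t ht => (hφ t ht).choose_spec.1.differentiableAt
  have hcψ := continuousOn_of_hasDerivAt hψ0 fun t ht => (hψ t ht).choose_spec.1.differentiableAt
  -- No smallness is assumed of either solution; boundedness on the compact interval [0,T] makes the
  -- local Lipschitz bound available.
  obtain ⟨M₁, hM₁⟩ := isCompact_Icc.exists_bound_of_continuousOn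
    (hcφ.mono (show Icc 0 T ⊆ Ici 0 from Icc_subset_Ici_self))
  obtain ⟨M₂, hM₂⟩ := isCompact_Icc.exists_bound_of_continuousOn
    (hcψ.mono (show Icc 0 T ⊆ Ici 0 from Icc_subset_Ici_self))
  obtain ⟨L, hL0, hL⟩ := exists_nonlin_lipschitz b p (n + 1) (max M₁ M₂)
  obtain ⟨K, hK⟩ := exists_pot_eq P (n + 2)
  set C := 1 / 2 + ‖(cl : CI →L[ℂ] L2s)‖ * ‖K‖ + ‖(cl : CI →L[ℂ] L2s)‖ * L with hC
  set y : ℝ → L2s := fun t => toL2 (n + 2) (φ t - ψ t) with hy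
  have hyc : ContinuousOn y (Icc 0 T) := (toL2 (n + 2)).continuous.comp_continuousOn
    ((hcφ.sub hcψ).mono Icc_subset_Ici_self)
  have hder : ∀ t ∈ Ioo 0 T, ∃ y', HasDerivAt y y' t ∧ (inner ℂ (y t) y').re ≤ C * ‖y t‖ ^ 2 := by
    intro t ht
    obtain ⟨φ', d1, e1⟩ := hφ t ht.1
    obtain ⟨ψ', d2, e2⟩ := hψ t ht.1
    refine ⟨toL2 (n + 2) (φ' - ψ'),
      ((toL2 (n + 2)).restrictScalars ℝ).hasFDerivAt.comp_hasDerivAt t (d1.sub d2), ?_⟩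
    have hN := hL (φ t) (ψ t) ((hM₁ t (Ioo_subset_Icc_self ht)).trans (le_max_left _ _))
      ((hM₂ t (Ioo_subset_Icc_self ht)).trans (le_max_right _ _))
    set θ := φ t - ψ t with hθ
    have e : toL2 (n + 2) (φ' - ψ') = mulL2 oneSub (toL2 (n + 1) (tail θ)) - (a : ℂ) • y t +
        cl (K (y t)) + cl (ev (n + 2) (nonlin b p (n + 1) (φ t)) -
          ev (n + 2) (nonlin b p (n + 1) (ψ t))) := by
      simp only [hy]
      rw [← hK, ← toL2_succ, map_sub, e1, e2, hθ]
      simp only [map_sub, toL2_succ (n := n + 2), smul_sub]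
      abel
    have i1 := re_inner_oneSub_le θ
    have i2 : (inner ℂ (y t) ((a : ℂ) • y t)).re = a * ‖y t‖ ^ 2 := by
      rw [inner_smul_right, inner_self_eq_norm_sq_to_K, Complex.re_ofReal_mul]
      norm_cast
    have bnd : ∀ x : L2s, (inner ℂ (y t) x).re ≤ ‖y t‖ * ‖x‖ := fun x =>
      (Complex.re_le_norm _).trans (norm_inner_le_norm _ _)
    have i3 : (inner ℂ (y t) (cl (K (y t)))).re ≤
        ‖(cl : CI →L[ℂ] L2s)‖ * ‖K‖ * ‖y t‖ ^ 2 := by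
      refine (bnd _).trans ?_
      calc ‖y t‖ * ‖cl (K (y t))‖ ≤ ‖y t‖ * (‖(cl : CI →L[ℂ] L2s)‖ * (‖K‖ * ‖y t‖)) := by
            gcongr
            exact (cl.le_opNorm _).trans (by gcongr; exact K.le_opNorm _)
        _ = _ := by ring
    have i4 : (inner ℂ (y t) (cl (ev (n + 2) (nonlin b p (n + 1) (φ t)) -
        ev (n + 2) (nonlin b p (n + 1) (ψ t))))).re ≤
        ‖(cl : CI →L[ℂ] L2s)‖ * L * ‖y t‖ ^ 2 := by
      refine (bnd _).trans ?_
      calc _ ≤ ‖y t‖ * (‖(cl : CI →L[ℂ] L2s)‖ * (L * ‖y t‖)) := by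
            gcongr
            exact (cl.le_opNorm _).trans (by gcongr)
        _ = _ := by ring
    rw [e, inner_add_right, inner_add_right, inner_sub_right, Complex.add_re, Complex.add_re,
      Complex.sub_re, i2]
    have i5 : 0 ≤ a * ‖y t‖ ^ 2 := by positivity
    have i1' : (inner ℂ (y t) (mulL2 oneSub (toL2 (n + 1) (tail θ)))).re ≤ 1 / 2 * ‖y t‖ ^ 2 := i1
    rw [hC, add_mul, add_mul]
    linarith
  have hanti : AntitoneOn (fun t => Real.exp (-(2 * C) * t) * ‖y t‖ ^ 2) (Icc 0 T) := by
    have hD : ∀ t ∈ Ioo 0 T, ∃ d ≤ 0,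
        HasDerivAt (fun t => Real.exp (-(2 * C) * t) * ‖y t‖ ^ 2) d t := by
      intro t ht
      obtain ⟨y', d1, le⟩ := hder t ht
      have d2 : HasDerivAt (fun t => ‖y t‖ ^ 2) (2 * (inner ℂ (y t) y').re) t := by
        have h1 := Complex.reCLM.hasFDerivAt.comp_hasDerivAt t (d1.inner ℂ d1)
        have h2 : (⇑Complex.reCLM ∘ fun t => inner ℂ (y t) (y t)) = fun t => ‖y t‖ ^ 2 := by
          ext s
          exact inner_self_eq_norm_sq (𝕜 := ℂ) (y s)
        rw [h2] at h1
        refine h1.congr_deriv ?_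
        rw [map_add, Complex.reCLM_apply, Complex.reCLM_apply, ← inner_conj_symm y' (y t),
          Complex.conj_re]
        ring
      have d3 : HasDerivAt (fun t => Real.exp (-(2 * C) * t))
          (Real.exp (-(2 * C) * t) * (-(2 * C))) t := by
        simpa using ((hasDerivAt_id t).const_mul (-(2 * C))).exp
      refine ⟨_, ?_, d3.mul d2⟩
      have hp := Real.exp_pos (-(2 * C) * t)
      nlinarith
    refine antitoneOn_of_deriv_nonpos (convex_Icc 0 T) ?_ ?_ ?_
    · exact (Continuous.continuousOn (by fun_prop)).mul (hyc.norm.pow 2)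
    · rw [interior_Icc]
      intro t ht
      obtain ⟨d, -, hd⟩ := hD t ht
      exact hd.differentiableAt.differentiableWithinAt
    · rw [interior_Icc]
      intro t ht
      obtain ⟨d, hd0, hd⟩ := hD t ht
      rwa [hd.deriv]
  have hle := hanti (left_mem_Icc.2 hT) (right_mem_Icc.2 hT) hT
  have hy0 : y 0 = 0 := by simp only [hy, h0, sub_self, map_zero]
  simp only [hy0, norm_zero, ne_eq, OfNat.ofNat_ne_zero, not_false_eq_true, zero_pow,
    mul_zero] at hle
  have hyT : y T = 0 := by
    have hp := Real.exp_pos (-(2 * C) * T)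
    have h1 : ‖y T‖ ^ 2 ≤ 0 := by
      by_contra hcon
      rw [not_le] at hcon
      have := mul_pos hp hcon
      linarith
    exact norm_eq_zero.1 ((pow_eq_zero_iff two_ne_zero).1 (le_antisymm h1 (sq_nonneg _)))
  have h2 : φ T - ψ T = 0 := toL2_injective (n + 2) (hyT.trans (map_zero _).symm)
  exact sub_eq_zero.1 h2

/-! ### Transfer to `H^{2k}` -/

theorem exists_gen_eq {p : ℕ} {u v : H} (h : (u, v) ∈ (gen p).graph) :
    ∃ hu : u ∈ (gen p).domain, gen p ⟨u, hu⟩ = v := by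
  obtain ⟨y, hy⟩ := (gen p).mem_graph_iff'.1 h
  obtain ⟨rfl, rfl⟩ := Prod.ext_iff.1 hy
  exact ⟨y.2, rfl⟩

section Transfer

variable {k n : ℕ} {J : Sob (n + 2) ≃L[ℂ] H2k k}

theorem toH_eq_split (hJ : ∀ w, toH (J w) = split (toL2 (n + 2) w)) (u : H2k k) :
    toH u = split (toL2 (n + 2) (J.symm u)) := by
  rw [← hJ, J.apply_symm_apply]

theorem isSolution_of_solvesL2At (hJ : ∀ w, toH (J w) = split (toL2 (n + 2) w)) {p : ℕ}
    {φ : ℝ → Sob (n + 2)} (hc : Continuous φ)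
    (hφ : ∀ t > 0, SolvesL2At (2 / (p - 1)) (p * c0 p) (coeffN p) p n φ t) :
    IsSolution p k (J (φ 0)) fun t => J (φ t) := by
  refine ⟨rfl, (J.continuous.comp hc).continuousAt.continuousWithinAt, fun t ht => ?_⟩
  obtain ⟨φ', hd, he⟩ := hφ t ht
  refine ⟨J φ', ((J : Sob (n + 2) →L[ℂ] H2k k).restrictScalars ℝ).hasFDerivAt.comp_hasDerivAt t hd,
    ?_⟩
  obtain ⟨hu, hg⟩ := exists_gen_eq (split_mem_graph p (φ t))
  simp only [hJ]
  refine ⟨hu, _, isNonlinearity_split p (φ t), ?_⟩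
  rw [hg, he, ← map_smul split, ← map_sub split, ← map_add split]
  congr 1
  abel

theorem IsSolution.solvesL2At (hJ : ∀ w, toH (J w) = split (toL2 (n + 2) w)) {p : ℕ} {v : H2k k}
    {Ψ : ℝ → H2k k} (hΨ : IsSolution p k v Ψ) (t : ℝ) (ht : t > 0) :
    SolvesL2At (2 / (p - 1)) (p * c0 p) (coeffN p) p n (fun t => J.symm (Ψ t)) t := by
  obtain ⟨Ψ', hd, hu, w, hw, he⟩ := hΨ.equation t ht
  refine ⟨J.symm Ψ',
    ((J.symm : H2k k →L[ℂ] Sob (n + 2)).restrictScalars ℝ).hasFDerivAt.comp_hasDerivAt t hd, ?_⟩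
  obtain ⟨hu', hg⟩ := exists_gen_eq (split_mem_graph p (J.symm (Ψ t)))
  simp only [toH_eq_split hJ] at he hw hu
  rw [hg, hw.eq (isNonlinearity_split p (J.symm (Ψ t))), ← map_smul, ← map_sub, ← map_add] at he
  rw [split_injective he]
  abel

/-- Solving for the transport term, (1-x)w' - a w is Lu - a u minus the potential, all of which lie
in the full space. So applying the free generator to such data loses no derivative. -/
theorem InPartDomain.exists_incl_eq (hJ : ∀ w, toH (J w) = split (toL2 (n + 2) w)) {p : ℕ}
    {u : H2k k} (hu : InPartDomain p k u) (a : ℝ) : ∃ z, incl z = freeGen a (J.symm u) := by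
  obtain ⟨h, v, hv⟩ := hu
  obtain ⟨hu', hg⟩ := exists_gen_eq (split_mem_graph p (J.symm u))
  simp only [toH_eq_split hJ] at hv
  rw [hg] at hv
  refine ⟨J.symm v - (a : ℂ) • J.symm u - incl (pot (p * c0 p) (n + 2) (J.symm u)), ?_⟩
  apply toL2_injective (n + 1)
  rw [toL2_incl, toL2_freeGen, map_sub, map_sub, map_smul, toL2_incl, ← split_injective hv]
  abel

theorem symm_gaugeMode (hJ : ∀ w, toH (J w) = split (toL2 (n + 2) w)) (p : ℕ) :
    J.symm (gaugeMode p k) = (gaugeFactor p : ℂ) • growMode (2 / (p - 1)) n := by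
  apply toL2_injective (n + 2)
  apply split_injective
  rw [← toH_eq_split hJ, map_smul, map_smul]
  set a : ℝ := 2 / (p - 1) with ha
  set g := ev (n + 1) (growMode a n) with hg
  have hval : ∀ x ∈ Icc (-1 : ℝ) 1, xt g x = 1 + (1 + a) * x := by
    intro x hx
    rw [hg, growMode, xt_ev_affine _ _ hx]
    push_cast
    ring
  rw [toL2_succ]
  refine WithLp.ofLp_injective 2 (Prod.ext ?_ ?_)
  · change affine (gaugeFactor p * gaugeEigenvalue p) 0 =
      (gaugeFactor p : ℂ) • (split (cl g)).fst
    rw [split_fst, smul_smul]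
    apply Lp.ext
    filter_upwards [affine_ae (gaugeFactor p * gaugeEigenvalue p) 0,
      Lp.coeFn_smul ((gaugeFactor p : ℂ) * (1 / 2)) (resP (cl g) - resN (cl g)),
      Lp.coeFn_sub (resP (cl g)) (resN (cl g)), resP_cl g, resN_cl g, ae_mem_unit]
      with x h1 h2 h3 h4 h5 hm
    have hx : x ∈ Icc (-1 : ℝ) 1 := ⟨by linarith [hm.1], hm.2.le⟩
    rw [h1, h2, Pi.smul_apply, h3, Pi.sub_apply, h4, h5, hval x hx, hval (-x) (neg_mem_sym hx),
      gaugeEigenvalue, ← ha, smul_eq_mul]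
    push_cast
    ring
  · change affine 0 (gaugeFactor p) = (gaugeFactor p : ℂ) • (split (cl g)).snd
    rw [split_snd, smul_smul]
    apply Lp.ext
    filter_upwards [affine_ae 0 (gaugeFactor p),
      Lp.coeFn_smul ((gaugeFactor p : ℂ) * (1 / 2)) (resP (cl g) + resN (cl g)),
      Lp.coeFn_add (resP (cl g)) (resN (cl g)), resP_cl g, resN_cl g, ae_mem_unit]
      with x h1 h2 h3 h4 h5 hm
    have hx : x ∈ Icc (-1 : ℝ) 1 := ⟨by linarith [hm.1], hm.2.le⟩
    rw [h1, h2, Pi.smul_apply, h3, Pi.add_apply, h4, h5, hval x hx, hval (-x) (neg_mem_sym hx),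
      smul_eq_mul]
    push_cast
    ring

theorem IsSolution.eqOn (hJ : ∀ w, toH (J w) = split (toL2 (n + 2) w)) {p : ℕ}
    (ha : (0 : ℝ) ≤ 2 / (p - 1)) {v : H2k k} {Φ Ψ : ℝ → H2k k} (hΦ : IsSolution p k v Φ)
    (hΨ : IsSolution p k v Ψ) : EqOn Φ Ψ (Ici 0) := by
  have h := eq_of_solvesL2At ha (φ := fun t => J.symm (Φ t)) (ψ := fun t => J.symm (Ψ t))
    (J.symm.continuous.continuousAt.comp_continuousWithinAt hΦ.continuous_zero)
    (J.symm.continuous.continuousAt.comp_continuousWithinAt hΨ.continuous_zero)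
    (by simp only [hΦ.initial, hΨ.initial]) (hΦ.solvesL2At hJ) (hΨ.solvesL2At hJ)
  exact fun t ht => J.symm.injective (h ht)

end Transfer

/-! ### Proof of the stability theorem -/

theorem gaugeFactor_pos (p : ℕ) : 0 < gaugeFactor p :=
  inv_pos.2 (Real.sqrt_pos.2 (by positivity))

/-- The algebraic identity on which the eigenvalues 1 and -2-2a depend, with a = 2/(p-1). -/
theorem potential_eq {p : ℕ} (hp : 1 < p) :
    (p * c0 p : ℝ) = (1 + 2 / (p - 1)) * (2 + 2 / (p - 1)) := by
  have hp' : (p : ℝ) - 1 ≠ 0 := by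
    have : (1 : ℝ) < p := by exact_mod_cast hp
    linarith
  rw [c0]
  field_simp
  ring

theorem exists_stable_solution {p k n : ℕ} (hp : 1 < p) (hn : n + 2 = 2 * k)
    (hg : HasGrowth (2 / (p - 1)) (p * c0 p) n 1) :
    ∃ δ₀ : ℝ, 0 < δ₀ ∧ ∃ C : ℝ, 0 < C ∧ ∀ δ : ℝ, 0 < δ → δ ≤ δ₀ →
      ∀ u : H2k k, InPartDomain p k u → ‖u‖ ≤ δ ^ 2 → ∃ (α : ℂ) (Φ : ℝ → H2k k),
        IsSolution p k (u + α • gaugeMode p k) Φ ∧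
        (∀ τ : ℝ, 0 < τ → ‖Φ τ‖ ≤ C * Real.exp (-τ)) ∧
        ∀ Ψ : ℝ → H2k k, IsSolution p k (u + α • gaugeMode p k) Ψ → EqOn Ψ Φ (Ici 0) := by
  have ha : (0 : ℝ) ≤ 2 / (p - 1) := by
    have : (1 : ℝ) < p := by exact_mod_cast hp
    exact div_nonneg zero_le_two (by linarith)
  obtain ⟨J, hJ⟩ := exists_equiv hn
  obtain ⟨ε, hε, hsol⟩ := exists_strong_solution ha (potential_eq hp) (coeffN p) p hg
  set A := ‖(J.symm : H2k k →L[ℂ] Sob (n + 2))‖ with hA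
  have hA0 : 0 ≤ A := ContinuousLinearMap.opNorm_nonneg _
  -- For δ ≤ 1 one has δ² ≤ δ, so the bound on δ transfers to δ², and A + 1 pays for the passage to
  -- the model space.
  refine ⟨min 1 (ε / (A + 1)), by positivity, ‖(J : Sob (n + 2) →L[ℂ] H2k k)‖ + 1, by positivity,
    fun δ hδ hδ' u hu hun => ?_⟩
  obtain ⟨z, hz⟩ := hu.exists_incl_eq hJ (2 / (p - 1))
  have hsmall : ‖J.symm u‖ ≤ ε := by
    have h1 : ‖J.symm u‖ ≤ A * ‖u‖ := (J.symm : H2k k →L[ℂ] Sob (n + 2)).le_opNorm u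
    have h2 : δ ^ 2 ≤ ε / (A + 1) := by
      have := hδ'.trans (min_le_left _ _)
      exact (by nlinarith : δ ^ 2 ≤ δ).trans (hδ'.trans (min_le_right _ _))
    calc ‖J.symm u‖ ≤ A * ‖u‖ := h1
      _ ≤ (A + 1) * (ε / (A + 1)) := by
          gcongr
          · linarith
          · exact hun.trans h2
      _ = ε := by field_simp
  obtain ⟨α, φ, hc, h0, hs, hb⟩ := hsol (J.symm u) z hz hsmall
  have hf : (gaugeFactor p : ℂ) ≠ 0 := by exact_mod_cast (gaugeFactor_pos p).ne'
  -- The gauge mode is the growing mode times the normalization factor, so the coefficient is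
  -- divided by that factor.
  have hinit : J (φ 0) = u + (α / gaugeFactor p) • gaugeMode p k := by
    apply J.symm.injective
    rw [J.symm_apply_apply, h0, map_add, map_smul, symm_gaugeMode hJ, smul_smul,
      div_mul_cancel₀ _ hf]
  have hΦ : IsSolution p k (u + (α / gaugeFactor p) • gaugeMode p k) fun t => J (φ t) := by
    rw [← hinit]
    exact isSolution_of_solvesL2At hJ hc fun t ht => (hs t ht).solvesL2At
  refine ⟨α / gaugeFactor p, fun t => J (φ t), hΦ, fun τ hτ => ?_, fun Ψ hΨ => hΨ.eqOn hJ ha hΦ⟩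
  calc ‖J (φ τ)‖ ≤ ‖(J : Sob (n + 2) →L[ℂ] H2k k)‖ * ‖φ τ‖ :=
        (J : Sob (n + 2) →L[ℂ] H2k k).le_opNorm _
    _ ≤ (‖(J : Sob (n + 2) →L[ℂ] H2k k)‖ + 1) * Real.exp (-τ) := by
        gcongr
        · linarith
        · exact hb τ hτ.le

end

end WaveStability

theorem mainTheorem1 (p : ℕ) (hp : 3 ≤ p) (hodd : Odd p) :
    ∃ k₀ : ℕ, ∀ k : ℕ, k₀ ≤ k →
      ∃ δ₀ : ℝ, 0 < δ₀ ∧ ∃ C : ℝ, 0 < C ∧ ∀ δ : ℝ, 0 < δ → δ ≤ δ₀ →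
        ∀ u : WaveStability.H2k k, WaveStability.InPartDomain p k u → ‖u‖ ≤ δ ^ 2 →
          ∃ (α : ℂ) (Φ : ℝ → WaveStability.H2k k),
            WaveStability.IsSolution p k (u + α • WaveStability.gaugeMode p k) Φ ∧
            (∀ τ : ℝ, 0 < τ → ‖Φ τ‖ ≤ C * Real.exp (-τ)) ∧
            ∀ Ψ : ℝ → WaveStability.H2k k,
              WaveStability.IsSolution p k (u + α • WaveStability.gaugeMode p k) Ψ →
                Set.EqOn Ψ Φ (Set.Ici 0) := by
  have hp1 : 1 < p := by omega
  have ha : (0 : ℝ) ≤ 2 / (p - 1) := by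
    have : (1 : ℝ) < p := by exact_mod_cast hp1
    exact div_nonneg zero_le_two (by linarith)
  obtain ⟨m, hm⟩ := WaveStability.exists_hasGrowth_one ha (WaveStability.potential_eq hp1)
  -- Rate one is needed at order 2(k-1); the last two derivatives are spent on the dichotomy.
  refine ⟨m + 1, fun k hk => ?_⟩
  obtain ⟨j, rfl⟩ : ∃ j, k = j + 1 := ⟨k - 1, by omega⟩
  exact WaveStability.exists_stable_solution hp1 (n := 2 * j) (by omega) (hm j (by omega))
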